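/- **Setting.** An election consists of a finite set $C$ of candidates and a finite collection $V$ of voters, each of whom strictly ranks all candidates in $C$. For a subset $C'\subseteq C$, $(C',V)$ denotes the election in which the rankings are restricted to $C'$. An election system $\mathcal E$ maps every election $(C,V)$ to a set $\mathcal E(C,V)\subseteq C$ of winners (possibly empty, possibly with several elements). We consider three systems. * *Kemeny*: $c$ is a winner if $c$ is the most preferred candidate in some total order $>$ on $C$ that minimizes $\sum_{a,b\in C,\ a>b}\|\{v\in V : b>_v a\}\|$. * *Young*: $c$ is a winner if the smallest number of voters whose deletion makes $c$ a weak Condorcet winner (a candidate that beats or ties every other candidate pairwise) is minimal among all candidates. * *Dodgson*: $c$ is a winner if $c$ can be made a Condorcet winner (a candidate that beats every other candidate pairwise) by swaps of adjacent candidates in the voters' rankings, and the smallest number of swaps that suffices is minimal among all candidates. (If no candidate can be made a Condorcet winner, there is no winner.) **Control problems.** An instance always contains a distinguished candidate $p\in C$. In the *constructive* problem the question is whether the chair has an action of the given type after which $p$ is a winner; in the *destructive* problem, whether there is one after which $p$ is not a winner. Limits $k\in\mathbb N$ are part of the input, written in binary; voters are listed one by one. The types of action are the following. 1. *Adding candidates*: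 given disjoint sets $C,D$, voters $V$ ranking $C\cup D$, and $k$, choose $D'\subseteq D$ with $\|D'\|\le k$; the election is $(C\cup D',V)$. 2. *Adding an unlimited number of candidates*: the same without $k$ and without the bound on $\|D'\|$. 3. *Deleting candidates*: given $(C,V)$ and $k$, choose $D'\subseteq C\setminus\{p\}$ with $\|D'\|\le k$; the election is $(C\setminus D',V)$. 4. *Deleting candidates from a given set*: as in 3, but a set $D\subseteq C$ is also given and $D'\subseteq D\setminus\{p\}$. 5. *Adding voters*: given a candidate set $C$, collections $V,W$ of voters over $C$, and $k$, choose $W'\subseteq W$ with $\|W'\|\le k$; the election is $(C,V\cup W')$. 6. *Deleting voters*: given $(C,V)$ and $k$, choose $V'\subseteq V$ with $\|V'\|\le k$; the election is $(C,V\setminus V')$. 7. *Partition of candidates*: given $(C,V)$, partition $C$ into $C_1,C_2$ (parts may be empty); the final election is $(S_1\cup C_2,V)$, where $S_1$ is the set of survivors of $(C_1,V)$. 8. *Runoff partition of candidates*: the same with final election $(S_1\cup S_2,V)$, where $S_i$ is the set of survivors of $(C_i,V)$. 9. *Partition of voters*: given $(C,V)$, partition $V$ into $V_1,V_2$ (parts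 may be empty); the final election is $(S_1\cup S_2,V)$, where $S_i$ is the set of survivors of $(C,V_i)$. Each of 7, 8, 9 comes in two versions. Under *ties promote* the survivors of an election are all its winners; under *ties eliminate* the survivor is its unique winner if there is exactly one winner, and otherwise nobody survives. **Corollary 3.2.** Let $\mathcal E$ be Kemeny, Young, or Dodgson. Then for each of the action types 1–9 (7, 8 and 9 under either tie-handling rule), both the constructive and the destructive control problem for $\mathcal E$ are in $\Sigma_2^p=\mathrm{NP}^{\mathrm{NP}}$, the class of languages decided by a nondeterministic polynomial-time oracle machine with an oracle from $\mathrm{NP}$. -/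

import Mathlib

/-! ## Nondeterministic polynomial time with an oracle -/

namespace Complexity

/-- One instruction of a machine with stacks of bits indexed by `K` and control states `Q`.
Every instruction costs one step. -/
inductive Instr (K Q : Type) : Type
  /-- Push the bit `b` on the stack `k` and go to `q`. -/
  | push (k : K) (b : Bool) (q : Q) : Instr K Q
  /-- If the stack `k` is empty, go to `qEmpty`; otherwise remove its top bit and go to
  `qFalse` or `qTrue`, depending on that bit. -/
  | pop (k : K) (qEmpty qFalse qTrue : Q) : Instr K Q
  /-- Nondeterministic choice: go to `qFalse` or to `qTrue`. -/
  | guess (qFalse qTrue : Q) : Instr K Q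
  /-- Ask the oracle about the string on the stack `k`, read from the top; the stack is kept. -/
  | query (k : K) (qNo qYes : Q) : Instr K Q
  /-- Stop, accepting (`true`) or rejecting (`false`). -/
  | halt (accept : Bool) : Instr K Q

/-- A nondeterministic oracle machine: finitely many stacks of bits (two stacks make up one
Turing machine tape), a finite set of control states, and a finite program that assigns an
instruction to each state. -/
structure OracleMachine where
  K : Type
  Q : Type
  [finiteK : Finite K]
  [finiteQ : Finite Q]
  [decEqK : DecidableEq K]
  /-- the stack that holds the input at the start -/
  input : K
  start : Q
  code : Q → Instr K Q

namespace OracleMachine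

/-- A configuration: the control state and the content of every stack (top first). -/
structure Cfg (M : OracleMachine) where
  state : M.Q
  stack : M.K → List Bool

/-- The initial configuration: the input is on the input stack, all other stacks are empty. -/
def init (M : OracleMachine) (x : List Bool) : M.Cfg :=
  letI := M.decEqK
  ⟨M.start, fun k => if k = M.input then x else []⟩

open Classical in
/-- One step with oracle `A`; `choice` decides where a `guess` instruction goes. A halted
configuration does not change any more. -/
noncomputable def step (M : OracleMachine) (A : Language Bool) (choice : Bool) (c : M.Cfg) :
    M.Cfg :=
  letI := M.decEqK
  match M.code c.state with
  | .push k b q => ⟨q, Function.update c.stack k (b :: c.stack k)⟩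
  | .pop k qEmpty qFalse qTrue =>
    match c.stack k with
    | [] => ⟨qEmpty, c.stack⟩
    | b :: l => ⟨if b = true then qTrue else qFalse, Function.update c.stack k l⟩
  | .guess qFalse qTrue => ⟨if choice = true then qTrue else qFalse, c.stack⟩
  | .query k qNo qYes => ⟨if c.stack k ∈ A then qYes else qNo, c.stack⟩
  | .halt _ => c

/-- The configuration after `t` steps on input `x` along the computation path in which the
`i`-th step uses the choice bit `path i`. -/
noncomputable def run (M : OracleMachine) (A : Language Bool) (path : ℕ → Bool) (x : List Bool) :
    ℕ → M.Cfg
  | 0 => M.init x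
  | t + 1 => M.step A (path t) (M.run A path x t)

/-- After `t` steps the computation path has halted with the given answer. -/
def HaltsWith (M : OracleMachine) (A : Language Bool) (path : ℕ → Bool) (x : List Bool) (t : ℕ)
    (answer : Bool) : Prop :=
  M.code (M.run A path x t).state = .halt answer

end OracleMachine

/-- `NP^A`: the languages `L` for which some nondeterministic machine with oracle `A` and some
polynomial `p` satisfy: on every input `x` all computation paths halt within `p (|x|)` steps,
and `x ∈ L` if and only if some computation path accepts. -/
def NPOracle (A : Language Bool) : Set (Language Bool) :=
  {L | ∃ (M : OracleMachine) (p : Polynomial ℕ), ∀ x : List Bool,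
    (∀ path, ∃ answer, M.HaltsWith A path x (p.eval x.length) answer) ∧
    (x ∈ L ↔ ∃ path, M.HaltsWith A path x (p.eval x.length) true)}

/-- `NP`: the oracle is trivial. -/
def NP : Set (Language Bool) := NPOracle (∅ : Set (List Bool))

/-- `Σ₂ᵖ = NP^NP`. -/
def SigmaTwo : Set (Language Bool) := {L | ∃ A ∈ NP, L ∈ NPOracle A}

end Complexity

/-! ## Elections -/

namespace Election

/-- A vote lists the candidates (named by natural numbers) from most to least preferred. -/
abbrev Vote := List ℕ

/-- The voters of an election, one entry for each voter. -/
abbrev Profile := List Vote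

/-- `r` is a strict ranking of exactly the candidates in `C`. -/
def IsRanking (C : Finset ℕ) (r : Vote) : Prop := r.Nodup ∧ r.toFinset = C

/-- Every voter in `V` ranks exactly the candidates in `C`. -/
def IsProfile (C : Finset ℕ) (V : Profile) : Prop := ∀ v ∈ V, IsRanking C v

/-- The votes restricted to the candidates in `C`. -/
def restrict (C : Finset ℕ) (V : Profile) : Profile := V.map fun v => v.filter fun c => c ∈ C

/-- The number of voters who prefer `a` to `b`. -/
def support (V : Profile) (a b : ℕ) : ℕ := V.countP fun v => v.idxOf a < v.idxOf b

/-- `c` beats every other candidate pairwise. -/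
def IsCondorcetWinner (C : Finset ℕ) (V : Profile) (c : ℕ) : Prop :=
  ∀ d ∈ C, d ≠ c → support V d c < support V c d

/-- `c` beats or ties every other candidate pairwise. -/
def IsWeakCondorcetWinner (C : Finset ℕ) (V : Profile) (c : ℕ) : Prop :=
  ∀ d ∈ C, d ≠ c → support V d c ≤ support V c d

/-- An election system maps an election, that is, a set `C` of candidates and a profile of
rankings of `C`, to its set of winners. -/
abbrev System := Finset ℕ → Profile → Finset ℕ

/-- The sum of the Kendall tau distances from the ranking `r` to the voters. -/
def kemenyDistance (C : Finset ℕ) (V : Profile) (r : Vote) : ℕ :=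
  ∑ a ∈ C, ∑ b ∈ C, if r.idxOf a < r.idxOf b then support V b a else 0

/-- A Kemeny consensus is a ranking that minimizes the total distance to the voters. -/
def IsKemenyConsensus (C : Finset ℕ) (V : Profile) (r : Vote) : Prop :=
  IsRanking C r ∧ ∀ s, IsRanking C s → kemenyDistance C V r ≤ kemenyDistance C V s

open Classical in
/-- The candidates that are on top of some Kemeny consensus. -/
noncomputable def kemeny : System := fun C V =>
  {c ∈ C | ∃ r, IsKemenyConsensus C V r ∧ r.head? = some c}

/-- `c` can be made a weak Condorcet winner by deleting exactly `n` voters. -/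
def YoungReachable (C : Finset ℕ) (V : Profile) (c n : ℕ) : Prop :=
  ∃ V' : Profile, V'.Sublist V ∧ V'.length + n = V.length ∧ IsWeakCondorcetWinner C V' c

open Classical in
/-- The candidates that become a weak Condorcet winner by deleting the fewest voters. -/
noncomputable def young : System := fun C V =>
  {c ∈ C | ∃ n, YoungReachable C V c n ∧ ∀ d ∈ C, ∀ m, YoungReachable C V d m → n ≤ m}

/-- `Swaps V n W`: the profile `W` arises from `V` by `n` successive swaps, each exchanging two
candidates that are adjacent in the ranking of one voter. -/
inductive Swaps (V : Profile) : ℕ → Profile → Prop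
  | refl : Swaps V 0 V
  | swap {n : ℕ} {V₁ V₂ : Profile} {s t : Vote} {a b : ℕ} :
      Swaps V n (V₁ ++ (s ++ a :: b :: t) :: V₂) →
      Swaps V (n + 1) (V₁ ++ (s ++ b :: a :: t) :: V₂)

/-- `c` can be made a Condorcet winner by `n` swaps of adjacent candidates. -/
def DodgsonReachable (C : Finset ℕ) (V : Profile) (c n : ℕ) : Prop :=
  ∃ W, Swaps V n W ∧ IsCondorcetWinner C W c

open Classical in
/-- The candidates that become a Condorcet winner with the fewest swaps. -/
noncomputable def dodgson : System := fun C V =>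
  {c ∈ C | ∃ n, DodgsonReachable C V c n ∧ ∀ d ∈ C, ∀ m, DodgsonReachable C V d m → n ≤ m}

/-! ## Control -/

/-- How ties among the winners of a first-round election are handled in partition control:
all winners are promoted to the final round, or a winner is promoted only if it is unique. -/
inductive TieRule
  | promote
  | eliminate

/-- The candidates that are promoted to the final round when `W` wins the first round. -/
def TieRule.survivors : TieRule → Finset ℕ → Finset ℕ
  | promote, W => W
  | eliminate, W => if W.card = 1 then W else ∅

/-- The chair wants the distinguished candidate to win (constructive control), or not to win
(destructive control). -/
inductive Goal
  | constructive
  | destructive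

/-- The goal is met for the distinguished candidate `p` if `W` is the set of winners. -/
def Goal.Met : Goal → Finset ℕ → ℕ → Prop
  | constructive, W, p => p ∈ W
  | destructive, W, p => p ∉ W

/-- The control actions of the chair. -/
inductive Action
  /-- add at most `k` candidates -/
  | addCandidates
  /-- add any number of candidates -/
  | addCandidatesUnlimited
  /-- delete at most `k` candidates -/
  | deleteCandidates
  /-- delete at most `k` candidates, all from a given set of deletable candidates -/
  | deleteDeletableCandidates
  /-- first round within one part of the candidates; the other part moves on directly -/
  | partitionCandidates (tie : TieRule)
  /-- first rounds within both parts of the candidates -/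
  | runoffPartitionCandidates (tie : TieRule)
  /-- add at most `k` voters -/
  | addVoters
  /-- delete at most `k` voters -/
  | deleteVoters
  /-- first rounds among both parts of the voters -/
  | partitionVoters (tie : TieRule)

/-- The winners under the system `E` when the voters `V` choose among the candidates in `C`. -/
def System.winners (E : System) (C : Finset ℕ) (V : Profile) : Finset ℕ := E C (restrict C V)

/-- Self-delimiting code of a list: every entry is preceded by `true`; `false` ends the list. -/
def encodeList {α : Type} (enc : α → List Bool) : List α → List Bool
  | [] => [false]
  | a :: l => true :: (enc a ++ encodeList enc l)

/-- Self-delimiting code of the binary representation of a natural number. -/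
def encodeNat (n : ℕ) : List Bool := encodeList (fun b => [b]) n.bits

/-- Code of a list of candidates. -/
def encodeCandidates (C : List ℕ) : List Bool := encodeList encodeNat C

/-- Code of a profile. -/
def encodeProfile (V : Profile) : List Bool := encodeList encodeCandidates V

/-- The decision problem for a control action under the system `E`, as the language of codes of
yes-instances. Sets of candidates are given as lists without repetitions, the voters are listed
one by one, and numbers are written in binary. `C` and `V` are the (registered) candidates and
voters, `D` and `W` are further candidates and voters, `k` is the limit, and `p` is the
distinguished candidate. The chair must not delete `p` (which matters only in the destructive
case). -/
def controlProblem (E : System) (g : Goal) : Action → Language Bool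
  | .addCandidates =>
    {x | ∃ (C D : List ℕ) (V : Profile) (k p : ℕ),
      x = encodeCandidates C ++ encodeCandidates D ++ encodeProfile V ++ encodeNat k ++
        encodeNat p ∧
      (C ++ D).Nodup ∧ IsProfile (C ++ D).toFinset V ∧ p ∈ C ∧
      ∃ D' ⊆ D.toFinset, D'.card ≤ k ∧ g.Met (E.winners (C.toFinset ∪ D') V) p}
  | .addCandidatesUnlimited =>
    {x | ∃ (C D : List ℕ) (V : Profile) (p : ℕ),
      x = encodeCandidates C ++ encodeCandidates D ++ encodeProfile V ++ encodeNat p ∧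
      (C ++ D).Nodup ∧ IsProfile (C ++ D).toFinset V ∧ p ∈ C ∧
      ∃ D' ⊆ D.toFinset, g.Met (E.winners (C.toFinset ∪ D') V) p}
  | .deleteCandidates =>
    {x | ∃ (C : List ℕ) (V : Profile) (k p : ℕ),
      x = encodeCandidates C ++ encodeProfile V ++ encodeNat k ++ encodeNat p ∧
      C.Nodup ∧ IsProfile C.toFinset V ∧ p ∈ C ∧
      ∃ D' ⊆ C.toFinset, p ∉ D' ∧ D'.card ≤ k ∧ g.Met (E.winners (C.toFinset \ D') V) p}
  | .deleteDeletableCandidates =>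
    {x | ∃ (C D : List ℕ) (V : Profile) (k p : ℕ),
      x = encodeCandidates C ++ encodeCandidates D ++ encodeProfile V ++ encodeNat k ++
        encodeNat p ∧
      C.Nodup ∧ D.Nodup ∧ D ⊆ C ∧ IsProfile C.toFinset V ∧ p ∈ C ∧
      ∃ D' ⊆ D.toFinset, p ∉ D' ∧ D'.card ≤ k ∧ g.Met (E.winners (C.toFinset \ D') V) p}
  | .partitionCandidates tie =>
    {x | ∃ (C : List ℕ) (V : Profile) (p : ℕ),
      x = encodeCandidates C ++ encodeProfile V ++ encodeNat p ∧
      C.Nodup ∧ IsProfile C.toFinset V ∧ p ∈ C ∧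
      ∃ C₁ C₂ : Finset ℕ, Disjoint C₁ C₂ ∧ C₁ ∪ C₂ = C.toFinset ∧
        g.Met (E.winners (tie.survivors (E.winners C₁ V) ∪ C₂) V) p}
  | .runoffPartitionCandidates tie =>
    {x | ∃ (C : List ℕ) (V : Profile) (p : ℕ),
      x = encodeCandidates C ++ encodeProfile V ++ encodeNat p ∧
      C.Nodup ∧ IsProfile C.toFinset V ∧ p ∈ C ∧
      ∃ C₁ C₂ : Finset ℕ, Disjoint C₁ C₂ ∧ C₁ ∪ C₂ = C.toFinset ∧
        g.Met (E.winners
          (tie.survivors (E.winners C₁ V) ∪ tie.survivors (E.winners C₂ V)) V) p}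
  | .addVoters =>
    {x | ∃ (C : List ℕ) (V W : Profile) (k p : ℕ),
      x = encodeCandidates C ++ encodeProfile V ++ encodeProfile W ++ encodeNat k ++
        encodeNat p ∧
      C.Nodup ∧ IsProfile C.toFinset V ∧ IsProfile C.toFinset W ∧ p ∈ C ∧
      ∃ W' : Profile, W'.Sublist W ∧ W'.length ≤ k ∧
        g.Met (E.winners C.toFinset (V ++ W')) p}
  | .deleteVoters =>
    {x | ∃ (C : List ℕ) (V : Profile) (k p : ℕ),
      x = encodeCandidates C ++ encodeProfile V ++ encodeNat k ++ encodeNat p ∧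
      C.Nodup ∧ IsProfile C.toFinset V ∧ p ∈ C ∧
      ∃ V' : Profile, V'.Sublist V ∧ V.length ≤ V'.length + k ∧
        g.Met (E.winners C.toFinset V') p}
  | .partitionVoters tie =>
    {x | ∃ (C : List ℕ) (V : Profile) (p : ℕ),
      x = encodeCandidates C ++ encodeProfile V ++ encodeNat p ∧
      C.Nodup ∧ IsProfile C.toFinset V ∧ p ∈ C ∧
      ∃ V₁ V₂ : Profile, (V₁ ++ V₂).Perm V ∧
        g.Met (E.winners (tie.survivors (E.winners C.toFinset V₁) ∪
          tie.survivors (E.winners C.toFinset V₂)) V) p}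

end Election

/-!
The control problems are put in the form "some table passes all tests against a further table",
where a test is a formula of bounded arithmetic, and such formulas are shown to define languages in
`Σ₂ᵖ`.

Formulas. `Expr` is a language of arithmetic expressions in the bits of the input and of guessed
strings, with addition, truncated subtraction and bounded sums. Every value is bounded by a
polynomial in the length of the input, so a multi-stack machine can evaluate an expression with
unary registers in polynomial time (`Complexity.Expr.sound`). Guessing one string gives languages in
`NP` (`mem_NP_of_expr`), and a guess `Y` followed by an oracle query on `Y ++ x` about the existence
of a counterexample `Z` gives `mem_SigmaTwo_of_expr`. The classes `Definable`, `DefinablePred` and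
`DefinableStr` let instance search produce the expressions; the result is
`mem_SigmaTwo_of_definable`.

Election systems. In each of the three systems the winners are the candidates with the least score,
and a score is witnessed by a polynomially bounded table (`Certification`): a ranking for Kemeny,
the set of remaining voters for Young, and the swapped votes for Dodgson, whose cost is the number
of inversions, because sorting by adjacent swaps needs exactly one swap for each inversion
(`Swaps.sort_all`, `Swaps.exists_inversions_le`). A set `W` is the set of winners if and only if its
members have certificates, and no certificate of any candidate `d` is better than these, or equally
good with `d` outside `W`, or exists while `W` is empty (`Certification.winners_of_beats`,
`Certification.exists_beats`). That is one existential and one universal guess.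

Control. A single table holds the parsed instance, up to three elections among its candidates and
voters (the final one and the two of the first round), their winners, and the certificates. Since
all guesses of winner sets are verified simultaneously against one universally quantified
certificate, the two rounds of partition control need no further alternation. All conditions on the
table are definable (`Table.WellFormed`, `Table.Checked`, `Table.Legal`); the correspondence with
the control problems is `Table.Correct.code_mem` and `Table.exists_of_mem`. The limit `k` may be
exponentially large, so it is only evaluated up to the length of the input
(`Table.WellFormed.le_limit_iff`).
-/

namespace Complexity

/-! ### Program fragments over stacks indexed by the natural numbers -/

/-- The content of infinitely many stacks of bits (top first). -/
abbrev Stacks := ℕ → List Bool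

/-- Rename the stacks and the control states of an instruction. -/
def Instr.map {K K' Q Q' : Type} (f : K → K') (g : Q → Q') : Instr K Q → Instr K' Q'
  | .push k b q => .push (f k) b (g q)
  | .pop k q₀ q₁ q₂ => .pop (f k) (g q₀) (g q₁) (g q₂)
  | .guess q₁ q₂ => .guess (g q₁) (g q₂)
  | .query k q₁ q₂ => .query (f k) (g q₁) (g q₂)
  | .halt a => .halt a

open Classical in
/-- One step of a program on stacks indexed by `ℕ`, as in `OracleMachine.step`. -/
noncomputable def stepOn {Q : Type} (code : Q → Instr ℕ Q) (A : Language Bool) (choice : Bool)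
    (c : Q × Stacks) : Q × Stacks :=
  match code c.1 with
  | .push k b q => (q, Function.update c.2 k (b :: c.2 k))
  | .pop k q₀ q₁ q₂ =>
    match c.2 k with
    | [] => (q₀, c.2)
    | b :: l => (if b = true then q₂ else q₁, Function.update c.2 k l)
  | .guess q₁ q₂ => (if choice = true then q₂ else q₁, c.2)
  | .query k q₁ q₂ => (if c.2 k ∈ A then q₂ else q₁, c.2)
  | .halt _ => c

/-- The configuration `t` steps after the configuration `c`, which is the one at time `t₀`. -/
noncomputable def runFrom {Q : Type} (code : Q → Instr ℕ Q) (A : Language Bool)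
    (path : ℕ → Bool) (t₀ : ℕ) : ℕ → Q × Stacks → Q × Stacks
  | 0, c => c
  | t + 1, c => stepOn code A (path (t₀ + t)) (runFrom code A path t₀ t c)

section Run

variable {Q : Type} {code : Q → Instr ℕ Q} {A : Language Bool} {path : ℕ → Bool}

theorem runFrom_add (t₀ a b : ℕ) (c : Q × Stacks) :
    runFrom code A path t₀ (a + b) c =
      runFrom code A path (t₀ + a) b (runFrom code A path t₀ a c) := by
  induction b with
  | zero => rfl
  | succ b ih =>
    rw [← Nat.add_assoc, runFrom, runFrom, ih, Nat.add_assoc]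

theorem runFrom_succ (t₀ a : ℕ) (c : Q × Stacks) :
    runFrom code A path t₀ (a + 1) c =
      runFrom code A path (t₀ + 1) a (stepOn code A (path t₀) c) := by
  rw [Nat.add_comm, runFrom_add]; rfl

theorem stepOn_push {q q' : Q} {k : ℕ} {b choice : Bool} {s : Stacks}
    (h : code q = .push k b q') :
    stepOn code A choice (q, s) = (q', Function.update s k (b :: s k)) := by
  simp [stepOn, h]

theorem stepOn_pop_nil {q q₀ q₁ q₂ : Q} {k : ℕ} {choice : Bool} {s : Stacks}
    (h : code q = .pop k q₀ q₁ q₂) (hs : s k = []) :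
    stepOn code A choice (q, s) = (q₀, s) := by
  simp [stepOn, h, hs]

theorem stepOn_pop_cons {q q₀ q₁ q₂ : Q} {k : ℕ} {b choice : Bool} {l : List Bool} {s : Stacks}
    (h : code q = .pop k q₀ q₁ q₂) (hs : s k = b :: l) :
    stepOn code A choice (q, s) = (if b = true then q₂ else q₁, Function.update s k l) := by
  simp [stepOn, h, hs]

theorem stepOn_guess {q q₁ q₂ : Q} {choice : Bool} {s : Stacks} (h : code q = .guess q₁ q₂) :
    stepOn code A choice (q, s) = (if choice = true then q₂ else q₁, s) := by
  simp [stepOn, h]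

theorem runFrom_halt {t₀ : ℕ} {c : Q × Stacks} {ans : Bool} (h : code c.1 = .halt ans) (t : ℕ) :
    runFrom code A path t₀ t c = c := by
  induction t with
  | zero => rfl
  | succ t ih => simp [runFrom, ih, stepOn, h]

end Run

/-- A piece of a program. The state `none` is the exit; a fragment that starts at the exit does
nothing. -/
structure Frag where
  Q : Type
  [fin : Finite Q]
  start : Option Q
  code : Q → Instr ℕ (Option Q)

namespace Frag

/-- The program `code` contains the fragment `F`: its states are embedded by `ι`, and its exit is
identified with the state `e`. -/
def In (F : Frag) {Q : Type} (code : Q → Instr ℕ Q) (ι : F.Q → Q) (e : Q) : Prop :=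
  ∀ q, code (ι q) = (F.code q).map id (fun o => o.elim e ι)

/-- Inside every program, the fragment `F` transforms the stacks `s` to `s'` within `T` steps,
independently of the choices and of the oracle. -/
def Does (F : Frag) (s s' : Stacks) (T : ℕ) : Prop :=
  ∃ t ≤ T, ∀ (Q : Type) (code : Q → Instr ℕ Q) (ι : F.Q → Q) (e : Q), F.In code ι e →
    ∀ A path t₀, runFrom code A path t₀ t (F.start.elim e ι, s) = (e, s')

theorem Does.mono {F : Frag} {s s' : Stacks} {T T' : ℕ} (h : F.Does s s' T) (hT : T ≤ T') :
    F.Does s s' T' := by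
  obtain ⟨t, ht, h⟩ := h
  exact ⟨t, ht.trans hT, h⟩

/-- Do nothing. -/
def skip : Frag where
  Q := Empty
  start := none
  code := Empty.elim

theorem skip_does (s : Stacks) : skip.Does s s 0 :=
  ⟨0, le_rfl, fun _ _ _ _ _ _ _ _ => rfl⟩

/-- Push the bit `b` on the stack `k`. -/
def push (k : ℕ) (b : Bool) : Frag where
  Q := Unit
  start := some ()
  code := fun _ => .push k b none

theorem push_does (k : ℕ) (b : Bool) (s : Stacks) :
    (push k b).Does s (Function.update s k (b :: s k)) 1 := by
  refine ⟨1, le_rfl, fun Q code ι e h A path t₀ => ?_⟩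
  exact stepOn_push (h ())

/-- Execute `F`, then `G`. -/
def seq (F G : Frag) : Frag where
  Q := F.Q ⊕ G.Q
  fin := have := F.fin; have := G.fin; inferInstance
  start := F.start.elim (G.start.map Sum.inr) (fun q => some (.inl q))
  code := Sum.elim
    (fun q => (F.code q).map id fun o => o.elim (G.start.map Sum.inr) (fun q => some (.inl q)))
    (fun q => (G.code q).map id (Option.map Sum.inr))

theorem Instr.map_map {K K' K'' Q Q' Q'' : Type} (f : K → K') (g : Q → Q') (f' : K' → K'')
    (g' : Q' → Q'') (i : Instr K Q) : (i.map f g).map f' g' = i.map (f' ∘ f) (g' ∘ g) := by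
  cases i <;> rfl

theorem In.seq_left {F G : Frag} {Q : Type} {code : Q → Instr ℕ Q} {ι : (F.seq G).Q → Q} {e : Q}
    (h : (F.seq G).In code ι e) : F.In code (ι ∘ .inl) (G.start.elim e (ι ∘ .inr)) := by
  intro q
  have := h (.inl q)
  simp only [Function.comp, this, seq, Sum.elim_inl, Instr.map_map, Function.id_comp]
  congr 1
  funext o
  rcases o with _ | o <;> [cases G.start <;> rfl; rfl]

theorem In.seq_right {F G : Frag} {Q : Type} {code : Q → Instr ℕ Q} {ι : (F.seq G).Q → Q} {e : Q}
    (h : (F.seq G).In code ι e) : G.In code (ι ∘ .inr) e := by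
  intro q
  have := h (.inr q)
  simp only [Function.comp, this, seq, Sum.elim_inr, Instr.map_map, Function.id_comp]
  congr 1
  funext o
  cases o <;> rfl

theorem seq_start {F G : Frag} {Q : Type} (ι : (F.seq G).Q → Q) (e : Q) :
    (F.seq G).start.elim e ι = F.start.elim (G.start.elim e (ι ∘ .inr)) (ι ∘ .inl) := by
  simp only [seq]
  rcases F.start with _ | q <;> [cases G.start <;> rfl; rfl]

theorem Does.seq {F G : Frag} {s s₁ s₂ : Stacks} {T₁ T₂ : ℕ} (hF : F.Does s s₁ T₁)
    (hG : G.Does s₁ s₂ T₂) : (F.seq G).Does s s₂ (T₁ + T₂) := by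
  obtain ⟨t₁, ht₁, hF⟩ := hF
  obtain ⟨t₂, ht₂, hG⟩ := hG
  refine ⟨t₁ + t₂, by omega, fun Q code ι e h A path t₀ => ?_⟩
  rw [runFrom_add, seq_start, hF _ _ _ _ h.seq_left, hG _ _ _ _ h.seq_right]

/-- Pop the stack `k` and execute `E`, `F` or `G` if it was empty or its top was `false` or
`true`, respectively. -/
def branch (k : ℕ) (E F G : Frag) : Frag where
  Q := Option (E.Q ⊕ F.Q ⊕ G.Q)
  fin := have := E.fin; have := F.fin; have := G.fin; inferInstance
  start := some none
  code
    | none => .pop k (E.start.map (some ∘ .inl)) (F.start.map (some ∘ .inr ∘ .inl))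
        (G.start.map (some ∘ .inr ∘ .inr))
    | some (.inl q) => (E.code q).map id (Option.map (some ∘ .inl))
    | some (.inr (.inl q)) => (F.code q).map id (Option.map (some ∘ .inr ∘ .inl))
    | some (.inr (.inr q)) => (G.code q).map id (Option.map (some ∘ .inr ∘ .inr))

/-- A fragment that sits in a larger one and leaves it when it exits. -/
theorem In.of_map {F G : Frag} {Q : Type} {code : Q → Instr ℕ Q} {ι : F.Q → Q} {e : Q}
    (h : F.In code ι e) (j : G.Q → F.Q)
    (hj : ∀ q, F.code (j q) = (G.code q).map id (Option.map j)) :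
    G.In code (ι ∘ j) e := by
  intro q
  simp only [Function.comp, h (j q), hj, Instr.map_map, Function.id_comp]
  congr 1
  funext o
  cases o <;> rfl

theorem elim_map {α β γ : Type} (o : Option α) (j : α → β) (e : γ) (ι : β → γ) :
    (o.map j).elim e ι = o.elim e (ι ∘ j) := by cases o <;> rfl

theorem branch_nil {k : ℕ} {E F G : Frag} {s s' : Stacks} {T : ℕ} (hs : s k = [])
    (h : E.Does s s' T) : (branch k E F G).Does s s' (1 + T) := by
  obtain ⟨t, ht, h⟩ := h
  refine ⟨t + 1, by omega, fun Q code ι e hin A path t₀ => ?_⟩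
  have h0 := stepOn_pop_nil (A := A) (choice := path t₀) (hin none) hs
  rw [runFrom_succ, show (branch k E F G).start.elim e ι = ι none from rfl, h0]
  exact (congrArg (fun q => runFrom code A path (t₀ + 1) t (q, s))
    (elim_map E.start _ e ι)).trans (h _ _ _ _ (hin.of_map _ fun q => rfl) _ _ _)

theorem branch_cons {k : ℕ} {E F G : Frag} {s s' : Stacks} {T : ℕ} {b : Bool} {l : List Bool}
    (hs : s k = b :: l) (h : (cond b G F).Does (Function.update s k l) s' T) :
    (branch k E F G).Does s s' (1 + T) := by
  obtain ⟨t, ht, h⟩ := h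
  refine ⟨t + 1, by omega, fun Q code ι e hin A path t₀ => ?_⟩
  have h0 := stepOn_pop_cons (A := A) (choice := path t₀) (hin none) hs
  rw [runFrom_succ, show (branch k E F G).start.elim e ι = ι none from rfl, h0]
  cases b
  · exact (congrArg (fun q => runFrom code A path (t₀ + 1) t (q, Function.update s k l))
      (elim_map F.start _ e ι)).trans (h _ _ _ _ (hin.of_map _ fun q => rfl) _ _ _)
  · exact (congrArg (fun q => runFrom code A path (t₀ + 1) t (q, Function.update s k l))
      (elim_map G.start _ e ι)).trans (h _ _ _ _ (hin.of_map _ fun q => rfl) _ _ _)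

/-- Pop the stack `k` until it is empty, executing `F` for every `false` and `G` for every
`true`. -/
def loop (k : ℕ) (F G : Frag) : Frag where
  Q := Option (F.Q ⊕ G.Q)
  fin := have := F.fin; have := G.fin; inferInstance
  start := some none
  code
    | none => .pop k none (some (F.start.map .inl)) (some (G.start.map .inr))
    | some (.inl q) => (F.code q).map id fun o => some (o.map .inl)
    | some (.inr q) => (G.code q).map id fun o => some (o.map .inr)

theorem loop_nil {k : ℕ} {F G : Frag} {s : Stacks} (hs : s k = []) :
    (loop k F G).Does s s 1 := by
  refine ⟨1, le_rfl, fun Q code ι e hin A path t₀ => ?_⟩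
  exact stepOn_pop_nil (hin none) hs

theorem loop_cons {k : ℕ} {F G : Frag} {s s₁ s₂ : Stacks} {T₁ T₂ : ℕ} {b : Bool} {l : List Bool}
    (hs : s k = b :: l) (h₁ : (cond b G F).Does (Function.update s k l) s₁ T₁)
    (h₂ : (loop k F G).Does s₁ s₂ T₂) : (loop k F G).Does s s₂ (1 + T₁ + T₂) := by
  obtain ⟨t₁, ht₁, h₁⟩ := h₁
  obtain ⟨t₂, ht₂, h₂⟩ := h₂
  refine ⟨t₁ + t₂ + 1, by omega, fun Q code ι e hin A path t₀ => ?_⟩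
  have hF : F.In code (fun q => ι (some (.inl q))) (ι none) := by
    intro q
    simp only [hin (some (.inl q)), loop, Instr.map_map]
    congr 1
    funext o
    cases o <;> rfl
  have hG : G.In code (fun q => ι (some (.inr q))) (ι none) := by
    intro q
    simp only [hin (some (.inr q)), loop, Instr.map_map]
    congr 1
    funext o
    cases o <;> rfl
  have h0 := stepOn_pop_cons (A := A) (choice := path t₀) (hin none) hs
  have key : runFrom code A path (t₀ + 1) t₁
      (stepOn code A (path t₀) ((loop k F G).start.elim e ι, s)) = (ι none, s₁) := by
    rw [show (loop k F G).start.elim e ι = ι none from rfl, h0]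
    cases b
    · rw [← h₁ _ _ _ _ hF A path (t₀ + 1)]
      simp only [Bool.false_eq_true, if_false, cond_false]
      cases F.start <;> rfl
    · rw [← h₁ _ _ _ _ hG A path (t₀ + 1)]
      simp only [if_true, cond_true]
      cases G.start <;> rfl
  rw [runFrom_succ, runFrom_add, key]
  exact h₂ _ _ _ _ hin _ _ _

/-- A loop over a unary counter. -/
theorem loop_unary {k : ℕ} {F G : Frag} {T : ℕ} (S : ℕ → Stacks) (n : ℕ)
    (hk : ∀ i ≤ n, S i k = List.replicate (n - i) true)
    (hstep : ∀ i < n, G.Does (Function.update (S i) k (List.replicate (n - i - 1) true))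
      (S (i + 1)) T) : (loop k F G).Does (S 0) (S n) (n * (T + 1) + 1) := by
  induction n generalizing S with
  | zero => simpa using loop_nil (by simpa using hk 0 le_rfl)
  | succ n ih =>
    have h2 := ih (fun i => S (i + 1)) (fun i hi => by simpa using hk (i + 1) (by omega))
      (fun i hi => by
        have := hstep (i + 1) (by omega)
        rwa [show n + 1 - (i + 1) - 1 = n - i - 1 by omega] at this)
    have h1 := hstep 0 (by omega)
    have := loop_cons (F := F) (k := k) (s := S 0) (b := true) (l := List.replicate n true)
      (by simpa [List.replicate_succ] using hk 0 (by omega)) (by simpa using h1) h2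
    exact this.mono (by ring_nf; omega)

end Frag

open Function List

/-! ### Counting expressions -/

/-- Arithmetic expressions over the length of an input string, the bits of some strings, and
variables numbered by de Bruijn indices. Bounded sums provide multiplication, bounded quantifiers
and counting; there is no way to form numbers of superpolynomial size. -/
inductive Expr : Type
  | var (j : ℕ)
  | one
  | len
  | bit (k : ℕ) (e : Expr)
  | add (e f : Expr)
  | sub (e f : Expr)
  | sum (e f : Expr)

/-- Extend an assignment of the variables by a value for the innermost variable. -/
def consEnv (i : ℕ) (v : ℕ → ℕ) : ℕ → ℕ
  | 0 => i
  | j + 1 => v j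

/-- The value of an expression; `n` is the length of the input, `str k` is the `k`-th string
(as an infinite sequence of bits), and `v` assigns values to the variables. -/
def Expr.eval (n : ℕ) (str : ℕ → ℕ → Bool) : Expr → (ℕ → ℕ) → ℕ
  | var j, v => v j
  | one, _ => 1
  | len, _ => n
  | bit k e, v => if str k (e.eval n str v) = true then 1 else 0
  | add e f, v => e.eval n str v + f.eval n str v
  | sub e f, v => e.eval n str v - f.eval n str v
  | sum e f, v => ∑ i ∈ Finset.range (e.eval n str v), f.eval n str (consEnv i v)

/-- A polynomial that bounds the values, the positions of the bits that matter, and the running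
time of the evaluation, in terms of a bound for the values of the variables and the length of
the input. -/
noncomputable def Expr.bound : Expr → Polynomial ℕ
  | var _ => 6 * .X + 5
  | one => 6 * .X + 5
  | len => 6 * .X + 5
  | bit _ e => 7 * e.bound + 5
  | add e f => e.bound + 3 * f.bound + 1
  | sub e f => e.bound + 3 * f.bound + 1
  | sum e f => e.bound + e.bound * (3 * f.bound.comp (.X + e.bound) + 3) + e.bound + 2

theorem eval_mono (p : Polynomial ℕ) {a b : ℕ} (h : a ≤ b) : p.eval a ≤ p.eval b := by
  simp only [Polynomial.eval_eq_sum_range]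
  gcongr

theorem consEnv_le {i N : ℕ} {v : ℕ → ℕ} (hi : i ≤ N) (hv : ∀ j, v j ≤ N) (j : ℕ) :
    consEnv i v j ≤ N := by
  cases j with
  | zero => exact hi
  | succ j => exact hv j

namespace Expr

theorem eval_le_bound {n N : ℕ} {str : ℕ → ℕ → Bool} (e : Expr) {v : ℕ → ℕ} (hn : n ≤ N)
    (hv : ∀ j, v j ≤ N) : e.eval n str v ≤ e.bound.eval N := by
  induction e generalizing v N with
  | var j => have := hv j; simp [eval, bound]; omega
  | one => simp [eval, bound]
  | len => simp [eval, bound]; omega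
  | bit k e ih => simp only [eval, bound]; split_ifs <;> simp
  | add e f ih₁ ih₂ =>
    have := ih₁ hn hv; have := ih₂ hn hv; simp [eval, bound]; omega
  | sub e f ih₁ ih₂ =>
    have := ih₁ hn hv; have := ih₂ hn hv; simp [eval, bound]; omega
  | sum e f ih₁ ih₂ =>
    have h1 := ih₁ hn hv
    simp only [eval, bound]
    have : ∀ i ∈ Finset.range (e.eval n str v), f.eval n str (consEnv i v) ≤
        f.bound.eval (N + e.bound.eval N) := by
      intro i hi
      rw [Finset.mem_range] at hi
      exact ih₂ (by omega) (consEnv_le (by omega) fun j => (hv j).trans (by omega))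
    have h2 := Finset.sum_le_card_nsmul _ _ _ this
    simp only [Finset.card_range, smul_eq_mul] at h2
    have h3 := Nat.mul_le_mul_right (f.bound.eval (N + e.bound.eval N)) h1
    simp
    nlinarith

/-- Only bits at positions below the bound matter. -/
theorem eval_congr {n N : ℕ} {str str' : ℕ → ℕ → Bool} (e : Expr) {v : ℕ → ℕ} (hn : n ≤ N)
    (hv : ∀ j, v j ≤ N) (h : ∀ k, ∀ i < e.bound.eval N, str k i = str' k i) :
    e.eval n str v = e.eval n str' v := by
  induction e generalizing v N with
  | var j => rfl
  | one => rfl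
  | len => rfl
  | bit k e ih =>
    have h1 := e.eval_le_bound (str := str) hn hv
    simp only [bound, Polynomial.eval_add, Polynomial.eval_mul, Polynomial.eval_ofNat] at h
    simp only [eval, ← ih hn hv fun k i hi => h k i (by omega)]
    rw [h k _ (by omega)]
  | add e f ih₁ ih₂ =>
    simp only [bound, Polynomial.eval_add, Polynomial.eval_mul, Polynomial.eval_ofNat] at h
    simp only [eval]
    rw [ih₁ hn hv fun k i hi => h k i (by omega), ih₂ hn hv fun k i hi => h k i (by omega)]
  | sub e f ih₁ ih₂ =>
    simp only [bound, Polynomial.eval_add, Polynomial.eval_mul, Polynomial.eval_ofNat] at h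
    simp only [eval]
    rw [ih₁ hn hv fun k i hi => h k i (by omega), ih₂ hn hv fun k i hi => h k i (by omega)]
  | sum e f ih₁ ih₂ =>
    have h1 := e.eval_le_bound (str := str) hn hv
    simp only [bound, Polynomial.eval_add, Polynomial.eval_mul, Polynomial.eval_ofNat,
      Polynomial.eval_comp, Polynomial.eval_X] at h
    simp only [eval]
    rw [← ih₁ hn hv fun k i hi => h k i (by omega)]
    refine Finset.sum_congr rfl fun i hi => ?_
    rw [Finset.mem_range] at hi
    refine ih₂ (N := N + e.bound.eval N) (by omega)
      (consEnv_le (by omega) fun j => (hv j).trans (by omega)) fun k i' hi' => h k i' ?_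
    have : 1 * (f.bound.eval (N + e.bound.eval N)) ≤
        e.bound.eval N * (f.bound.eval (N + e.bound.eval N)) :=
      Nat.mul_le_mul_right _ (by omega)
    nlinarith

end Expr

/-! ### Evaluation of expressions by a program -/

namespace Frag

theorem Does.congr {F : Frag} {s s' s'' : Stacks} {T T' : ℕ} (h : F.Does s s' T)
    (hs : s' = s'') (hT : T ≤ T') : F.Does s s'' T' := hs ▸ h.mono hT

/-- Pour the stack `k` onto the stack `t`, executing `X` for every bit. -/
def pour (k t : ℕ) (X : Frag) : Frag :=
  loop k ((push t false).seq X) ((push t true).seq X)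

theorem pour_does {k t d c : ℕ} {X : Frag} (hkt : k ≠ t) (hkd : k ≠ d) (htd : t ≠ d)
    (hX : ∀ s : Stacks, X.Does s (update s d (replicate c true ++ s d)) 1) (l : List Bool)
    (s : Stacks) (hs : s k = l) :
    (pour k t X).Does s
      (update (update (update s k []) t (l.reverse ++ s t)) d
        (replicate (c * l.length) true ++ s d)) (3 * l.length + 1) := by
  induction l generalizing s with
  | nil =>
    refine (loop_nil hs).congr ?_ (by simp)
    funext j
    simp only [update_apply, reverse_nil, nil_append, length_nil, Nat.mul_zero, replicate_zero]
    split_ifs <;> simp_all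
  | cons b l ih =>
    have h1 : ((push t b).seq X).Does (update s k l)
        (update (update (update s k l) t (b :: s t)) d (replicate c true ++ s d)) 2 := by
      refine ((push_does t b _).seq (hX _)).congr ?_ le_rfl
      simp [htd.symm, hkt.symm, hkd.symm]
    have h2 := ih (update (update (update s k l) t (b :: s t)) d (replicate c true ++ s d))
      (by simp [hkd, hkt])
    refine (loop_cons hs (by cases b <;> exact h1) h2).congr ?_ (by simp; ring_nf; omega)
    funext j
    simp only [update_apply, htd, if_false, reverse_cons, append_assoc, cons_append,
      nil_append, length_cons, if_true, Nat.mul_add, Nat.mul_one, replicate_add]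
    split_ifs <;> simp_all

theorem skip_does' (d : ℕ) (s : Stacks) : skip.Does s (update s d (replicate 0 true ++ s d)) 1 :=
  (skip_does s).congr (by simp) (by simp)

theorem push_does' (d : ℕ) (s : Stacks) :
    (push d true).Does s (update s d (replicate 1 true ++ s d)) 1 := push_does d true s

/-- Push as many `true`s on the stack `d` as the length of the stack `k`, with the empty stack
`d + 1` as a help. -/
def measure (k d : ℕ) : Frag := (pour k (d + 1) skip).seq (pour (d + 1) k (push d true))

theorem measure_does {k d : ℕ} (hk : k < d) (s : Stacks) (hs : ∀ j ≥ d, s j = []) :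
    (measure k d).Does s (update s d (replicate (s k).length true)) (6 * (s k).length + 2) := by
  have h1 := pour_does (k := k) (t := d + 1) (d := d) (by omega) (by omega) (by omega)
    (skip_does' d) _ s rfl
  have h2 := fun s' : Stacks => pour_does (k := d + 1) (t := k) (d := d) (by omega) (by omega)
    (by omega) (push_does' d) _ s' rfl
  refine (h1.seq (h2 _)).congr ?_ ?_
  · funext j
    simp only [update_apply]
    have e1 : d + 1 ≠ d := by omega
    have e2 : k ≠ d := by omega
    have e3 : k ≠ d + 1 := by omega
    have h3 := hs d le_rfl
    have h4 := hs (d + 1) (by omega)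
    split_ifs <;> simp_all
  · simp only [update_apply]
    have h4 := hs (d + 1) (by omega)
    simp [h4]
    omega

/-- Empty the stack `k`. -/
def clear (k : ℕ) : Frag := loop k skip skip

theorem clear_does (k : ℕ) (s : Stacks) : (clear k).Does s (update s k []) ((s k).length + 1) := by
  generalize hl : s k = l
  induction l generalizing s with
  | nil => exact (loop_nil hl).congr (by rw [← hl, update_eq_self]) (by simp)
  | cons b l ih =>
    have h := loop_cons (F := skip) (G := skip) hl (s₁ := update s k l) (T₁ := 0)
      (by cases b <;> exact skip_does _) (ih (update s k l) (by simp))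
    exact h.congr (by simp) (by simp; omega)

end Frag

namespace Expr

open Frag

/-- The stacks that hold the strings. -/
def strReg (k : ℕ) : ℕ := min k 1

/-- The program that evaluates an expression: the strings are on the stacks `0` and `1`, the
value of the variable `j` is on the stack `ρ j` in unary, the result goes to the stack `d`, and
only stacks from `d` on are used otherwise. -/
def compile : Expr → (ℕ → ℕ) → ℕ → Frag
  | var j, ρ, d => measure (ρ j) d
  | one, _, d => push d true
  | len, _, d => measure 0 d
  | bit k e, ρ, d =>
    (e.compile ρ (d + 1)).seq <|
    (loop (d + 1) skip
      (branch (strReg k) skip (push (d + 2) false) (push (d + 2) true))).seq <|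
    (branch (strReg k) skip (push (strReg k) false)
      ((push (strReg k) true).seq (push d true))).seq <|
    pour (d + 2) (strReg k) skip
  | add e f, ρ, d =>
    (e.compile ρ d).seq <| (f.compile ρ (d + 1)).seq <| loop (d + 1) skip (push d true)
  | sub e f, ρ, d =>
    (e.compile ρ d).seq <| (f.compile ρ (d + 1)).seq <|
    loop (d + 1) skip (branch d skip skip skip)
  | sum e f, ρ, d =>
    (e.compile ρ (d + 1)).seq <|
    (loop (d + 1) skip <|
      (f.compile (consEnv (d + 2) ρ) (d + 3)).seq <|
      (loop (d + 3) skip (push d true)).seq (push (d + 2) true)).seq <|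
    clear (d + 2)

end Expr

namespace Frag

/-- Add the unary number on the stack `a` to the one on the stack `d`. -/
theorem addLoop_does {a d m n : ℕ} (had : a ≠ d) (s : Stacks) (ha : s a = replicate m true)
    (hd : s d = replicate n true) :
    (loop a skip (push d true)).Does s
      (update (update s a []) d (replicate (n + m) true)) (2 * m + 1) := by
  have h := loop_unary (k := a) (F := skip) (G := push d true) (T := 1)
    (fun i => update (update s a (replicate (m - i) true)) d (replicate (n + i) true)) m
    (fun i hi => by simp [had]) (fun i hi => by
      refine (push_does _ _ _).congr ?_ le_rfl
      funext j
      simp only [update_apply, had.symm, if_false]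
      split_ifs <;> simp_all [Nat.sub_sub, ← Nat.add_assoc, replicate_succ])
  have e : (update (update s a (replicate (m - 0) true)) d (replicate (n + 0) true)) = s := by
    funext j
    simp only [update_apply]
    split_ifs <;> simp_all
  simp only [e] at h
  exact h.congr (by simp) (by omega)

theorem subLoop_does {a d m n : ℕ} (had : a ≠ d) (s : Stacks) (ha : s a = replicate m true)
    (hd : s d = replicate n true) :
    (loop a skip (branch d skip skip skip)).Does s
      (update (update s a []) d (replicate (n - m) true)) (2 * m + 1) := by
  have h := loop_unary (k := a) (F := skip) (G := branch d skip skip skip) (T := 1)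
    (fun i => update (update s a (replicate (m - i) true)) d (replicate (n - i) true)) m
    (fun i hi => by simp [had]) (fun i hi => by
      rcases hni : n - i with _ | r
      · refine (branch_nil (by simp [had.symm]) (skip_does _)).congr
          ?_ le_rfl
        funext j
        simp only [update_apply, show n - (i + 1) = 0 by omega]
        split_ifs <;> simp_all [Nat.sub_sub]
      · refine (branch_cons (b := true) (l := replicate r true)
          (by simp [had.symm, replicate_succ])
          (skip_does _)).congr ?_ le_rfl
        funext j
        simp only [update_apply, show n - (i + 1) = r by omega]
        split_ifs <;> simp_all [Nat.sub_sub])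
  have e : (update (update s a (replicate (m - 0) true)) d (replicate (n - 0) true)) = s := by
    funext j
    simp only [update_apply]
    split_ifs <;> simp_all
  simp only [e] at h
  exact h.congr (by simp) (by omega)

/-- Move the topmost `v` bits of the stack `a` to the stack `d + 2`, where the counter `v` is on
the stack `d + 1`. -/
theorem digLoop_does {a d v : ℕ} (had : a < d) (s : Stacks) (l : List Bool) (ha : s a = l)
    (h1 : s (d + 1) = replicate v true) (h2 : s (d + 2) = []) :
    (loop (d + 1) skip (branch a skip (push (d + 2) false) (push (d + 2) true))).Does s
      (update (update (update s (d + 1) []) (d + 2) (l.take v).reverse) a (l.drop v))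
      (3 * v + 1) := by
  have e1 : a ≠ d + 1 := by omega
  have e2 : a ≠ d + 2 := by omega
  have e3 : d + 1 ≠ d + 2 := by omega
  have h := loop_unary (k := d + 1) (F := skip)
    (G := branch a skip (push (d + 2) false) (push (d + 2) true)) (T := 2)
    (fun i => update (update (update s (d + 1) (replicate (v - i) true)) (d + 2)
      (l.take i).reverse) a (l.drop i)) v
    (fun i hi => by simp [e1.symm]) (fun i hi => by
      by_cases hl : i < l.length
      · have hd : l.drop i = l[i] :: l.drop (i + 1) := by simp
        have ht : l.take (i + 1) = l.take i ++ [l[i]] := by simp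
        refine (branch_cons (b := l[i]) (l := l.drop (i + 1)) (T := 1)
          (s' := update (update (update s (d + 1) (replicate (v - (i + 1)) true)) (d + 2)
            (l.take (i + 1)).reverse) a (l.drop (i + 1))) (by simp [e1]) ?_)
        generalize hb : l[i] = b
        have hp := push_does (d + 2) b (update (update (update (update (update s (d + 1)
          (replicate (v - i) true)) (d + 2) (l.take i).reverse) a (l.drop i)) (d + 1)
          (replicate (v - i - 1) true)) a (drop (i + 1) l))
        rw [hb] at ht
        cases b
        all_goals
          refine hp.congr ?_ le_rfl
          funext j
          simp only [update_apply, ht]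
          split_ifs <;> simp_all [Nat.sub_sub]
      · have hd : l.drop i = [] := by simp; omega
        have hd' : l.drop (i + 1) = [] := by simp; omega
        have ht : l.take (i + 1) = l.take i := by
          rw [take_of_length_le (by omega), take_of_length_le (by omega)]
        refine (branch_nil (by simp [e1, hd]) (skip_does _)).congr ?_ (by omega)
        funext j
        simp only [update_apply, ht, hd, hd']
        split_ifs <;> simp_all [Nat.sub_sub])
  have e : (update (update (update s (d + 1) (replicate (v - 0) true)) (d + 2)
      (l.take 0).reverse) a (l.drop 0)) = s := by
    funext j
    simp only [update_apply]
    split_ifs <;> simp_all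
  simp only [e] at h
  exact h.congr (by simp) (by omega)

/-- Overwriting temporary results. -/
theorem update_temp {s : Stacks} {a d : ℕ} (h : s a = []) (x y z : List Bool) :
    update (update (update (update s d x) a y) a []) d z = update s d z := by
  funext j
  simp only [update_apply]
  split_ifs <;> simp_all

/-- Record the top of the stack `a` on the stack `d`. -/
theorem readBit_does {a d : ℕ} (had : a ≠ d) (s : Stacks) (hd : s d = []) :
    (branch a skip (push a false) ((push a true).seq (push d true))).Does s
      (update s d (replicate (if (s a).headD false = true then 1 else 0) true)) 3 := by
  rcases hl : s a with _ | ⟨b, l⟩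
  · refine (branch_nil hl (skip_does _)).congr ?_ (by omega)
    simp [hd]
  · refine (branch_cons (T := 2) (s' := update s d (replicate (if b = true then 1 else 0) true))
      hl ?_).mono (by omega)
    cases b
    · refine (push_does _ _ _).congr ?_ (by omega)
      simp [← hl, ← hd]
    · refine ((push_does _ _ _).seq (push_does _ _ _)).congr ?_ (by omega)
      simp [← hl, had.symm, hd]

end Frag

namespace Expr

open Frag

/-- Whenever the variables `v` are stored on the stacks given by `ρ`, all below `d`, and the
stacks from `d` on are empty, the compiled expression writes its value on the stack `d`, leaves
everything else as it was, and needs at most `e.bound` steps. -/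
def Sound (n : ℕ) (str : ℕ → ℕ → Bool) (e : Expr) : Prop :=
  ∀ ⦃v ρ : ℕ → ℕ⦄ ⦃d : ℕ⦄ ⦃s : Stacks⦄ ⦃N : ℕ⦄, 2 ≤ d → (∀ j, ρ j < d) →
    (∀ j, s (ρ j) = replicate (v j) true) → (∀ j ≥ d, s j = []) → (s 0).length = n →
    (∀ k i, str k i = (s (strReg k)).getD i false) → n ≤ N → (∀ j, v j ≤ N) →
    (e.compile ρ d).Does s (update s d (replicate (e.eval n str v) true)) (e.bound.eval N)

variable {n : ℕ} {str : ℕ → ℕ → Bool} {e f : Expr}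

theorem Sound.add (ih₁ : Sound n str e) (ih₂ : Sound n str f) : Sound n str (add e f) := by
  intro v ρ d s N hd hρ hv hs hlen hstr hn hvN
  have h1 := ih₁ hd hρ hv hs hlen hstr hn hvN
  have hup : ∀ k < d, update s d (replicate (e.eval n str v) true) k = s k :=
    fun k hk => by simp [show k ≠ d by omega]
  have h2 := ih₂ (s := update s d (replicate (e.eval n str v) true)) (d := d + 1)
    (by omega) (fun j => (hρ j).trans (by omega)) (fun j => by rw [hup _ (hρ j), hv])
    (fun j hj => by simp [show j ≠ d by omega, hs j (by omega)])
    (by rw [hup _ (by omega), hlen])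
    (fun k i => by rw [hup _ (by simp [strReg]; omega), hstr]) hn hvN
  have h3 := addLoop_does (a := d + 1) (d := d) (m := f.eval n str v) (n := e.eval n str v)
    (by omega) _ (by simp) (by simp) |> (h1.seq <| h2.seq ·)
  refine h3.congr (update_temp (hs (d + 1) (by omega)) _ _ _) ?_
  have := f.eval_le_bound (str := str) hn hvN
  simp [bound]
  omega

theorem Sound.sub (ih₁ : Sound n str e) (ih₂ : Sound n str f) : Sound n str (sub e f) := by
  intro v ρ d s N hd hρ hv hs hlen hstr hn hvN
  have h1 := ih₁ hd hρ hv hs hlen hstr hn hvN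
  have hup : ∀ k < d, update s d (replicate (e.eval n str v) true) k = s k :=
    fun k hk => by simp [show k ≠ d by omega]
  have h2 := ih₂ (s := update s d (replicate (e.eval n str v) true)) (d := d + 1)
    (by omega) (fun j => (hρ j).trans (by omega)) (fun j => by rw [hup _ (hρ j), hv])
    (fun j hj => by simp [show j ≠ d by omega, hs j (by omega)])
    (by rw [hup _ (by omega), hlen])
    (fun k i => by rw [hup _ (by simp [strReg]; omega), hstr]) hn hvN
  have h3 := subLoop_does (a := d + 1) (d := d) (m := f.eval n str v) (n := e.eval n str v)
    (by omega) _ (by simp) (by simp) |> (h1.seq <| h2.seq ·)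
  refine h3.congr (update_temp (hs (d + 1) (by omega)) _ _ _) ?_
  have := f.eval_le_bound (str := str) hn hvN
  simp [bound]
  omega

theorem Sound.bit (k : ℕ) (ih : Sound n str e) : Sound n str (Expr.bit k e) := by
  intro v ρ d s N hd hρ hv hs hlen hstr hn hvN
  have hk : strReg k < d := by simp [strReg]; omega
  have h1 := ih (d := d + 1) (by omega) (fun j => (hρ j).trans (by omega)) hv
    (fun j hj => hs j (by omega)) hlen hstr hn hvN
  set m := e.eval n str v with hm
  have hb := hstr k m
  set a := strReg k with ha
  set l := s a with hl
  have h2 := digLoop_does (a := a) (d := d) (v := m) hk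
    (update s (d + 1) (replicate m true)) l (by simp [show a ≠ d + 1 by omega, hl]) (by simp)
    (by simp [hs])
  set s₂ := update (update (update (update s (d + 1) (replicate m true)) (d + 1) []) (d + 2)
    (l.take m).reverse) a (l.drop m) with hs₂
  have hd0 := hs d le_rfl
  have hd1 := hs (d + 1) (by omega)
  have hd2 := hs (d + 2) (by omega)
  have h3 := readBit_does (a := a) (d := d) (by omega) s₂
    (by simp [hs₂, show d ≠ a by omega, hd0])
  rw [show (s₂ a).headD false = str k m by
    rw [hb, headD_eq_getD, show s₂ a = l.drop m by simp [hs₂]]; simp] at h3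
  have h4 := pour_does (k := d + 2) (t := a) (d := d) (c := 0) (X := skip) (by omega)
    (by omega) (by omega) (skip_does' d) _
    (update s₂ d (replicate (if str k m = true then 1 else 0) true)) rfl
  refine (h1.seq <| h2.seq <| h3.seq h4).congr ?_ ?_
  · have e1 : a ≠ d := by omega
    have e2 : a ≠ d + 1 := by omega
    have e3 : a ≠ d + 2 := by omega
    have h6 : str k m = true ∨ str k m = false := by cases str k m <;> simp
    clear h1 h2 h3 h4 hv hρ hs hlen hstr hvN ih
    funext j
    simp only [update_apply, hs₂, eval, ← hm]
    split_ifs <;> simp_all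
  · have := e.eval_le_bound (str := str) hn hvN
    have h5 : (update s₂ d (replicate (if str k m = true then 1 else 0) true) (d + 2)).length ≤
        m := by
      simp [hs₂, show d + 2 ≠ a by omega]
    simp only [bound, Polynomial.eval_add, Polynomial.eval_mul, Polynomial.eval_ofNat]
    omega

theorem Sound.sum (ih₁ : Sound n str e) (ih₂ : Sound n str f) : Sound n str (sum e f) := by
  intro v ρ d s N hd hρ hv hs hlen hstr hn hvN
  have h1 := ih₁ (d := d + 1) (by omega) (fun j => (hρ j).trans (by omega)) hv
    (fun j hj => hs j (by omega)) hlen hstr hn hvN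
  have hm' := e.eval_le_bound (str := str) hn hvN
  set m := e.eval n str v with hm
  have hd0 := hs d le_rfl
  have hd1 := hs (d + 1) (by omega)
  have hd2 := hs (d + 2) (by omega)
  have hd3 := hs (d + 3) (by omega)
  set M := N + e.bound.eval N with hM
  set g : ℕ → ℕ := fun i => f.eval n str (consEnv i v) with hg
  have hgM : ∀ i < m, g i ≤ f.bound.eval M := fun i hi =>
    f.eval_le_bound (by omega) (consEnv_le (by omega) fun j => (hvN j).trans (by omega))
  set T := f.bound.eval M + (2 * f.bound.eval M + 1 + 1) with hT
  have h2 := loop_unary (k := d + 1) (F := skip)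
    (G := (f.compile (consEnv (d + 2) ρ) (d + 3)).seq <|
      (loop (d + 3) skip (push d true)).seq (push (d + 2) true)) (T := T)
    (fun i => update (update (update s (d + 1) (replicate (m - i) true)) (d + 2)
      (replicate i true)) d (replicate (∑ j ∈ Finset.range i, g j) true)) m
    (fun i hi => by simp) (fun i hi => by
      set s₁ := update (update (update (update s (d + 1) (replicate (m - i) true)) (d + 2)
        (replicate i true)) d (replicate (∑ j ∈ Finset.range i, g j) true)) (d + 1)
        (replicate (m - i - 1) true) with hs₁
      have hup : ∀ k < d, s₁ k = s k := fun k hk => by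
        simp [hs₁, show k ≠ d by omega, show k ≠ d + 1 by omega, show k ≠ d + 2 by omega]
      have h3 := ih₂ (s := s₁) (d := d + 3) (ρ := consEnv (d + 2) ρ) (v := consEnv i v)
        (N := M) (by omega)
        (fun j => by
          cases j with
          | zero => simp [consEnv]
          | succ j => exact (hρ j).trans (by omega))
        (fun j => by
          cases j with
          | zero => simp [consEnv, hs₁]
          | succ j => simp [consEnv, hup _ (hρ j), hv])
        (fun j hj => by
          simp [hs₁, show j ≠ d by omega, show j ≠ d + 1 by omega, show j ≠ d + 2 by omega,
            hs j (by omega)])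
        (by rw [hup _ (by omega), hlen])
        (fun k i => by rw [hup _ (by simp [strReg]; omega), hstr])
        (by omega) (consEnv_le (by omega) fun j => (hvN j).trans (by omega))
      have h4 := addLoop_does (a := d + 3) (d := d) (m := g i)
        (n := ∑ j ∈ Finset.range i, g j) (by omega)
        (update s₁ (d + 3) (replicate (g i) true)) (by simp) (by simp [hs₁])
      refine (h3.seq <| h4.seq <| push_does (d + 2) true _).congr ?_ ?_
      · rw [Finset.sum_range_succ]
        clear h3 h4 hup hv hρ hs hlen hstr hvN ih₁ ih₂ h1
        funext j
        simp only [update_apply, hs₁]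
        split_ifs <;> simp_all [Nat.sub_sub, replicate_succ]
      · have := hgM i hi
        omega)
  have e0 : (update (update (update s (d + 1) (replicate (m - 0) true)) (d + 2)
      (replicate 0 true)) d (replicate (∑ j ∈ Finset.range 0, g j) true)) =
      update s (d + 1) (replicate m true) := by
    funext j
    simp only [update_apply]
    split_ifs <;> simp_all
  simp only [e0] at h2
  refine (h1.seq <| h2.seq <| clear_does (d + 2) _).congr ?_ ?_
  · clear h1 h2 hv hρ hs hlen hstr hvN ih₁ ih₂ e0
    funext j
    simp only [update_apply, eval]
    split_ifs <;> simp_all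
  · have h6 : m * (3 * f.bound.eval M + 3) ≤ e.bound.eval N * (3 * f.bound.eval M + 3) :=
      Nat.mul_le_mul_right _ hm'
    have h7 : m * (T + 1) = m * (3 * f.bound.eval M + 3) := by rw [hT]; ring
    simp [bound, ← hM]
    omega

theorem sound (e : Expr) : Sound n str e := by
  induction e with
  | var j =>
    intro v ρ d s N hd hρ hv hs hlen hstr hn hvN
    refine (measure_does (hρ j) s hs).congr (by simp [hv, eval]) ?_
    have := hvN j
    simp [hv, bound]
    omega
  | one =>
    intro v ρ d s N hd hρ hv hs hlen hstr hn hvN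
    refine (push_does _ _ _).congr (by simp [hs, eval]) (by simp [bound])
  | len =>
    intro v ρ d s N hd hρ hv hs hlen hstr hn hvN
    refine (measure_does (by omega) s hs).congr (by simp [hlen, eval]) ?_
    simp [hlen, bound]
    omega
  | add e f ih₁ ih₂ => exact ih₁.add ih₂
  | sub e f ih₁ ih₂ => exact ih₁.sub ih₂
  | bit k e ih => exact ih.bit k
  | sum e f ih₁ ih₂ => exact ih₁.sum ih₂

end Expr

/-! ### Guessing programs as oracle machines -/

/-- The initial stacks on input `x`. -/
def initStacks (x : List Bool) : Stacks := fun k => if k = 0 then x else []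

section Machine

variable {Q : Type} [Finite Q]

/-- The largest stack that an instruction mentions. -/
def Instr.reg {Q : Type} : Instr ℕ Q → ℕ
  | .push k _ _ => k
  | .pop k _ _ _ => k
  | .guess _ _ => 0
  | .query k _ _ => k
  | .halt _ => 0

theorem exists_reg_lt (code : Q → Instr ℕ Q) : ∃ N, ∀ q, (code q).reg < N + 1 := by
  obtain ⟨N, hN⟩ := (Set.finite_range fun q => (code q).reg).bddAbove
  exact ⟨N, fun q => Nat.lt_succ_of_le (hN ⟨q, rfl⟩)⟩

/-- A program uses only finitely many stacks, so it is a program of an oracle machine. -/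
def toMachine (N : ℕ) (code : Q → Instr ℕ Q) (start : Q) : OracleMachine where
  K := Fin (N + 1)
  Q := Q
  input := 0
  start := start
  code := fun q => (code q).map (Fin.ofNat _) id

theorem toMachine_run {N : ℕ} {code : Q → Instr ℕ Q} (hN : ∀ q, (code q).reg < N + 1)
    (start : Q) (A : Language Bool) (path : ℕ → Bool) (x : List Bool) (t : ℕ) :
    (toMachine N code start).run A path x t =
      ⟨(runFrom code A path 0 t (start, initStacks x)).1,
        fun k : Fin _ => (runFrom code A path 0 t (start, initStacks x)).2 k.val⟩ := by
  induction t with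
  | zero =>
    simp only [OracleMachine.run, OracleMachine.init, runFrom, toMachine]
    congr 1
    funext k
    simp only [initStacks, Fin.ext_iff, Fin.val_zero]
  | succ t ih =>
    simp only [OracleMachine.run, runFrom, Nat.zero_add]
    rw [ih]
    generalize runFrom code A path 0 t (start, initStacks x) = c
    obtain ⟨q, s⟩ := c
    have hq := hN q
    simp only [OracleMachine.step, stepOn, toMachine]
    have key : ∀ (k : ℕ), k < N + 1 → ∀ l : List Bool,
        (update (fun j : Fin (N + 1) => s j.val) (Fin.ofNat _ k) l) =
          fun j => update s k l j.val := by
      intro k hk l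
      funext j
      have : j = Fin.ofNat _ k ↔ j.val = k := by
        rw [Fin.ext_iff, Fin.val_ofNat, Nat.mod_eq_of_lt hk]
      by_cases h : j.val = k
      · rw [update_apply, update_apply, if_pos (this.2 h), if_pos h]
      · rw [update_apply, update_apply, if_neg (mt this.1 h), if_neg h]
    rcases hc : code q with ⟨k, b, q'⟩ | ⟨k, q₀, q₁, q₂⟩ | ⟨q₁, q₂⟩ | ⟨k, q₁, q₂⟩ | ⟨a⟩ <;>
      simp only [hc, Instr.reg, Instr.map, id] at hq ⊢
    · simp only [Fin.val_ofNat, Nat.mod_eq_of_lt hq]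
      exact congrArg _ (key k hq _)
    · simp only [Fin.val_ofNat, Nat.mod_eq_of_lt hq]
      rcases hk : s k with _ | ⟨b, l⟩
      · rfl
      · exact congrArg _ (key k hq _)
    · have h := Nat.mod_eq_of_lt hq
      by_cases hm : s k ∈ A <;> simp [hm, h]

end Machine

namespace Frag

/-- Push nondeterministic bits on the stack `z`, as many as the length of the stack `d`. -/
def guessLoop (d z : ℕ) : Frag where
  Q := Option (Option Bool)
  start := some none
  code
    | none => .pop d none (some (some none)) (some (some none))
    | some none => .guess (some (some (some false))) (some (some (some true)))
    | some (some b) => .push z b (some none)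

/-- The bits that the guessing loop pushes when it is started at time `t₀`. -/
def guessed (path : ℕ → Bool) (t₀ n : ℕ) : List Bool :=
  ((range n).map fun i => path (t₀ + 3 * i + 1)).reverse

theorem exists_guessed (l : List Bool) (t₀ : ℕ) : ∃ path, guessed path t₀ l.length = l := by
  refine ⟨fun m => l.reverse.getD ((m - t₀) / 3) false, ?_⟩
  rw [guessed, reverse_eq_iff]
  refine ext_getElem (by simp) fun i h₁ h₂ => ?_
  have : (t₀ + 3 * i + 1 - t₀) / 3 = i := by omega
  simp only [getElem_map, getElem_range, this]
  rw [getD_eq_getElem _ _ h₂]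

theorem guessLoop_run {d z : ℕ} (hdz : d ≠ z) {Q : Type} {code : Q → Instr ℕ Q}
    {ι : (guessLoop d z).Q → Q} {e : Q} (h : (guessLoop d z).In code ι e) (A : Language Bool)
    (path : ℕ → Bool) (n t₀ : ℕ) (s : Stacks) (hs : s d = replicate n true) :
    runFrom code A path t₀ (3 * n + 1) (ι none, s) =
      (e, update (update s d []) z (guessed path t₀ n ++ s z)) := by
  induction n generalizing t₀ s with
  | zero =>
    rw [show 3 * 0 + 1 = 0 + 1 by rfl, runFrom_succ, stepOn_pop_nil (h none) hs]
    simp only [runFrom, guessed, range_zero, map_nil, reverse_nil, nil_append]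
    congr 1
    rw [show s z = update s d [] z by simp [hdz.symm], update_eq_self]
    exact (update_eq_self_iff.2 hs.symm).symm
  | succ n ih =>
    set s' := update s d (replicate n true) with hs'
    have h1 : stepOn code A (path t₀) (ι none, s) = (ι (some none), s') :=
      stepOn_pop_cons (h none) (b := true) (by simp [hs, replicate_succ])
    have h2 : stepOn code A (path (t₀ + 1)) (ι (some none), s') =
        (ι (some (some (path (t₀ + 1)))), s') := by
      refine (stepOn_guess (h (some none))).trans ?_
      cases path (t₀ + 1) <;> rfl
    have h3 : stepOn code A (path (t₀ + 1 + 1)) (ι (some (some (path (t₀ + 1)))), s') =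
        (ι none, update s' z (path (t₀ + 1) :: s' z)) :=
      stepOn_push (h (some (some (path (t₀ + 1)))))
    rw [show 3 * (n + 1) + 1 = (3 * n + 1) + 1 + 1 + 1 by ring, runFrom_succ, h1, runFrom_succ,
      h2, runFrom_succ, h3, ih (t₀ + 1 + 1 + 1) _ (by simp [hdz, hs'])]
    have e5 : guessed path t₀ (n + 1) = guessed path (t₀ + 1 + 1 + 1) n ++ [path (t₀ + 1)] := by
      simp only [guessed, range_succ_eq_map, map_cons, map_map, reverse_cons]
      congr 2
      refine map_congr_left fun i _ => ?_
      simp only [comp, Nat.succ_eq_add_one]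
      congr 1
      ring
    rw [e5]
    congr 1
    funext j
    simp only [update_apply, hs']
    split_ifs <;> simp_all

end Frag

/-- The program that executes the fragment `F` and then decides by the instruction `dec`. -/
def topCode (F : Frag) (dec : Instr ℕ Bool) : Option (F.Q ⊕ Bool) → Instr ℕ (Option (F.Q ⊕ Bool))
  | none => dec.map id (some ∘ .inr)
  | some (.inl q) => (F.code q).map id (fun o => o.elim none (some ∘ .inl))
  | some (.inr b) => .halt b

open Frag in
/-- A language is in `NP^A` if it is recognized as follows: guess a string `y` of length
`q |x|` on top of the stack `z`, run a deterministic polynomial-time program, and execute a final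
instruction that gives the answer. -/
theorem mem_NPOracle_of_guess {A L : Language Bool} (b : Expr) (q p : Polynomial ℕ)
    (hb : ∀ n str v, b.eval n str v = q.eval n) {z : ℕ} (hz : z < 3) (post : Frag)
    (dec : Instr ℕ Bool) (res : List Bool → List Bool → Stacks)
    (ans : List Bool → List Bool → Bool)
    (hpost : ∀ x y, y.length = q.eval x.length →
      post.Does (update (initStacks x) z (y ++ initStacks x z)) (res x y) (p.eval x.length))
    (hdec : ∀ x y, y.length = q.eval x.length → ∀ (Q : Type) (code : Q → Instr ℕ Q) (r : Q)
      (j : Bool → Q) (choice : Bool), code r = dec.map id j →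
      (stepOn code A choice (r, res x y)).1 = j (ans x y))
    (hL : ∀ x, x ∈ L ↔ ∃ y, y.length = q.eval x.length ∧ ans x y = true) : L ∈ NPOracle A := by
  set F := (b.compile (fun _ => 2) 3).seq ((guessLoop 3 z).seq post) with hF
  have := F.fin
  have hin : F.In (topCode F dec) (some ∘ .inl) none := fun q => rfl
  set code := topCode F dec with hcode
  set st : Option (F.Q ⊕ Bool) := F.start.elim none (some ∘ .inl) with hst
  -- the time after which the answer is known on all paths
  set T : Polynomial ℕ := b.bound + (3 * q + 1) + p + 1 with hT
  have run : ∀ x, ∃ t₀, ∀ path,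
      (runFrom code A path 0 (T.eval x.length) (st, initStacks x)).1 =
        some (.inr (ans x (guessed path t₀ (q.eval x.length)))) := by
    intro x
    obtain ⟨t₁, ht₁, h1⟩ := b.sound (n := x.length)
      (str := fun k i => (initStacks x (Expr.strReg k)).getD i false) (v := fun _ => 0)
      (ρ := fun _ => 2) (d := 3) (s := initStacks x) (N := x.length) (by omega)
      (fun _ => by omega) (fun _ => by simp [initStacks])
      (fun j hj => by simp [initStacks, show j ≠ 0 by omega]) (by simp [initStacks])
      (fun _ _ => rfl) le_rfl (fun _ => Nat.zero_le _)
    refine ⟨t₁, fun path => ?_⟩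
    set m := q.eval x.length with hm
    have hy : (guessed path t₁ m).length = m := by simp [guessed]
    obtain ⟨t₂, ht₂, h2⟩ := hpost x _ hy
    have g1 := h1 _ _ _ _ hin.seq_left A path 0
    have g2 := guessLoop_run (d := 3) (z := z) (by omega) hin.seq_right.seq_left A path m t₁
      (update (initStacks x) 3 (replicate m true)) (by simp)
    have g3 := h2 _ _ _ _ hin.seq_right.seq_right A path (t₁ + (3 * m + 1))
    have e1 : update (update (update (initStacks x) 3 (replicate m true)) 3 []) z
        (guessed path t₁ m ++ update (initStacks x) 3 (replicate m true) z) =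
        update (initStacks x) z (guessed path t₁ m ++ initStacks x z) := by
      have h3 : update (initStacks x) 3 [] = initStacks x := update_eq_self_iff.2 rfl
      rw [update_idem, update_of_ne (by omega), h3]
    rw [e1] at g2
    have h4 : (runFrom code A path 0 (t₁ + (3 * m + 1) + t₂ + 1) (st, initStacks x)).1 =
        some (.inr (ans x (guessed path t₁ m))) := by
      rw [runFrom, runFrom_add, runFrom_add]
      have e2 : runFrom code A path 0 t₁ (st, initStacks x) =
          (((guessLoop 3 z).seq post).start.elim none ((some ∘ .inl) ∘ .inr),
            update (initStacks x) 3 (replicate m true)) := by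
        rw [hb] at g1
        rw [← g1]
        exact congrArg (fun q => runFrom code A path 0 t₁ (q, initStacks x)) (seq_start _ _)
      simp only [e2, Nat.zero_add, seq_start]
      refine (congrArg (fun c => (stepOn code A (path (t₁ + (3 * m + 1) + t₂))
        (runFrom code A path (t₁ + (3 * m + 1)) t₂ c)).1) g2).trans ?_
      rw [g3]
      exact hdec x _ hy _ code none _ _ rfl
    have hle : t₁ + (3 * m + 1) + t₂ + 1 ≤ T.eval x.length := by
      simp [hT, ← hm]
      omega
    obtain ⟨r, hr⟩ := Nat.exists_eq_add_of_le hle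
    rw [hr, runFrom_add, runFrom_halt (ans := ans x (guessed path t₁ m)), h4]
    rw [h4]
    rfl
  obtain ⟨N, hN⟩ := exists_reg_lt code
  refine ⟨toMachine N code st, T, fun x => ?_⟩
  obtain ⟨t₀, hrun⟩ := run x
  have hans : ∀ path answer, (toMachine N code st).HaltsWith A path x (T.eval x.length) answer ↔
      ans x (guessed path t₀ (q.eval x.length)) = answer := by
    intro path answer
    rw [OracleMachine.HaltsWith, toMachine_run hN]
    simp only [hrun path]
    change Instr.halt _ = Instr.halt _ ↔ _
    simp
  refine ⟨fun path => ⟨_, (hans path _).2 rfl⟩, ?_⟩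
  rw [hL]
  constructor
  · rintro ⟨y, hy, h⟩
    obtain ⟨path, hpath⟩ := exists_guessed y t₀
    exact ⟨path, (hans path _).2 (by rw [← hy, hpath, h])⟩
  · rintro ⟨path, h⟩
    exact ⟨_, by simp [guessed], (hans path _).1 h⟩

/-! ### Second-order counting formulas define languages in `Σ₂ᵖ` -/

namespace Expr

/-- Rename the variables under one more binder. -/
def liftRen (ρ : ℕ → ℕ) : ℕ → ℕ := consEnv 0 fun j => ρ j + 1

/-- Rename the variables. -/
def rename : (ℕ → ℕ) → Expr → Expr
  | ρ, var j => var (ρ j)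
  | _, one => one
  | _, len => len
  | ρ, bit k e => bit k (e.rename ρ)
  | ρ, add e f => add (e.rename ρ) (f.rename ρ)
  | ρ, sub e f => sub (e.rename ρ) (f.rename ρ)
  | ρ, sum e f => sum (e.rename ρ) (f.rename (liftRen ρ))

theorem consEnv_comp_liftRen (i : ℕ) (v ρ : ℕ → ℕ) :
    consEnv i v ∘ liftRen ρ = consEnv i (v ∘ ρ) := by
  funext j
  cases j <;> rfl

theorem eval_rename {n : ℕ} {str : ℕ → ℕ → Bool} (e : Expr) (ρ v : ℕ → ℕ) :
    (e.rename ρ).eval n str v = e.eval n str (v ∘ ρ) := by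
  induction e generalizing ρ v <;> simp_all [rename, eval, consEnv_comp_liftRen]

/-- Substitute expressions for the variables. -/
def subst : (ℕ → Expr) → Expr → Expr
  | σ, var j => σ j
  | _, one => one
  | _, len => len
  | σ, bit k e => bit k (e.subst σ)
  | σ, add e f => add (e.subst σ) (f.subst σ)
  | σ, sub e f => sub (e.subst σ) (f.subst σ)
  | σ, sum e f => sum (e.subst σ)
      (f.subst fun j => Nat.casesOn j (var 0) fun j => (σ j).rename Nat.succ)

theorem eval_subst {n : ℕ} {str : ℕ → ℕ → Bool} (e : Expr) (σ : ℕ → Expr) (v : ℕ → ℕ) :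
    (e.subst σ).eval n str v = e.eval n str fun j => (σ j).eval n str v := by
  induction e generalizing σ v with
  | sum e f ih₁ ih₂ =>
    simp only [subst, eval, ih₁, ih₂]
    refine Finset.sum_congr rfl fun i _ => congrArg _ ?_
    funext j
    cases j with
    | zero => rfl
    | succ j => exact eval_rename _ _ _
  | _ => simp_all [subst, eval]

/-- The product of two expressions. -/
def mul (e f : Expr) : Expr := sum e (f.rename Nat.succ)

theorem eval_mul {n : ℕ} {str : ℕ → ℕ → Bool} (e f : Expr) (v : ℕ → ℕ) :
    (mul e f).eval n str v = e.eval n str v * f.eval n str v := by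
  have h : ∀ i, consEnv i v ∘ Nat.succ = v := fun i => rfl
  simp [mul, eval, eval_rename, h]

theorem exists_natCast (c : ℕ) : ∃ e : Expr, ∀ n str v, e.eval n str v = c := by
  induction c with
  | zero => exact ⟨sub one one, fun n str v => by simp [eval]⟩
  | succ c ih =>
    obtain ⟨e, he⟩ := ih
    exact ⟨add e one, fun n str v => by simp [eval, he]⟩

theorem exists_polynomial (q : Polynomial ℕ) (a : Expr) :
    ∃ e : Expr, ∀ n str v, e.eval n str v = q.eval (a.eval n str v) := by
  induction q using Polynomial.induction_on with
  | C c =>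
    obtain ⟨e, he⟩ := exists_natCast c
    exact ⟨e, by simpa using he⟩
  | add p q hp hq =>
    obtain ⟨e, he⟩ := hp
    obtain ⟨f, hf⟩ := hq
    exact ⟨add e f, fun n str v => by simp [eval, he, hf]⟩
  | monomial k c ih =>
    obtain ⟨e, he⟩ := ih
    exact ⟨mul e a, fun n str v => by simp [eval_mul, he, pow_succ, mul_assoc]⟩

end Expr

open Complexity.Expr

/-- Languages of the form `{w | ∃ Z, ψ (w, Z)}` are in `NP`. -/
theorem mem_NP_of_expr (ψ : Expr) (L : Language Bool)
    (hL : ∀ w, w ∈ L ↔ ∃ Z : ℕ → Bool, 0 < ψ.eval w.length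
      (fun k i => if k = 0 then w.getD i false else Z i) 0) : L ∈ NP := by
  obtain ⟨b, hb⟩ := exists_polynomial ψ.bound len
  set str : List Bool → List Bool → ℕ → ℕ → Bool := fun w z k i =>
    if k = 0 then w.getD i false else z.getD i false with hstr
  refine mem_NPOracle_of_guess b ψ.bound ψ.bound hb (z := 1) (by omega)
    (ψ.compile (fun _ => 2) 3) (.pop 3 false true true)
    (fun w z => update (update (initStacks w) 1 (z ++ initStacks w 1)) 3
      (replicate (ψ.eval w.length (str w z) 0) true))
    (fun w z => 0 < ψ.eval w.length (str w z) 0) ?_ ?_ ?_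
  · intro w z hz
    refine ψ.sound (v := 0) (by omega) (fun _ => by omega) (fun _ => by simp [initStacks])
      (fun j hj => by simp [initStacks, show j ≠ 0 by omega, show j ≠ 1 by omega])
      (by simp [initStacks]) (fun k i => ?_) le_rfl (fun _ => Nat.zero_le _)
    simp only [hstr, strReg, initStacks]
    rcases Nat.eq_zero_or_pos k with rfl | hk
    · simp [initStacks]
    · simp [show min k 1 = 1 by omega, show k ≠ 0 by omega]
  · intro w z hz Q code r j choice hr
    rcases hm : ψ.eval w.length (str w z) 0 with _ | m
    · exact congrArg Prod.fst (stepOn_pop_nil hr (by simp))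
    · exact congrArg Prod.fst
        (stepOn_pop_cons (b := true) (l := replicate m true) hr (by simp [replicate_succ]))
  · intro w
    rw [hL]
    have hloc : ∀ (z : List Bool) (Z : ℕ → Bool),
        (∀ i < ψ.bound.eval w.length, z.getD i false = Z i) →
        ψ.eval w.length (str w z) 0 =
          ψ.eval w.length (fun k i => if k = 0 then w.getD i false else Z i) 0 := by
      intro z Z h
      refine ψ.eval_congr le_rfl (fun _ => Nat.zero_le _) fun k i hi => ?_
      simp only [hstr, h i hi]
    constructor
    · rintro ⟨Z, hZ⟩
      refine ⟨(range (ψ.bound.eval w.length)).map Z, by simp, ?_⟩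
      rw [hloc _ Z]
      · simpa using hZ
      · intro i hi
        rw [getD_eq_getElem _ _ (by simpa using hi)]
        simp
    · rintro ⟨z, hz, h⟩
      refine ⟨fun i => z.getD i false, ?_⟩
      rw [← hloc z _ fun _ _ => rfl]
      simpa using h

/-- The length `n` of `x`, recovered from the length `n + q n` of a string `y ++ x` with
`|y| = q |x|`. -/
theorem sum_decode (q : Polynomial ℕ) (n : ℕ) :
    ∑ i ∈ Finset.range (n + q.eval n), (1 - (1 - (n + q.eval n - (i + q.eval i)))) = n := by
  have h : ∀ i ∈ Finset.range (n + q.eval n), (1 - (1 - (n + q.eval n - (i + q.eval i)))) =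
      if i < n then 1 else 0 := by
    intro i _
    split_ifs with hi
    · have := eval_mono q hi.le
      omega
    · have := eval_mono q (not_lt.1 hi)
      omega
  rw [Finset.sum_congr rfl h, ← Finset.card_filter]
  have : {i ∈ Finset.range (n + q.eval n) | i < n} = Finset.range n := by
    ext i
    simp
    omega
  rw [this, Finset.card_range]

/-- Evaluate on the string `y ++ x` an expression about `x` and `y`: `l` computes the length of
`x` and `q` that of `y`. -/
def Expr.onAppend (l q : Expr) : Expr → Expr
  | var j => var j
  | one => one
  | len => l
  | bit 0 e => bit 0 (add (onAppend l q e) q)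
  | bit 1 e => bit 0 (onAppend l q e)
  | bit (_ + 2) e => bit 1 (onAppend l q e)
  | add e f => add (onAppend l q e) (onAppend l q f)
  | sub e f => sub (onAppend l q e) (onAppend l q f)
  | sum e f => sum (onAppend l q e) (onAppend l q f)

theorem eval_onAppend {l q e : Expr} {m n c : ℕ} {w : List Bool} {Z : ℕ → Bool}
    {str : ℕ → ℕ → Bool} (hl : ∀ v, l.eval m str v = n) (hq : ∀ v, q.eval m str v = c)
    (h₀ : ∀ i, str 0 i = w.getD i false) (h₁ : ∀ i, str 1 i = Z i) (v : ℕ → ℕ) :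
    (onAppend l q e).eval m str v = e.eval n
      (fun k i => if k = 0 then w.getD (i + c) false else if k = 1 then w.getD i false else Z i)
      v := by
  induction e generalizing v with
  | bit k e ih =>
    rcases k with _ | _ | k <;> simp [onAppend, Expr.eval, ih, h₀, h₁, hq]
  | _ => simp_all [onAppend, Expr.eval]

/-- Languages of the form `{x | ∃ Y, ∀ Z, φ (x, Y, Z)}` are in `Σ₂ᵖ`. -/
theorem mem_SigmaTwo_of_expr (φ : Expr) (L : Language Bool)
    (hL : ∀ x, x ∈ L ↔ ∃ Y : ℕ → Bool, ∀ Z : ℕ → Bool, 0 < φ.eval x.length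
      (fun k i => if k = 0 then x.getD i false else if k = 1 then Y i else Z i) 0) :
    L ∈ SigmaTwo := by
  set q := φ.bound with hq
  obtain ⟨b, hb⟩ := exists_polynomial q len
  obtain ⟨c, hc⟩ := exists_polynomial q (var 0)
  -- the length of `x`, computed from the length of the oracle string
  set l : Expr := sum len (sub one (sub one (sub len (add (var 0) c)))) with hl
  obtain ⟨d, hd⟩ := exists_polynomial q l
  have hln : ∀ n str v, l.eval (n + q.eval n) str v = n := by
    intro n str v
    have := sum_decode q n
    simpa [hl, Expr.eval, hc, consEnv] using this
  set A : Language Bool := {w | ∃ Z : ℕ → Bool, 0 < (sub one (onAppend l d φ)).eval w.length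
    (fun k i => if k = 0 then w.getD i false else Z i) 0} with hA
  refine ⟨A, mem_NP_of_expr _ A fun w => Iff.rfl, ?_⟩
  -- the oracle finds a counterexample `Z` for the guess `y`
  have key : ∀ x y : List Bool, y.length = q.eval x.length → (y ++ x ∉ A ↔
      ∀ Z : ℕ → Bool, 0 < φ.eval x.length (fun k i => if k = 0 then x.getD i false else
        if k = 1 then y.getD i false else Z i) 0) := by
    intro x y hy
    have hlen : (y ++ x).length = x.length + q.eval x.length := by simp [hy, add_comm]
    have hmem : y ++ x ∈ A ↔ ∃ Z : ℕ → Bool, 0 < (sub one (onAppend l d φ)).eval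
      (y ++ x).length (fun k i => if k = 0 then (y ++ x).getD i false else Z i) 0 := Iff.rfl
    rw [hmem, not_exists]
    refine forall_congr' fun Z => ?_
    have h1 := eval_onAppend (l := l) (q := d) (e := φ) (m := x.length + q.eval x.length)
      (n := x.length) (c := q.eval x.length) (w := y ++ x) (Z := Z)
      (str := fun k i => if k = 0 then (y ++ x).getD i false else Z i)
      (fun v => hln _ _ _) (fun v => by rw [hd, hln]) (fun _ => rfl) (fun _ => rfl) 0
    rw [hlen]
    simp only [Expr.eval, h1]
    rw [φ.eval_congr (v := 0) (N := x.length) le_rfl (fun _ => le_rfl.trans (Nat.zero_le _))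
      (str' := fun k i => if k = 0 then x.getD i false else
        if k = 1 then y.getD i false else Z i)]
    · omega
    · intro k i hi
      have e1 : (y ++ x).getD (i + q.eval x.length) false = x.getD i false := by
        rw [getD_append_right _ _ _ _ (by omega)]
        congr 1
        omega
      have e2 : (y ++ x).getD i false = y.getD i false :=
        getD_append _ _ _ _ (by rw [hy]; exact hi)
      simp only [e1, e2]
  classical
  refine mem_NPOracle_of_guess b q 0 hb (z := 0) (by omega) Frag.skip (.query 0 true false)
    (fun x y => update (initStacks x) 0 (y ++ initStacks x 0)) (fun x y => decide (y ++ x ∉ A))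
    (fun x y hy => (Frag.skip_does _).mono (by simp)) ?_ ?_
  · intro x y hy Q code r j choice hr
    have : (stepOn code A choice (r, update (initStacks x) 0 (y ++ initStacks x 0))).1 =
        if y ++ x ∈ A then j false else j true := by
      simp [stepOn, hr, Instr.map, initStacks]
    rw [this]
    by_cases h : y ++ x ∈ A <;> simp [h]
  · intro x
    rw [hL]
    constructor
    · rintro ⟨Y, hY⟩
      refine ⟨(range (q.eval x.length)).map Y, by simp, ?_⟩
      rw [decide_eq_true_iff, key _ _ (by simp)]
      intro Z
      rw [φ.eval_congr (v := 0) (N := x.length) le_rfl (fun _ => le_rfl.trans (Nat.zero_le _))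
        (str' := fun k i => if k = 0 then x.getD i false else if k = 1 then Y i else Z i)]
      · exact hY Z
      · intro k i hi
        rw [getD_eq_getElem ((range (q.eval x.length)).map Y) _ (by simpa using hi)]
        simp
    · rintro ⟨y, hy, h⟩
      exact ⟨fun i => y.getD i false, (key x y hy).1 (by simpa using h)⟩

/-! ### Definable functions -/

/-- The position in a guessed string of the `v`-th bit of the table entry at `a`, `i`, `j`, `k`. -/
def pairCode (u v : ℕ) : ℕ := (u + v) * (u + v) + u

theorem pairCode_inj {u v u' v' : ℕ} (h : pairCode u v = pairCode u' v') : u = u' ∧ v = v' := by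
  unfold pairCode at h
  rcases lt_trichotomy (u + v) (u' + v') with hl | he | hl
  · nlinarith
  · rw [he] at h
    omega
  · nlinarith

/-- A guessed string `Y` describes a table with four arguments. The entries are the numbers of
`true`s among `n` bits and therefore at most `n`. -/
def tableOf (n : ℕ) (Y : ℕ → Bool) (a i j k : ℕ) : ℕ :=
  ∑ v ∈ Finset.range n,
    if Y (pairCode a (pairCode i (pairCode j (pairCode k v)))) = true then 1 else 0

theorem tableOf_le (n : ℕ) (Y : ℕ → Bool) (a i j k : ℕ) : tableOf n Y a i j k ≤ n := by
  refine (Finset.sum_le_card_nsmul _ _ 1 fun v _ => by split_ifs <;> simp).trans ?_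
  simp

theorem exists_tableOf {n : ℕ} (F : ℕ → ℕ → ℕ → ℕ → ℕ) (hF : ∀ a i j k, F a i j k ≤ n) :
    ∃ Y, tableOf n Y = F := by
  classical
  refine ⟨fun m => decide (∃ a i j k v,
    m = pairCode a (pairCode i (pairCode j (pairCode k v))) ∧ v < F a i j k), ?_⟩
  funext a i j k
  have : ∀ v, (∃ a' i' j' k' v', pairCode a (pairCode i (pairCode j (pairCode k v))) =
      pairCode a' (pairCode i' (pairCode j' (pairCode k' v'))) ∧ v' < F a' i' j' k') ↔
      v < F a i j k := by
    intro v
    constructor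
    · rintro ⟨a', i', j', k', v', h, hv⟩
      obtain ⟨ha, h⟩ := pairCode_inj h
      obtain ⟨hi, h⟩ := pairCode_inj h
      obtain ⟨hj, h⟩ := pairCode_inj h
      obtain ⟨hk, h⟩ := pairCode_inj h
      rwa [ha, hi, hj, hk, h]
    · exact fun hv => ⟨a, i, j, k, v, rfl, hv⟩
  simp only [tableOf, decide_eq_true_eq, this]
  rw [← Finset.card_filter]
  have h2 : {v ∈ Finset.range n | v < F a i j k} = Finset.range (F a i j k) := by
    ext v
    have := hF a i j k
    simp
    omega
  rw [h2, Finset.card_range]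

/-- An input string together with an existentially and a universally guessed string. -/
structure World where
  x : List Bool
  Y : ℕ → Bool
  Z : ℕ → Bool

namespace World

/-- The length of the input. -/
def size (w : World) : ℕ := w.x.length

/-- The bit of the input at position `i`. -/
def inputBit (w : World) (i : ℕ) : Prop := w.x.getD i false = true

/-- The existentially guessed table (for `g = 0`) and the universally guessed one. -/
def tab (w : World) (g : ℕ) : ℕ → ℕ → ℕ → ℕ → ℕ :=
  tableOf w.size (if g = 0 then w.Y else w.Z)

/-- The three strings of a world. -/
def str (w : World) (k i : ℕ) : Bool :=
  if k = 0 then w.x.getD i false else if k = 1 then w.Y i else w.Z i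

end World

open Classical in
/-- The truth value of a proposition as a number. -/
noncomputable def ind (p : Prop) : ℕ := if p then 1 else 0

theorem ind_of_true {p : Prop} (h : p) : ind p = 1 := if_pos h

theorem ind_of_false {p : Prop} (h : ¬p) : ind p = 0 := if_neg h

theorem ind_le_one (p : Prop) : ind p ≤ 1 := by unfold ind; split_ifs <;> simp

theorem ind_pos {p : Prop} : 0 < ind p ↔ p := by
  by_cases h : p <;> simp [ind, h]

/-- `f` is given by a counting expression, uniformly in the world and the variables. As a class,
so that instance search finds the expressions. -/
class Definable (f : World → (ℕ → ℕ) → ℕ) : Prop where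
  exists_expr : ∃ e : Expr, ∀ w v, e.eval w.size w.str v = f w v

/-- The predicate `P` is decided by a counting expression. -/
class DefinablePred (P : World → (ℕ → ℕ) → Prop) : Prop where
  definable_ind : Definable fun w v => ind (P w v)

namespace Definable

variable {f g a b c d e : World → (ℕ → ℕ) → ℕ} {P R : World → (ℕ → ℕ) → Prop}

instance var (j : ℕ) : Definable fun _ v => v j := ⟨.var j, fun _ _ => rfl⟩

instance const (c : ℕ) : Definable fun _ _ => c := by
  obtain ⟨e, he⟩ := Expr.exists_natCast c
  exact ⟨e, fun _ _ => he _ _ _⟩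

instance size : Definable fun w _ => w.size := ⟨.len, fun _ _ => rfl⟩

instance add [hf : Definable f] [hg : Definable g] : Definable fun w v => f w v + g w v := by
  obtain ⟨e, he⟩ := hf
  obtain ⟨e', he'⟩ := hg
  exact ⟨.add e e', fun w v => by simp [Expr.eval, he, he']⟩

instance sub [hf : Definable f] [hg : Definable g] : Definable fun w v => f w v - g w v := by
  obtain ⟨e, he⟩ := hf
  obtain ⟨e', he'⟩ := hg
  exact ⟨.sub e e', fun w v => by simp [Expr.eval, he, he']⟩

instance mul [hf : Definable f] [hg : Definable g] : Definable fun w v => f w v * g w v := by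
  obtain ⟨e, he⟩ := hf
  obtain ⟨e', he'⟩ := hg
  exact ⟨.mul e e', fun w v => by simp [Expr.eval_mul, he, he']⟩

instance sum {h : World → (ℕ → ℕ) → ℕ → ℕ} [hf : Definable f]
    [hh : Definable fun w v => h w (fun j => v (j + 1)) (v 0)] :
    Definable fun w v => ∑ i ∈ Finset.range (f w v), h w v i := by
  obtain ⟨e, he⟩ := hf
  obtain ⟨e', he'⟩ := hh
  exact ⟨.sum e e', fun w v => by simp only [Expr.eval, he, he']; rfl⟩

theorem subst {F : World → (ℕ → ℕ) → ℕ} (hF : Definable F) (σ : ℕ → World → (ℕ → ℕ) → ℕ)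
    (hσ : ∀ j, Definable (σ j)) : Definable fun w v => F w fun j => σ j w v := by
  obtain ⟨e, he⟩ := hF
  choose s hs using fun j => (hσ j).exists_expr
  exact ⟨e.subst s, fun w v => by rw [Expr.eval_subst, he]; simp [hs]⟩

theorem comp₁ {F : World → ℕ → ℕ} (hF : Definable fun w v => F w (v 0)) [Definable a] :
    Definable fun w v => F w (a w v) :=
  hF.subst (fun _ => a) fun _ => inferInstance

theorem comp₂ {F : World → ℕ → ℕ → ℕ} (hF : Definable fun w v => F w (v 0) (v 1))
    [Definable a] [Definable b] : Definable fun w v => F w (a w v) (b w v) :=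
  hF.subst (fun | 0 => a | _ => b) fun | 0 => ‹Definable a› | _ + 1 => ‹Definable b›

theorem comp₅ {F : World → ℕ → ℕ → ℕ → ℕ → ℕ → ℕ}
    (hF : Definable fun w v => F w (v 0) (v 1) (v 2) (v 3) (v 4))
    [Definable a] [Definable b] [Definable c] [Definable d] [Definable e] :
    Definable fun w v => F w (a w v) (b w v) (c w v) (d w v) (e w v) :=
  hF.subst (fun | 0 => a | 1 => b | 2 => c | 3 => d | _ => e) fun
    | 0 => ‹Definable a› | 1 => ‹Definable b› | 2 => ‹Definable c› | 3 => ‹Definable d›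
    | _ + 4 => ‹Definable e›

instance ind [h : DefinablePred P] : Definable fun w v => ind (P w v) := h.definable_ind

theorem congr (hf : Definable f) (h : ∀ w v, f w v = g w v) : Definable g := by
  obtain ⟨e, he⟩ := hf
  exact ⟨e, fun w v => by rw [he, h]⟩

instance tab [Definable a] [Definable b] [Definable c] [Definable d] [Definable e] :
    Definable fun w v => w.tab (a w v) (b w v) (c w v) (d w v) (e w v) := by
  refine comp₅ (F := World.tab) ?_
  have h : ∀ s, Definable fun w v => ∑ i ∈ Finset.range w.size,
      if w.str s (pairCode (v 1) (pairCode (v 2) (pairCode (v 3) (pairCode (v 4) i)))) = true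
        then 1 else 0 := by
    intro s
    have h1 : Definable fun _ v => pairCode (v 2) (pairCode (v 3) (pairCode (v 4)
        (pairCode (v 5) (v 0)))) := by
      unfold pairCode
      infer_instance
    have h2 : Definable fun w v => if w.str s (pairCode (v 2) (pairCode (v 3) (pairCode (v 4)
        (pairCode (v 5) (v 0))))) = true then 1 else 0 := by
      obtain ⟨e, he⟩ := h1
      exact ⟨.bit s e, fun w v => by simp [Expr.eval, he]⟩
    exact sum (h := fun w v i => if w.str s (pairCode (v 1) (pairCode (v 2) (pairCode (v 3)
      (pairCode (v 4) i)))) = true then 1 else 0)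
  have h1 := h 1
  have h2 := h 2
  refine (inferInstance : Definable fun w v => (1 - v 0) * (∑ i ∈ Finset.range w.size,
      if w.str 1 (pairCode (v 1) (pairCode (v 2) (pairCode (v 3) (pairCode (v 4) i)))) = true
        then 1 else 0) + (1 - (1 - v 0)) * (∑ i ∈ Finset.range w.size,
      if w.str 2 (pairCode (v 1) (pairCode (v 2) (pairCode (v 3) (pairCode (v 4) i)))) = true
        then 1 else 0)).congr fun w v => ?_
  rcases h : v 0 with _ | m
  · simp [World.tab, tableOf, World.str]
  · simp [World.tab, tableOf, World.str]

end Definable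

namespace DefinablePred

variable {f g a b : World → (ℕ → ℕ) → ℕ} {P R : World → (ℕ → ℕ) → Prop}

theorem of_pos (hf : Definable f) (h : ∀ w v, 0 < f w v ↔ P w v) : DefinablePred P :=
  ⟨(inferInstance : Definable fun w v => 1 - (1 - f w v)).congr fun w v => by
    by_cases hp : P w v
    · have := (h w v).2 hp
      rw [ind_of_true hp]
      omega
    · have := mt (h w v).1 hp
      rw [ind_of_false hp]
      omega⟩

instance lt [Definable f] [Definable g] : DefinablePred fun w v => f w v < g w v :=
  of_pos (f := fun w v => g w v - f w v) (by infer_instance) fun w v => by omega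

instance not [DefinablePred P] : DefinablePred fun w v => ¬P w v :=
  of_pos (f := fun w v => 1 - ind (P w v)) (by infer_instance) fun w v => by
    by_cases h : P w v <;> simp [ind, h]

instance and [DefinablePred P] [DefinablePred R] : DefinablePred fun w v => P w v ∧ R w v :=
  of_pos (f := fun w v => ind (P w v) * ind (R w v)) (by infer_instance) fun w v => by
    by_cases h : P w v <;> by_cases h' : R w v <;> simp [ind, h, h']

theorem congr (hP : DefinablePred P) (h : ∀ w v, P w v ↔ R w v) : DefinablePred R := by
  have : P = R := by
    funext w v
    exact propext (h w v)
  exact this ▸ hP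

instance le [Definable f] [Definable g] : DefinablePred fun w v => f w v ≤ g w v :=
  (inferInstance : DefinablePred fun w v => ¬g w v < f w v).congr fun _ _ => not_lt

instance eq [Definable f] [Definable g] : DefinablePred fun w v => f w v = g w v :=
  (inferInstance : DefinablePred fun w v => f w v ≤ g w v ∧ g w v ≤ f w v).congr
    fun _ _ => le_antisymm_iff.symm

instance or [DefinablePred P] [DefinablePred R] : DefinablePred fun w v => P w v ∨ R w v :=
  (inferInstance : DefinablePred fun w v => ¬(¬P w v ∧ ¬R w v)).congr fun w v => by tauto

instance imp [DefinablePred P] [DefinablePred R] : DefinablePred fun w v => P w v → R w v :=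
  (inferInstance : DefinablePred fun w v => ¬P w v ∨ R w v).congr fun w v => by tauto

instance iff [DefinablePred P] [DefinablePred R] : DefinablePred fun w v => (P w v ↔ R w v) :=
  (inferInstance : DefinablePred fun w v => (P w v → R w v) ∧ (R w v → P w v)).congr
    fun w v => by tauto

instance const (p : Prop) : DefinablePred fun _ _ => p :=
  ⟨inferInstanceAs (Definable fun _ _ => ind p)⟩

instance ex {S : World → (ℕ → ℕ) → ℕ → Prop} [Definable f]
    [DefinablePred fun w v => S w (fun j => v (j + 1)) (v 0)] :
    DefinablePred fun w v => ∃ i, i < f w v ∧ S w v i :=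
  of_pos (f := fun w v => ∑ i ∈ Finset.range (f w v), ind (S w v i))
    (Definable.sum (h := fun w v i => ind (S w v i))) fun w v => by
      simp only [Finset.sum_pos_iff, Finset.mem_range, ind_pos]

instance all {S : World → (ℕ → ℕ) → ℕ → Prop} [Definable f]
    [h : DefinablePred fun w v => S w (fun j => v (j + 1)) (v 0)] :
    DefinablePred fun w v => ∀ i, i < f w v → S w v i := by
  have h1 : DefinablePred fun w v => ¬S w (fun j => v (j + 1)) (v 0) := inferInstance
  exact (ex (S := fun w v i => ¬S w v i) |> fun h => @not _ h).congr fun w v => by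
    push Not
    rfl

instance inputBit [ha : Definable a] : DefinablePred fun w v => w.inputBit (a w v) := by
  obtain ⟨e, he⟩ := ha
  refine of_pos (f := fun w v => if w.x.getD (a w v) false = true then 1 else 0)
    ⟨.bit 0 e, fun w v => ?_⟩ fun w v => ?_
  · simp [Expr.eval, World.str, he]
  · simp only [World.inputBit]
    split_ifs with h
    · exact ⟨fun _ => h, fun _ => Nat.one_pos⟩
    · exact ⟨fun h' => absurd h' (by simp), fun h' => absurd h' h⟩

theorem comp₁ {F : World → ℕ → Prop} (hF : DefinablePred fun w v => F w (v 0)) [Definable a] :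
    DefinablePred fun w v => F w (a w v) :=
  ⟨hF.definable_ind.comp₁ (F := fun w a => ind (F w a))⟩

theorem comp₂ {F : World → ℕ → ℕ → Prop} (hF : DefinablePred fun w v => F w (v 0) (v 1))
    [Definable a] [Definable b] : DefinablePred fun w v => F w (a w v) (b w v) :=
  ⟨hF.definable_ind.comp₂ (F := fun w a b => ind (F w a b))⟩

end DefinablePred

/-- A language is in `Σ₂ᵖ` if it consists of the strings `x` for which there is a table such
that for all tables a definable property holds. -/
theorem mem_SigmaTwo_of_definable (P : World → Prop) (hP : DefinablePred fun w _ => P w)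
    (L : Language Bool) (hL : ∀ x, x ∈ L ↔ ∃ Y, ∀ Z, P ⟨x, Y, Z⟩) : L ∈ SigmaTwo := by
  obtain ⟨e, he⟩ := hP.definable_ind.exists_expr
  refine mem_SigmaTwo_of_expr e L fun x => ?_
  rw [hL]
  refine exists_congr fun Y => forall_congr' fun Z => ?_
  have := he ⟨x, Y, Z⟩ 0
  simp only [World.size] at this
  change _ ↔ 0 < Expr.eval x.length (fun k i => if k = 0 then x.getD i false else
    if k = 1 then Y i else Z i) e 0
  have h2 : Expr.eval x.length (fun k i => if k = 0 then x.getD i false else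
    if k = 1 then Y i else Z i) e 0 = ind (P ⟨x, Y, Z⟩) := this
  rw [h2, ind_pos]

/-! ### Definable strings -/

/-- The string `s` is definable if its length and its bits are. -/
class DefinableStr (s : World → (ℕ → ℕ) → List Bool) : Prop where
  length : Definable fun w v => (s w v).length
  bit : DefinablePred fun w v => (s w fun j => v (j + 1)).getD (v 0) false = true

theorem DefinablePred.subst {P : World → (ℕ → ℕ) → Prop} (hP : DefinablePred P)
    (σ : ℕ → World → (ℕ → ℕ) → ℕ) (hσ : ∀ j, Definable (σ j)) :
    DefinablePred fun w v => P w fun j => σ j w v :=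
  ⟨hP.definable_ind.subst σ hσ⟩

theorem length_flatMap_range (n : ℕ) (f : ℕ → List Bool) :
    ((range n).flatMap f).length = ∑ j ∈ Finset.range n, (f j).length := by
  induction n with
  | zero => rfl
  | succ n ih => simp only [range_succ, flatMap_append, length_append, ih, Finset.sum_range_succ,
      flatMap_singleton]

theorem getD_flatMap_range (n i : ℕ) (f : ℕ → List Bool) :
    ((range n).flatMap f).getD i false = true ↔ ∃ j, j < n ∧
      (∑ l ∈ Finset.range j, (f l).length ≤ i ∧
        (f j).getD (i - ∑ l ∈ Finset.range j, (f l).length) false = true) := by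
  induction n with
  | zero => simp
  | succ n ih =>
    have hlen := length_flatMap_range n f
    rw [range_succ, flatMap_append, flatMap_singleton]
    by_cases hi : i < ((range n).flatMap f).length
    · rw [getD_append _ _ _ _ hi, ih]
      constructor
      · rintro ⟨j, hj, h⟩
        exact ⟨j, by omega, h⟩
      · rintro ⟨j, hj, h₁, h₂⟩
        rcases Nat.lt_succ_iff_lt_or_eq.1 hj with hj | rfl
        · exact ⟨j, hj, h₁, h₂⟩
        · omega
    · rw [getD_append_right _ _ _ _ (by omega)]
      constructor
      · intro h
        exact ⟨n, by omega, by omega, by rwa [← hlen]⟩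
      · rintro ⟨j, hj, h₁, h₂⟩
        rcases Nat.lt_succ_iff_lt_or_eq.1 hj with hj | rfl
        · exfalso
          have h3 : i - ∑ l ∈ Finset.range j, (f l).length < (f j).length := by
            by_contra h
            rw [getD_eq_default _ _ (by omega)] at h₂
            simp at h₂
          have h4 := Finset.sum_range_succ (fun l => (f l).length) j
          have h5 : ∑ l ∈ Finset.range (j + 1), (f l).length ≤
              ∑ l ∈ Finset.range n, (f l).length :=
            Finset.sum_le_sum_of_subset (by simpa using hj)
          omega
        · rwa [hlen]

namespace DefinableStr

variable {s t : World → (ℕ → ℕ) → List Bool}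

instance nil : DefinableStr fun _ _ => [] where
  length := by simp only [length_nil]; infer_instance
  bit := by simp only [getD_nil, Bool.false_eq_true]; infer_instance

theorem cons {P : World → (ℕ → ℕ) → Prop} [∀ w v, Decidable (P w v)] [hP : DefinablePred P]
    [hs : DefinableStr s] : DefinableStr fun w v => decide (P w v) :: s w v where
  length := by
    have := hs.length
    simp only [length_cons]
    infer_instance
  bit := by
    have h1 : DefinablePred fun w v => P w fun j => v (j + 1) :=
      hP.subst (fun j _ v => v (j + 1)) fun _ => inferInstance
    have h2 : DefinablePred fun w v => (s w fun j => v (j + 1)).getD (v 0 - 1) false = true :=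
      hs.bit.subst (fun | 0 => fun _ v => v 0 - 1 | j + 1 => fun _ v => v (j + 1)) fun
        | 0 => by dsimp only; infer_instance
        | j + 1 => by dsimp only; infer_instance
    refine (inferInstance : DefinablePred fun w v => (v 0 = 0 ∧ P w fun j => v (j + 1)) ∨
      (0 < v 0 ∧ (s w fun j => v (j + 1)).getD (v 0 - 1) false = true)).congr fun w v => ?_
    rcases v 0 with _ | i <;> simp

instance cons_const {b : Bool} [DefinableStr s] : DefinableStr fun w v => b :: s w v := by
  have := cons (P := fun _ _ => b = true) (s := s)
  simpa using this

instance singleton {P : World → (ℕ → ℕ) → Prop} [∀ w v, Decidable (P w v)] [DefinablePred P] :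
    DefinableStr fun w v => [decide (P w v)] :=
  cons

instance append [hs : DefinableStr s] [ht : DefinableStr t] :
    DefinableStr fun w v => s w v ++ t w v where
  length := by
    have := hs.length
    have := ht.length
    simp only [length_append]
    infer_instance
  bit := by
    have h0 : Definable fun w v => (s w fun j => v (j + 1)).length :=
      hs.length.subst (fun j _ v => v (j + 1)) fun _ => inferInstance
    have h1 := hs.bit
    have h2 : DefinablePred fun w v => (t w fun j => v (j + 1)).getD
        (v 0 - (s w fun j => v (j + 1)).length) false = true :=
      ht.bit.subst (fun
        | 0 => fun w v => v 0 - (s w fun j => v (j + 1)).length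
        | j + 1 => fun _ v => v (j + 1)) fun
        | 0 => by dsimp only; infer_instance
        | j + 1 => by dsimp only; infer_instance
    refine (inferInstance : DefinablePred fun w v =>
      (v 0 < (s w fun j => v (j + 1)).length ∧
        (s w fun j => v (j + 1)).getD (v 0) false = true) ∨
      ((s w fun j => v (j + 1)).length ≤ v 0 ∧ (t w fun j => v (j + 1)).getD
        (v 0 - (s w fun j => v (j + 1)).length) false = true)).congr fun w v => ?_
    by_cases h : v 0 < (s w fun j => v (j + 1)).length
    · rw [getD_append _ _ _ _ h]
      simp [h]
    · rw [getD_append_right _ _ _ _ (by omega)]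
      simp [h, not_lt.1 h]

instance flatMap {f : World → (ℕ → ℕ) → ℕ} {s : World → (ℕ → ℕ) → ℕ → List Bool}
    [hf : Definable f] [hs : DefinableStr fun w v => s w (fun j => v (j + 1)) (v 0)] :
    DefinableStr fun w v => (range (f w v)).flatMap fun i => s w v i where
  length := by
    have := hs.length
    simp only [length_flatMap_range]
    exact Definable.sum (h := fun w v i => (s w v i).length)
  bit := by
    have hf' : Definable fun w v => f w fun j => v (j + 1) :=
      hf.subst (fun j _ v => v (j + 1)) fun _ => inferInstance
    have h1 : Definable fun w v => ∑ l ∈ Finset.range (v 0),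
        (s w (fun j => v (j + 1 + 1)) l).length := by
      have : Definable fun w v => (s w (fun j => v (j + 1 + 1 + 1)) (v 0)).length :=
        hs.length.subst (fun | 0 => fun _ v => v 0 | j + 1 => fun _ v => v (j + 1 + 1 + 1)) fun
          | 0 => by dsimp only; infer_instance
          | j + 1 => by dsimp only; infer_instance
      exact Definable.sum (f := fun _ v => v 0)
        (h := fun w v l => (s w (fun j => v (j + 1 + 1)) l).length)
    have h2 : DefinablePred fun w v => (s w (fun j => v (j + 1 + 1)) (v 0)).getD
        (v 1 - ∑ l ∈ Finset.range (v 0), (s w (fun j => v (j + 1 + 1)) l).length) false = true :=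
      hs.bit.subst (fun
        | 0 => fun w v => v 1 - ∑ l ∈ Finset.range (v 0), (s w (fun j => v (j + 1 + 1)) l).length
        | 1 => fun _ v => v 0
        | j + 2 => fun _ v => v (j + 2)) fun
        | 0 => by dsimp only; infer_instance
        | 1 => by dsimp only; infer_instance
        | j + 2 => by dsimp only; infer_instance
    simp only [getD_flatMap_range]
    exact DefinablePred.ex (f := fun w v => f w fun j => v (j + 1)) (S := fun w v j =>
      ∑ l ∈ Finset.range j, (s w (fun j => v (j + 1)) l).length ≤ v 0 ∧
        (s w (fun j => v (j + 1)) j).getD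
          (v 0 - ∑ l ∈ Finset.range j, (s w (fun j => v (j + 1)) l).length) false = true)

theorem comp₁ {F : World → ℕ → List Bool} (hF : DefinableStr fun w v => F w (v 0))
    {a : World → (ℕ → ℕ) → ℕ} [ha : Definable a] : DefinableStr fun w v => F w (a w v) where
  length := hF.length.comp₁ (F := fun w a => (F w a).length)
  bit := by
    have : Definable fun w v => a w fun j => v (j + 1) :=
      ha.subst (fun j _ v => v (j + 1)) fun _ => inferInstance
    exact hF.bit.subst (fun | 0 => fun _ v => v 0 | _ + 1 => fun w v => a w fun j => v (j + 1))
      fun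
      | 0 => by dsimp only; infer_instance
      | _ + 1 => by dsimp only; infer_instance

end DefinableStr

theorem ext_getD {l l' : List Bool} :
    l = l' ↔ l.length = l'.length ∧
      ∀ i, i < l.length → (l.getD i false = true ↔ l'.getD i false = true) := by
  constructor
  · rintro rfl
    simp
  · rintro ⟨hl, h⟩
    refine ext_getElem hl fun i h₁ h₂ => ?_
    have := h i h₁
    rw [getD_eq_getElem _ _ h₁, getD_eq_getElem _ _ h₂] at this
    exact Bool.eq_iff_iff.2 this

/-- It is definable that the input is a given definable string. -/
instance DefinablePred.input_eq {s : World → (ℕ → ℕ) → List Bool} [hs : DefinableStr s] :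
    DefinablePred fun w v => w.x = s w v := by
  have h1 := hs.length
  have h2 := hs.bit
  have : DefinablePred fun w v => ∀ i, i < w.size →
      (w.inputBit i ↔ (s w v).getD i false = true) :=
    DefinablePred.all (f := fun w _ => w.size) (S := fun w v i =>
      (w.inputBit i ↔ (s w v).getD i false = true))
  refine (inferInstance : DefinablePred fun w v => w.size = (s w v).length ∧
    ∀ i, i < w.size → (w.inputBit i ↔ (s w v).getD i false = true)).congr fun w v => ?_
  rw [ext_getD]
  rfl

end Complexity

open Complexity (ind ind_of_true ind_of_false ind_le_one ind_pos World Definable DefinablePred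
  DefinableStr)

namespace Election

/-! ### Rankings -/

theorem idxOf_filter_lt {p : ℕ → Bool} {a b : ℕ} (ha : p a = true) (hb : p b = true)
    (v : List ℕ) : (v.filter p).idxOf a < (v.filter p).idxOf b ↔ v.idxOf a < v.idxOf b := by
  induction v with
  | nil => simp
  | cons x v ih =>
    by_cases hx : p x = true
    · rw [List.filter_cons_of_pos hx]
      rcases eq_or_ne x a with rfl | hxa
      · rcases eq_or_ne x b with rfl | hxb
        · simp
        · simp [List.idxOf_cons_ne _ hxb]
      · rcases eq_or_ne x b with rfl | hxb
        · simp
        · simp [List.idxOf_cons_ne _ hxa, List.idxOf_cons_ne _ hxb, ih]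
    · rw [List.filter_cons_of_neg hx, ih]
      have hxa : x ≠ a := fun h => hx (h ▸ ha)
      have hxb : x ≠ b := fun h => hx (h ▸ hb)
      simp [List.idxOf_cons_ne _ hxa, List.idxOf_cons_ne _ hxb]

theorem isRanking_filter {C C' : Finset ℕ} {v : Vote} (hv : IsRanking C v) (h : C' ⊆ C) :
    IsRanking C' (v.filter fun c => c ∈ C') := by
  refine ⟨hv.1.filter _, ?_⟩
  ext c
  have : c ∈ v ↔ c ∈ C := by rw [← hv.2, List.mem_toFinset]
  simp only [List.mem_toFinset, List.mem_filter, this, decide_eq_true_eq]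
  exact ⟨fun h => h.2, fun hc => ⟨h hc, hc⟩⟩

theorem IsRanking.mem_iff {C : Finset ℕ} {v : Vote} (hv : IsRanking C v) (c : ℕ) :
    c ∈ v ↔ c ∈ C := by rw [← hv.2, List.mem_toFinset]

theorem IsRanking.length_eq {C : Finset ℕ} {v : Vote} (hv : IsRanking C v) :
    v.length = C.card := by rw [← hv.2, List.toFinset_card_of_nodup hv.1]

theorem IsRanking.idxOf_inj {C : Finset ℕ} {v : Vote} (hv : IsRanking C v) {a b : ℕ}
    (ha : a ∈ C) (h : v.idxOf a = v.idxOf b) : a = b :=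
  (List.idxOf_inj ((hv.mem_iff a).2 ha)).1 h

/-- Candidates can be ranked by any injective key. -/
theorem exists_isRanking {Cs : Finset ℕ} {name f : ℕ → ℕ} (hname : Set.InjOn name Cs)
    (hf : Set.InjOn f Cs) : ∃ r, IsRanking (Cs.image name) r ∧
      ∀ a ∈ Cs, ∀ b ∈ Cs, r.idxOf (name a) < r.idxOf (name b) ↔ f a < f b := by
  induction Cs using Finset.induction_on_max_value f with
  | empty => exact ⟨[], ⟨by simp, by simp⟩, by simp⟩
  | insert a s ha hmax ih =>
    obtain ⟨r, hr, hord⟩ := ih (hname.mono (by simp)) (hf.mono (by simp))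
    have hna : ∀ b ∈ s, name b ≠ name a := fun b hb h =>
      ha (hname (by simp [hb]) (by simp) h ▸ hb)
    have har : name a ∉ r := by
      rw [hr.mem_iff]
      simp only [Finset.mem_image, not_exists, not_and]
      exact hna
    have hidx : ∀ b ∈ s, (r ++ [name a]).idxOf (name b) = r.idxOf (name b) := fun b hb =>
      List.idxOf_append_of_mem ((hr.mem_iff _).2 (Finset.mem_image_of_mem _ hb))
    have hidx' : (r ++ [name a]).idxOf (name a) = r.length := by
      rw [List.idxOf_append_of_notMem har]
      simp
    have hlt : ∀ b ∈ s, r.idxOf (name b) < r.length := fun b hb =>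
      List.idxOf_lt_length_iff.2 ((hr.mem_iff _).2 (Finset.mem_image_of_mem _ hb))
    have hflt : ∀ b ∈ s, f b < f a := fun b hb => lt_of_le_of_ne (hmax b hb) fun h =>
      ha (hf (by simp [hb]) (by simp) h ▸ hb)
    refine ⟨r ++ [name a], ⟨?_, ?_⟩, ?_⟩
    · exact List.nodup_append.2 ⟨hr.1, by simp, by
        intro x hx y hy
        simp only [List.mem_singleton] at hy
        rintro rfl
        exact har (hy ▸ hx)⟩
    · rw [List.toFinset_append, hr.2, Finset.image_insert]
      ext x
      simp
    · intro b hb c hc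
      rw [Finset.mem_insert] at hb hc
      rcases hb with rfl | hb <;> rcases hc with rfl | hc
      · simp
      · rw [hidx', hidx c hc]
        have := hlt c hc; have := hflt c hc
        omega
      · rw [hidx', hidx b hb]
        have := hlt b hb; have := hflt b hb
        omega
      · rw [hidx b hb, hidx c hc]
        exact hord b hb c hc

/-! ### Elections given by indices -/

/-- The number of voters in `Vs` that rank `a` before `b`, where the rank of a candidate at a
voter is given by `R`. -/
noncomputable def rankSupport (n : ℕ) (Vs : ℕ → Prop) (R : ℕ → ℕ → ℕ) (a b : ℕ) : ℕ :=
  ∑ j ∈ Finset.range n, ind (Vs j ∧ R j a < R j b)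

theorem sum_ind_eq_countP {n : ℕ} {L : List ℕ} (hL : L.Nodup) (hn : ∀ j ∈ L, j < n)
    (P : ℕ → Prop) [DecidablePred P] :
    ∑ j ∈ Finset.range n, ind (j ∈ L ∧ P j) = L.countP fun j => P j := by
  classical
  rw [List.countP_eq_length_filter, ← List.toFinset_card_of_nodup (hL.filter _),
    show (fun j => ind (j ∈ L ∧ P j)) = fun j => if j ∈ L ∧ P j then 1 else 0 from
      funext fun j => by simp [ind], ← Finset.card_filter]
  congr 1
  ext j
  simp only [Finset.mem_filter, Finset.mem_range, List.mem_toFinset, List.mem_filter,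
    decide_eq_true_eq]
  exact ⟨fun h => h.2, fun h => ⟨hn _ h.1, h⟩⟩

theorem sum_ind_mul_eq_sum {n : ℕ} {L : List ℕ} (hL : L.Nodup) (hn : ∀ j ∈ L, j < n)
    (f : ℕ → ℕ) : ∑ j ∈ Finset.range n, ind (j ∈ L) * f j = (L.map f).sum := by
  classical
  rw [← List.sum_toFinset f hL]
  have : L.toFinset ⊆ Finset.range n := fun j hj => by
    simpa using hn j (List.mem_toFinset.1 hj)
  rw [← Finset.sum_subset this]
  · exact Finset.sum_congr rfl fun j hj => by rw [ind_of_true (List.mem_toFinset.1 hj), one_mul]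
  · intro j _ hj
    rw [ind_of_false (by simpa using hj), zero_mul]

/-- The candidates and the voters of an election, all taken from larger lists: `C` is the set of
names of the candidates with indices in `Cs`, `L` lists the indices of the voters, and `R` gives
the rank of a candidate in a vote. -/
structure Presents (m n : ℕ) (name : ℕ → ℕ) (vote : ℕ → Vote) (R : ℕ → ℕ → ℕ) (Cs : ℕ → Prop)
    (Vs : ℕ → Prop) (C : Finset ℕ) (L : List ℕ) : Prop where
  inj : ∀ a < m, ∀ b < m, name a = name b → a = b
  mem : ∀ c, c ∈ C ↔ ∃ a < m, Cs a ∧ name a = c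
  nodup : L.Nodup
  mem_voters : ∀ j, j ∈ L ↔ j < n ∧ Vs j
  ranking : ∀ j ∈ L, ∃ U, C ⊆ U ∧ IsRanking U (vote j)
  rank : ∀ j ∈ L, ∀ a < m, Cs a → ∀ b < m, Cs b →
    ((vote j).idxOf (name a) < (vote j).idxOf (name b) ↔ R j a < R j b)

namespace Presents

variable {m n : ℕ} {name : ℕ → ℕ} {vote : ℕ → Vote} {R : ℕ → ℕ → ℕ} {Cs Vs : ℕ → Prop}
  {C : Finset ℕ} {L : List ℕ}

theorem name_mem (h : Presents m n name vote R Cs Vs C L) {a : ℕ} (ha : a < m) (hC : Cs a) :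
    name a ∈ C := (h.mem _).2 ⟨a, ha, hC, rfl⟩

theorem name_mem_iff (h : Presents m n name vote R Cs Vs C L) {a : ℕ} (ha : a < m) :
    name a ∈ C ↔ Cs a := by
  refine ⟨fun hc => ?_, h.name_mem ha⟩
  obtain ⟨b, hb, hC, he⟩ := (h.mem _).1 hc
  exact h.inj b hb a ha he ▸ hC

open Classical in
/-- The indices of the candidates. -/
noncomputable def indices (_ : Presents m n name vote R Cs Vs C L) : Finset ℕ :=
  {a ∈ Finset.range m | Cs a}

theorem mem_indices (h : Presents m n name vote R Cs Vs C L) {a : ℕ} :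
    a ∈ h.indices ↔ a < m ∧ Cs a := by
  simp [indices]

theorem eq_image (h : Presents m n name vote R Cs Vs C L) : C = h.indices.image name := by
  ext c
  simp [h.mem, h.mem_indices, and_assoc]

theorem injOn (h : Presents m n name vote R Cs Vs C L) : Set.InjOn name h.indices := by
  intro a ha b hb hab
  rw [Finset.mem_coe, h.mem_indices] at ha hb
  exact h.inj a ha.1 b hb.1 hab

open Classical in
theorem sum_eq (h : Presents m n name vote R Cs Vs C L) (f : ℕ → ℕ) :
    ∑ c ∈ C, f c = ∑ a ∈ Finset.range m, ind (Cs a) * f (name a) := by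
  rw [h.eq_image, Finset.sum_image h.injOn, indices, Finset.sum_filter]
  exact Finset.sum_congr rfl fun a _ => by by_cases hc : Cs a <;> simp [ind, hc]

theorem card_le (h : Presents m n name vote R Cs Vs C L) : C.card ≤ m := by
  rw [h.eq_image]
  refine Finset.card_image_le.trans ?_
  have : h.indices ⊆ Finset.range m := fun a ha => Finset.mem_range.2 (h.mem_indices.1 ha).1
  simpa using Finset.card_le_card this

/-- Support in a sublist of the voters, whose votes may have been changed. -/
theorem support_eq {L' : List ℕ} (hL' : L'.Nodup) (hn : ∀ j ∈ L', j < n)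
    (r : ℕ → Vote) (T : ℕ → ℕ → ℕ) {a b : ℕ} (ha : a < m) (hCa : Cs a)
    (hb : b < m) (hCb : Cs b)
    (hT : ∀ j ∈ L', ∀ a < m, Cs a → ∀ b < m, Cs b →
      ((r j).idxOf (name a) < (r j).idxOf (name b) ↔ T j a < T j b)) :
    support (L'.map r) (name a) (name b) = rankSupport n (· ∈ L') T a b := by
  rw [rankSupport, sum_ind_eq_countP hL' hn (fun j => T j a < T j b), support, List.countP_map]
  refine List.countP_congr fun j hj => ?_
  simp only [Function.comp, decide_eq_true_eq]
  exact hT j hj a ha hCa b hb hCb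

theorem lt_of_mem (h : Presents m n name vote R Cs Vs C L) : ∀ j ∈ L, j < n :=
  fun j hj => ((h.mem_voters j).1 hj).1

theorem rankSupport_congr {Vs Vs' : ℕ → Prop} (h : ∀ j < n, Vs j ↔ Vs' j) (R : ℕ → ℕ → ℕ)
    (a b : ℕ) : rankSupport n Vs R a b = rankSupport n Vs' R a b :=
  Finset.sum_congr rfl fun j hj => by rw [h j (Finset.mem_range.1 hj)]

/-- The votes restricted to `C`. -/
theorem isRanking_restrict (h : Presents m n name vote R Cs Vs C L) {j : ℕ} (hj : j ∈ L) :
    IsRanking C ((vote j).filter fun c => c ∈ C) := by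
  obtain ⟨U, hU, hr⟩ := h.ranking j hj
  exact isRanking_filter hr hU

theorem restrict_rank (h : Presents m n name vote R Cs Vs C L) : ∀ j ∈ L, ∀ a < m, Cs a →
    ∀ b < m, Cs b → (((vote j).filter fun c => c ∈ C).idxOf (name a) <
      ((vote j).filter fun c => c ∈ C).idxOf (name b) ↔ R j a < R j b) := by
  intro j hj a ha hCa b hb hCb
  rw [← h.rank j hj a ha hCa b hb hCb]
  exact idxOf_filter_lt (by simpa using h.name_mem ha hCa) (by simpa using h.name_mem hb hCb) _

theorem restrict_eq (C : Finset ℕ) (vote : ℕ → Vote) (L : List ℕ) :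
    restrict C (L.map vote) = L.map fun j => (vote j).filter fun c => c ∈ C := by
  simp [restrict, Function.comp_def]

end Presents

/-! ### Certified election systems -/

/-- A way to certify the score of a candidate. The winners of the system `E` are the candidates
with the smallest score, where `Reach C V c k` says that `c` can get the score `k`. A certificate
is a table `T` that is `Valid` for a candidate, given by its index, in an election in the format of
`Presents`; it proves that the candidate can get the score `cost`, and conversely every score that
can be reached is matched by a certificate with small entries. The definability of these notions is
required for elections that are stored in tables, at the places that `Table` assigns to them. -/
structure Certification (E : System) where
  Reach : Finset ℕ → Profile → ℕ → ℕ → Prop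
  Valid : ℕ → ℕ → (ℕ → Prop) → (ℕ → Prop) → (ℕ → ℕ → ℕ) → ℕ → (ℕ → ℕ → ℕ) → Prop
  cost : ℕ → ℕ → (ℕ → Prop) → (ℕ → Prop) → (ℕ → ℕ → ℕ) → (ℕ → ℕ → ℕ) → ℕ
  mem_iff : ∀ C V c, c ∈ E C V ↔
    c ∈ C ∧ ∃ k, Reach C V c k ∧ ∀ d ∈ C, ∀ k', Reach C V d k' → k ≤ k'
  sound : ∀ {m n name vote R Cs Vs C L}, Presents m n name vote R Cs Vs C L →
    ∀ {a T}, a < m → Cs a → Valid m n Cs Vs R a T →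
      Reach C (restrict C (L.map vote)) (name a) (cost m n Cs Vs R T)
  complete : ∀ {m n name vote R Cs Vs C L}, Presents m n name vote R Cs Vs C L →
    ∀ {a k}, a < m → Cs a → Reach C (restrict C (L.map vote)) (name a) k →
      ∃ T : ℕ → ℕ → ℕ, (∀ j b, T j b ≤ m) ∧ Valid m n Cs Vs R a T ∧ cost m n Cs Vs R T ≤ k
  definable_valid : DefinablePred fun w v => Valid (v 0) (v 1) (fun a => 0 < w.tab 0 6 (v 2) a 0)
    (fun j => 0 < w.tab 0 7 (v 2) j 0) (fun j a => w.tab 0 4 j a 0) (v 3)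
    (w.tab (v 4) (v 5) (v 6))
  definable_cost : Definable fun w v => cost (v 0) (v 1) (fun a => 0 < w.tab 0 6 (v 2) a 0)
    (fun j => 0 < w.tab 0 7 (v 2) j 0) (fun j a => w.tab 0 4 j a 0) (w.tab (v 3) (v 4) (v 5))

namespace Certification

variable {E : System} (Q : Certification E)

theorem subset (Q : Certification E) (C : Finset ℕ) (V : Profile) : E C V ⊆ C :=
  fun c hc => ((Q.mem_iff C V c).1 hc).1

/-- The set `W` passes the test against the table `T`: if `T` certifies a score of the candidate
`d`, then `W` is not empty, and the certified scores of its members are not larger, and even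
smaller if `d` is not in `W`. -/
def Beats (m n : ℕ) (Cs Vs : ℕ → Prop) (R : ℕ → ℕ → ℕ) (W : ℕ → Prop)
    (cert : ℕ → ℕ → ℕ → ℕ) (T : ℕ → ℕ → ℕ) : Prop :=
  ∀ d, d < m → Cs d → Q.Valid m n Cs Vs R d T → (∃ a, a < m ∧ W a) ∧
    ∀ a, a < m → W a →
      Q.cost m n Cs Vs R (cert a) + ind (¬W d) ≤ Q.cost m n Cs Vs R T

variable {m n : ℕ} {name : ℕ → ℕ} {vote : ℕ → Vote} {R : ℕ → ℕ → ℕ} {Cs Vs : ℕ → Prop}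
  {C : Finset ℕ} {L : List ℕ} {W : ℕ → Prop}

/-- A set that passes all tests is the set of winners. -/
theorem winners_of_beats (h : Presents m n name vote R Cs Vs C L) (hW : ∀ a < m, W a → Cs a)
    {cert : ℕ → ℕ → ℕ → ℕ} (hcert : ∀ a < m, W a → Q.Valid m n Cs Vs R a (cert a))
    (hb : ∀ T : ℕ → ℕ → ℕ, (∀ j b, T j b ≤ m) → Q.Beats m n Cs Vs R W cert T) :
    ∀ a < m, name a ∈ E.winners C (L.map vote) ↔ W a := by
  have hmin : ∀ a < m, W a → ∀ d ∈ C, ∀ k', Q.Reach C (restrict C (L.map vote)) d k' →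
      Q.cost m n Cs Vs R (cert a) ≤ k' := by
    intro a ha hWa d hd k' hk'
    obtain ⟨d, hdm, hdC, rfl⟩ := (h.mem d).1 hd
    obtain ⟨T, hT, hv, hc⟩ := Q.complete h hdm hdC hk'
    have := (hb T hT d hdm hdC hv).2 a ha hWa
    omega
  intro a ha
  rw [System.winners, Q.mem_iff]
  constructor
  · rintro ⟨haC, k, hk, hkmin⟩
    have haC := (h.name_mem_iff ha).1 haC
    obtain ⟨T, hT, hv, hc⟩ := Q.complete h ha haC hk
    obtain ⟨⟨b, hbm, hWb⟩, hcost⟩ := hb T hT a ha haC hv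
    have h1 := hcost b hbm hWb
    have h2 := hkmin (name b) (h.name_mem hbm (hW b hbm hWb)) _
      (Q.sound h hbm (hW b hbm hWb) (hcert b hbm hWb))
    by_contra hWa
    rw [ind_of_true hWa] at h1
    omega
  · intro hWa
    exact ⟨h.name_mem ha (hW a ha hWa), _, Q.sound h ha (hW a ha hWa) (hcert a ha hWa),
      hmin a ha hWa⟩

/-- The set of winners passes all tests. -/
theorem exists_beats (h : Presents m n name vote R Cs Vs C L)
    (hW : ∀ a < m, W a ↔ name a ∈ E.winners C (L.map vote)) :
    ∃ cert : ℕ → ℕ → ℕ → ℕ, (∀ a j b, cert a j b ≤ m) ∧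
      (∀ a < m, W a → Q.Valid m n Cs Vs R a (cert a)) ∧
      ∀ T, Q.Beats m n Cs Vs R W cert T := by
  classical
  have key : ∀ a, ∃ T : ℕ → ℕ → ℕ, (∀ j b, T j b ≤ m) ∧ (a < m → W a →
      Q.Valid m n Cs Vs R a T ∧ ∀ d ∈ C, ∀ k', Q.Reach C (restrict C (L.map vote)) d k' →
        Q.cost m n Cs Vs R T ≤ k') := by
    intro a
    by_cases ha : a < m ∧ W a
    · obtain ⟨haC, k, hk, hmin⟩ := (Q.mem_iff _ _ _).1 ((hW a ha.1).1 ha.2)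
      obtain ⟨T, hT, hv, hc⟩ := Q.complete h ha.1 ((h.name_mem_iff ha.1).1 haC) hk
      exact ⟨T, hT, fun _ _ => ⟨hv, fun d hd k' hk' => hc.trans (hmin d hd k' hk')⟩⟩
    · exact ⟨fun _ _ => 0, fun _ _ => Nat.zero_le _, fun h1 h2 => absurd ⟨h1, h2⟩ ha⟩
  choose cert hbd hcert using key
  refine ⟨cert, hbd, fun a ha hWa => (hcert a ha hWa).1, ?_⟩
  intro T d hd hdC hv
  have hr := Q.sound h hd hdC hv
  have hdm := h.name_mem hd hdC
  constructor
  · have hex : ∃ k, ∃ c ∈ C, Q.Reach C (restrict C (L.map vote)) c k := ⟨_, _, hdm, hr⟩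
    obtain ⟨c, hc, hk⟩ := Nat.find_spec hex
    obtain ⟨a, ha, haC, rfl⟩ := (h.mem c).1 hc
    refine ⟨a, ha, (hW a ha).2 ((Q.mem_iff _ _ _).2 ⟨hc, _, hk, fun d hd k' hk' => ?_⟩)⟩
    exact Nat.find_min' hex ⟨d, hd, hk'⟩
  · intro a ha hWa
    have hmin := (hcert a ha hWa).2
    have h1 := hmin _ hdm _ hr
    by_cases hWd : W d
    · rw [ind_of_false (by simpa using hWd)]
      simpa using h1
    · rw [ind_of_true hWd]
      by_contra hlt
      refine hWd ((hW d hd).2 ((Q.mem_iff _ _ _).2 ⟨hdm, _, hr, fun e he k' hk' => ?_⟩))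
      have := hmin e he k' hk'
      omega

end Certification

/-! ### Kemeny -/

/-- A certificate for Kemeny is a ranking, given by the position `T 0 a` of every candidate, with
the candidate `c` on top. -/
def KemenyValid (m _n : ℕ) (Cs _Vs : ℕ → Prop) (_R : ℕ → ℕ → ℕ) (c : ℕ) (T : ℕ → ℕ → ℕ) : Prop :=
  (∀ a, a < m → Cs a → ∀ b, b < m → Cs b → T 0 a = T 0 b → a = b) ∧
    ∀ a, a < m → Cs a → T 0 c ≤ T 0 a

/-- The Kemeny distance of a ranking given by positions. -/
noncomputable def kemenyCost (m n : ℕ) (Cs Vs : ℕ → Prop) (R T : ℕ → ℕ → ℕ) : ℕ :=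
  ∑ a ∈ Finset.range m, ∑ b ∈ Finset.range m,
    ind (Cs a ∧ Cs b ∧ T 0 a < T 0 b) * rankSupport n Vs R b a

namespace Presents

variable {m n : ℕ} {name : ℕ → ℕ} {vote : ℕ → Vote} {R : ℕ → ℕ → ℕ} {Cs Vs : ℕ → Prop}
  {C : Finset ℕ} {L : List ℕ}

theorem support_restrict_eq (h : Presents m n name vote R Cs Vs C L) {a b : ℕ} (ha : a < m)
    (hCa : Cs a) (hb : b < m) (hCb : Cs b) :
    support (restrict C (L.map vote)) (name a) (name b) = rankSupport n Vs R a b := by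
  rw [restrict_eq, support_eq h.nodup h.lt_of_mem _ R ha hCa hb hCb h.restrict_rank]
  exact rankSupport_congr (fun j hj => by simp [h.mem_voters, hj]) R a b

theorem kemenyDistance_eq (h : Presents m n name vote R Cs Vs C L) {r : Vote} {T : ℕ → ℕ → ℕ}
    (hr : ∀ a < m, Cs a → ∀ b < m, Cs b → (r.idxOf (name a) < r.idxOf (name b) ↔
      T 0 a < T 0 b)) :
    kemenyDistance C (restrict C (L.map vote)) r = kemenyCost m n Cs Vs R T := by
  rw [kemenyDistance, h.sum_eq, kemenyCost]
  refine Finset.sum_congr rfl fun a ha => ?_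
  rw [h.sum_eq, Finset.mul_sum]
  refine Finset.sum_congr rfl fun b hb => ?_
  rw [Finset.mem_range] at ha hb
  by_cases hCa : Cs a
  · by_cases hCb : Cs b
    · rw [h.support_restrict_eq hb hCb ha hCa]
      simp [ind, hCa, hCb, hr a ha hCa b hb hCb]
    · simp [ind, hCb]
  · simp [ind, hCa]

end Presents

theorem head?_eq_some_iff {C : Finset ℕ} {r : Vote} (hr : IsRanking C r) {c : ℕ} (hc : c ∈ C) :
    r.head? = some c ↔ ∀ d ∈ C, r.idxOf c ≤ r.idxOf d := by
  have hcr := (hr.mem_iff c).2 hc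
  cases r with
  | nil => simp at hcr
  | cons e r =>
    rw [List.head?_cons, Option.some.injEq]
    constructor
    · rintro rfl d _
      simp
    · intro h
      have := h e ((hr.mem_iff e).1 (by simp))
      rw [List.idxOf_cons_self, Nat.le_zero] at this
      by_contra hec
      rw [List.idxOf_cons_ne _ hec] at this
      simp at this

/-- Scores for Kemeny: the distances of rankings with `c` on top. -/
def KemenyReachable (C : Finset ℕ) (V : Profile) (c k : ℕ) : Prop :=
  ∃ r, IsRanking C r ∧ r.head? = some c ∧ kemenyDistance C V r = k

open Classical in
theorem mem_kemeny_iff (C : Finset ℕ) (V : Profile) (c : ℕ) : c ∈ kemeny C V ↔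
    c ∈ C ∧ ∃ k, KemenyReachable C V c k ∧ ∀ d ∈ C, ∀ k', KemenyReachable C V d k' → k ≤ k' := by
  rw [kemeny, Finset.mem_filter]
  refine and_congr_right fun hc => ?_
  constructor
  · rintro ⟨r, ⟨hr, hmin⟩, hh⟩
    refine ⟨_, ⟨r, hr, hh, rfl⟩, ?_⟩
    rintro d _ k' ⟨s, hs, _, rfl⟩
    exact hmin s hs
  · rintro ⟨k, ⟨r, hr, hh, rfl⟩, hmin⟩
    refine ⟨r, ⟨hr, fun s hs => ?_⟩, hh⟩
    cases s with
    | nil =>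
      have := (hs.mem_iff c).2 hc
      simp at this
    | cons d s => exact hmin d ((hs.mem_iff d).1 (by simp)) _ ⟨_, hs, rfl, rfl⟩

/-- Winners under Kemeny are certified by rankings. -/
noncomputable def kemenyCertification : Certification kemeny where
  Reach := KemenyReachable
  Valid := KemenyValid
  cost := kemenyCost
  mem_iff := mem_kemeny_iff
  sound := by
    intro m n name vote R Cs Vs C L h a T ha haC hv
    have hinj : Set.InjOn (T 0) (↑(h.indices) : Set ℕ) := by
      intro b hb c hc hbc
      rw [Finset.mem_coe, h.mem_indices] at hb hc
      exact hv.1 b hb.1 hb.2 c hc.1 hc.2 hbc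
    obtain ⟨r, hr, hord⟩ := exists_isRanking h.injOn hinj
    rw [← h.eq_image] at hr
    have hord : ∀ a < m, Cs a → ∀ b < m, Cs b →
        (r.idxOf (name a) < r.idxOf (name b) ↔ T 0 a < T 0 b) := fun a ha hCa b hb hCb =>
      hord a (h.mem_indices.2 ⟨ha, hCa⟩) b (h.mem_indices.2 ⟨hb, hCb⟩)
    refine ⟨r, hr, ?_, h.kemenyDistance_eq hord⟩
    rw [head?_eq_some_iff hr (h.name_mem ha haC)]
    intro d hd
    obtain ⟨d, hdm, hdC, rfl⟩ := (h.mem d).1 hd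
    have h1 := hord d hdm hdC a ha haC
    have h2 := hv.2 d hdm hdC
    omega
  complete := by
    rintro m n name vote R Cs Vs C L h a k ha haC ⟨r, hr, hh, rfl⟩
    refine ⟨fun _ b => r.idxOf (name b), fun _ b => ?_, ⟨?_, ?_⟩, ?_⟩
    · exact List.idxOf_le_length.trans (hr.length_eq ▸ h.card_le)
    · intro b hb hCb c hc hCc hbc
      exact h.inj b hb c hc (hr.idxOf_inj (h.name_mem hb hCb) hbc)
    · exact fun b hb hCb => (head?_eq_some_iff hr (h.name_mem ha haC)).1 hh _ (h.name_mem hb hCb)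
    · exact (h.kemenyDistance_eq fun _ _ _ _ _ _ => Iff.rfl).ge
  definable_valid := by unfold KemenyValid; infer_instance
  definable_cost := by unfold kemenyCost rankSupport; infer_instance

/-! ### Young -/

/-- A certificate for Young marks the voters that are kept, so that `c` is a weak Condorcet
winner. -/
def YoungValid (m n : ℕ) (Cs Vs : ℕ → Prop) (R : ℕ → ℕ → ℕ) (c : ℕ) (T : ℕ → ℕ → ℕ) : Prop :=
  ∀ d, d < m → Cs d → ¬d = c →
    rankSupport n (fun j => Vs j ∧ 0 < T j 0) R d c ≤
      rankSupport n (fun j => Vs j ∧ 0 < T j 0) R c d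

/-- The number of deleted voters. -/
noncomputable def youngCost (_m n : ℕ) (_Cs Vs : ℕ → Prop) (_R T : ℕ → ℕ → ℕ) : ℕ :=
  ∑ j ∈ Finset.range n, ind (Vs j ∧ ¬0 < T j 0)

namespace Presents

variable {m n : ℕ} {name : ℕ → ℕ} {vote : ℕ → Vote} {R : ℕ → ℕ → ℕ} {Cs Vs : ℕ → Prop}
  {C : Finset ℕ} {L : List ℕ}

/-- Statements about all rivals of a candidate, in terms of indices. -/
theorem forall_rival_iff (h : Presents m n name vote R Cs Vs C L) {a : ℕ} (ha : a < m)
    (P : ℕ → Prop) : (∀ d ∈ C, d ≠ name a → P d) ↔ ∀ d < m, Cs d → d ≠ a → P (name d) := by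
  constructor
  · exact fun hP d hd hdC hne => hP _ (h.name_mem hd hdC) fun he => hne (h.inj d hd a ha he)
  · intro hP d hd hne
    obtain ⟨d, hdm, hdC, rfl⟩ := (h.mem d).1 hd
    exact hP d hdm hdC fun he => hne (he ▸ rfl)

theorem isWeakCondorcetWinner_iff (h : Presents m n name vote R Cs Vs C L) {L' : List ℕ}
    (hL' : L'.Sublist L) {K : ℕ → Prop} (hK : ∀ j < n, j ∈ L' ↔ K j) {a : ℕ} (ha : a < m)
    (haC : Cs a) :
    IsWeakCondorcetWinner C (L'.map fun j => (vote j).filter fun c => c ∈ C) (name a) ↔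
      ∀ d < m, Cs d → d ≠ a → rankSupport n K R d a ≤ rankSupport n K R a d := by
  rw [IsWeakCondorcetWinner, h.forall_rival_iff ha]
  have key : ∀ a < m, Cs a → ∀ b < m, Cs b →
      support (L'.map fun j => (vote j).filter fun c => c ∈ C) (name a) (name b) =
        rankSupport n K R a b := by
    intro a ha haC b hb hbC
    rw [support_eq (h.nodup.sublist hL') (fun j hj => h.lt_of_mem j (hL'.subset hj)) _ R ha haC
      hb hbC fun j hj => h.restrict_rank j (hL'.subset hj)]
    exact rankSupport_congr hK R a b
  refine forall_congr' fun d => forall_congr' fun hd => forall_congr' fun hdC => ?_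
  rw [key d hd hdC a ha haC, key a ha haC d hd hdC]

end Presents

theorem mem_young_iff (C : Finset ℕ) (V : Profile) (c : ℕ) : c ∈ young C V ↔
    c ∈ C ∧ ∃ k, YoungReachable C V c k ∧ ∀ d ∈ C, ∀ k', YoungReachable C V d k' → k ≤ k' := by
  classical
  rw [young, Finset.mem_filter]

/-- Winners under Young are certified by sets of voters. -/
noncomputable def youngCertification : Certification young where
  Reach := YoungReachable
  Valid := YoungValid
  cost := youngCost
  mem_iff := mem_young_iff
  sound := by
    intro m n name vote R Cs Vs C L h a T ha haC hv
    rw [Presents.restrict_eq]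
    refine ⟨_, (List.filter_sublist (p := fun j => 0 < T j 0)).map _, ?_, ?_⟩
    · have h1 : youngCost m n Cs Vs R T = L.countP fun j => ¬0 < T j 0 := by
        rw [← sum_ind_eq_countP h.nodup h.lt_of_mem fun j => ¬0 < T j 0, youngCost]
        refine Finset.sum_congr rfl fun j hj => ?_
        simp [h.mem_voters, Finset.mem_range.1 hj]
      rw [List.length_map, List.length_map, ← List.countP_eq_length_filter, h1]
      have := L.length_eq_countP_add_countP fun j => 0 < T j 0
      simpa using this.symm
    · refine (h.isWeakCondorcetWinner_iff (K := fun j => Vs j ∧ 0 < T j 0) List.filter_sublist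
        (fun j hj => ?_) ha haC).2 hv
      simp [List.mem_filter, h.mem_voters, hj]
  complete := by
    rintro m n name vote R Cs Vs C L h a k ha haC ⟨V', hV', hlen, hw⟩
    rw [Presents.restrict_eq] at hV' hlen
    obtain ⟨L', hL', rfl⟩ := List.sublist_map_iff.1 hV'
    have hpos : ∀ j, 0 < ind (j ∈ L') ↔ j ∈ L' := fun j => ind_pos
    refine ⟨fun j _ => ind (j ∈ L'), fun j _ => (ind_le_one _).trans (by omega), ?_, ?_⟩
    · refine (h.isWeakCondorcetWinner_iff hL' (fun j hj => ?_) ha haC).1 hw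
      rw [hpos]
      exact ⟨fun hj => ⟨((h.mem_voters j).1 (hL'.subset hj)).2, hj⟩, fun hj => hj.2⟩
    · have h1 : youngCost m n Cs Vs R (fun j _ => ind (j ∈ L')) =
          L.countP fun j => ¬j ∈ L' := by
        rw [← sum_ind_eq_countP h.nodup h.lt_of_mem fun j => ¬j ∈ L', youngCost]
        refine Finset.sum_congr rfl fun j hj => ?_
        simp [h.mem_voters, Finset.mem_range.1 hj, hpos]
      have h2 : L'.length ≤ L.countP fun j => j ∈ L' := by
        have := hL'.countP_le (p := fun j => decide (j ∈ L'))
        rwa [List.countP_eq_length.2 (by simp)] at this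
      have h3 := L.length_eq_countP_add_countP fun j => decide (j ∈ L')
      have h4 : (L.countP fun j => ¬j ∈ L') = L.countP fun j => !decide (j ∈ L') :=
        List.countP_congr fun j _ => by simp
      rw [List.length_map, List.length_map] at hlen
      rw [h1, h4]
      simp only [decide_eq_true_eq] at h3
      simp only [← decide_not] at *
      omega
  definable_valid := by unfold YoungValid rankSupport; infer_instance
  definable_cost := by unfold youngCost; infer_instance

/-! ### Dodgson -/

/-- The pairs of candidates that are ordered differently by `v` and `r`, once each. -/
def inversions (C : Finset ℕ) (v r : Vote) : Finset (ℕ × ℕ) :=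
  {e ∈ C ×ˢ C | v.idxOf e.1 < v.idxOf e.2 ∧ r.idxOf e.2 < r.idxOf e.1}

theorem mem_inversions {C : Finset ℕ} {v r : Vote} {a b : ℕ} : (a, b) ∈ inversions C v r ↔
    (a ∈ C ∧ b ∈ C) ∧ v.idxOf a < v.idxOf b ∧ r.idxOf b < r.idxOf a := by
  simp [inversions]

theorem card_inversions (C : Finset ℕ) (v r : Vote) : (inversions C v r).card =
    ∑ a ∈ C, ∑ b ∈ C, ind (v.idxOf a < v.idxOf b ∧ r.idxOf b < r.idxOf a) := by
  rw [inversions, Finset.card_filter, Finset.sum_product]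
  exact Finset.sum_congr rfl fun a _ => Finset.sum_congr rfl fun b _ => by simp [ind]

theorem idxOf_adjacent {s t : Vote} {a b : ℕ} (h : (s ++ a :: b :: t).Nodup) :
    (s ++ a :: b :: t).idxOf a = s.length ∧ (s ++ a :: b :: t).idxOf b = s.length + 1 := by
  have hab : a ≠ b := by
    rintro rfl
    simp [List.nodup_append] at h
  simp only [List.nodup_append] at h
  have has : a ∉ s := fun hs => h.2.2 a hs a (by simp) rfl
  have hbs : b ∉ s := fun hs => h.2.2 b hs b (by simp) rfl
  exact ⟨by simp [List.idxOf_append_of_notMem has],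
    by simp [List.idxOf_append_of_notMem hbs, List.idxOf_cons_ne _ hab]⟩

theorem nodup_swap {s t : Vote} {a b : ℕ} (h : (s ++ a :: b :: t).Nodup) :
    (s ++ b :: a :: t).Nodup :=
  ((List.Perm.swap a b t).append_left s).nodup_iff.2 h

/-- A swap of two adjacent candidates changes only the order of these two. -/
theorem idxOf_lt_swap {s t : Vote} {a b x y : ℕ} (h : (s ++ a :: b :: t).Nodup)
    (hlt : (s ++ b :: a :: t).idxOf x < (s ++ b :: a :: t).idxOf y)
    (hnot : ¬(s ++ a :: b :: t).idxOf x < (s ++ a :: b :: t).idxOf y) : x = b ∧ y = a := by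
  obtain ⟨e1, e2⟩ := idxOf_adjacent h
  obtain ⟨e3, e4⟩ := idxOf_adjacent (nodup_swap h)
  have e5 : ∀ z, z ≠ a → z ≠ b → (s ++ b :: a :: t).idxOf z = (s ++ a :: b :: t).idxOf z ∧
      ((s ++ a :: b :: t).idxOf z < s.length ∨ s.length + 2 ≤ (s ++ a :: b :: t).idxOf z) := by
    intro z hza hzb
    by_cases hzs : z ∈ s
    · rw [List.idxOf_append_of_mem hzs, List.idxOf_append_of_mem hzs]
      exact ⟨rfl, Or.inl (List.idxOf_lt_length_iff.2 hzs)⟩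
    · rw [List.idxOf_append_of_notMem hzs, List.idxOf_append_of_notMem hzs,
        List.idxOf_cons_ne _ hza.symm, List.idxOf_cons_ne _ hzb.symm,
        List.idxOf_cons_ne _ hza.symm, List.idxOf_cons_ne _ hzb.symm]
      exact ⟨rfl, Or.inr (by omega)⟩
  rcases eq_or_ne x a with rfl | hxa
  · rcases eq_or_ne y x with rfl | hyx
    · omega
    rcases eq_or_ne y b with rfl | hyb
    · omega
    have := e5 y hyx hyb
    omega
  rcases eq_or_ne x b with rfl | hxb
  · rcases eq_or_ne y a with rfl | hya
    · exact ⟨rfl, rfl⟩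
    rcases eq_or_ne y x with rfl | hyx
    · omega
    have := e5 y hya hyx
    omega
  have := e5 x hxa hxb
  rcases eq_or_ne y a with rfl | hya
  · omega
  rcases eq_or_ne y b with rfl | hyb
  · omega
  have := e5 y hya hyb
  omega

theorem isRanking_swap {C : Finset ℕ} {s t : Vote} {a b : ℕ} (h : IsRanking C (s ++ a :: b :: t)) :
    IsRanking C (s ++ b :: a :: t) :=
  ⟨nodup_swap h.1, by
    rw [← h.2]
    exact List.toFinset_eq_of_perm _ _ ((List.Perm.swap a b t).append_left s)⟩

/-- A swap adds at most one inversion. -/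
theorem card_inversions_swap_le {C : Finset ℕ} {v s t : Vote} {a b : ℕ}
    (h : IsRanking C (s ++ a :: b :: t)) :
    (inversions C v (s ++ b :: a :: t)).card ≤ (inversions C v (s ++ a :: b :: t)).card + 1 := by
  classical
  refine (Finset.card_le_card (t := insert (a, b) (inversions C v (s ++ a :: b :: t))) ?_).trans
    (Finset.card_insert_le _ _)
  rintro ⟨x, y⟩ he
  rw [mem_inversions] at he
  rw [Finset.mem_insert, mem_inversions]
  by_contra hn
  rw [not_or] at hn
  obtain ⟨rfl, rfl⟩ := idxOf_lt_swap h.1 he.2.2 fun h' => hn.2 ⟨he.1, he.2.1, h'⟩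
  exact hn.1 rfl

/-- Swapping an adjacent inversion removes exactly one inversion. -/
theorem card_inversions_swap {C : Finset ℕ} {r s t : Vote} {a b : ℕ}
    (h : IsRanking C (s ++ a :: b :: t)) (hab : r.idxOf b < r.idxOf a) :
    (inversions C (s ++ a :: b :: t) r).card =
      (inversions C (s ++ b :: a :: t) r).card + 1 := by
  classical
  have h' := isRanking_swap h
  have hmem : (a, b) ∈ inversions C (s ++ a :: b :: t) r := by
    refine mem_inversions.2 ⟨⟨(h.mem_iff a).1 (by simp), (h.mem_iff b).1 (by simp)⟩, ?_, hab⟩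
    obtain ⟨e1, e2⟩ := idxOf_adjacent h.1
    omega
  have heq : inversions C (s ++ b :: a :: t) r =
      (inversions C (s ++ a :: b :: t) r).erase (a, b) := by
    ext ⟨x, y⟩
    rw [Finset.mem_erase]
    constructor
    · intro he
      have he' := mem_inversions.1 he
      refine ⟨?_, mem_inversions.2 ⟨he'.1, ?_, he'.2.2⟩⟩
      · intro hxy
        obtain ⟨rfl, rfl⟩ := Prod.mk.inj hxy
        obtain ⟨e1, e2⟩ := idxOf_adjacent h'.1
        omega
      · by_contra hn
        obtain ⟨rfl, rfl⟩ := idxOf_lt_swap h.1 he'.2.1 hn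
        omega
    · rintro ⟨hne, he⟩
      have he' := mem_inversions.1 he
      refine mem_inversions.2 ⟨he'.1, ?_, he'.2.2⟩
      by_contra hn
      obtain ⟨rfl, rfl⟩ := idxOf_lt_swap h'.1 he'.2.1 hn
      exact hne rfl
  rw [heq, Finset.card_erase_add_one hmem]

/-- A ranking without adjacent inversions with respect to `r` is equal to `r`. -/
theorem eq_of_no_adjacent_inversion {C : Finset ℕ} {v r : Vote} (hv : IsRanking C v)
    (hr : IsRanking C r)
    (h : ∀ s a b t, v = s ++ a :: b :: t → ¬r.idxOf b < r.idxOf a) : v = r := by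
  have hchain : v.IsChain fun a b => r.idxOf a ≤ r.idxOf b :=
    List.isChain_iff_forall_rel_of_append_cons_cons.2 fun a b s t he => not_lt.1 (h s a b t he)
  have hpv : v.Pairwise fun a b => r.idxOf a ≤ r.idxOf b := by
    have : Trans (fun a b => r.idxOf a ≤ r.idxOf b) (fun a b => r.idxOf a ≤ r.idxOf b)
      (fun a b => r.idxOf a ≤ r.idxOf b) := ⟨le_trans⟩
    exact hchain.pairwise
  have hpr : r.Pairwise fun a b => r.idxOf a ≤ r.idxOf b := by
    rw [List.pairwise_iff_getElem]
    intro i j hi hj hij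
    rw [hr.1.idxOf_getElem i hi, hr.1.idxOf_getElem j hj]
    exact hij.le
  have hp : v.Perm r := (List.perm_ext_iff_of_nodup hv.1 hr.1).2 fun c => by
    rw [hv.mem_iff, hr.mem_iff]
  refine hp.eq_of_pairwise (fun a b ha hb h₁ h₂ => ?_) hpv hpr
  exact hr.idxOf_inj ((hv.mem_iff a).1 ha) (le_antisymm h₁ h₂)

/-- A ranking can be sorted with one swap for every inversion. -/
theorem Swaps.sort {C : Finset ℕ} {X V₁ V₂ : Profile} {r : Vote} (hr : IsRanking C r) :
    ∀ {v : Vote} {k : ℕ}, IsRanking C v → Swaps X k (V₁ ++ v :: V₂) →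
      Swaps X (k + (inversions C v r).card) (V₁ ++ r :: V₂) := by
  intro v k hv
  induction hn : (inversions C v r).card generalizing v k with
  | zero =>
    intro hX
    have : v = r := eq_of_no_adjacent_inversion hv hr fun s a b t he hab => by
      subst he
      have := card_inversions_swap hv hab
      omega
    exact this ▸ hX
  | succ n ih =>
    intro hX
    by_cases hex : ∃ s a b t, v = s ++ a :: b :: t ∧ r.idxOf b < r.idxOf a
    · obtain ⟨s, a, b, t, rfl, hab⟩ := hex
      have hc := card_inversions_swap hv hab
      have := ih (isRanking_swap hv) (by omega) hX.swap
      rwa [show k + (n + 1) = k + 1 + n by omega]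
    · have : v = r := eq_of_no_adjacent_inversion hv hr fun s a b t he hab =>
        hex ⟨s, a, b, t, he, hab⟩
      subst this
      have h0 : inversions C v v = ∅ := Finset.filter_eq_empty_iff.2 fun e _ h =>
        lt_asymm h.1 h.2
      rw [h0, Finset.card_empty] at hn
      omega

theorem Swaps.sort_all {C : Finset ℕ} {X : Profile} {v r : ℕ → Vote} (L : List ℕ)
    (hv : ∀ j ∈ L, IsRanking C (v j)) (hr : ∀ j ∈ L, IsRanking C (r j)) :
    ∀ {V₁ : Profile} {k : ℕ}, Swaps X k (V₁ ++ L.map v) →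
      Swaps X (k + (L.map fun j => (inversions C (v j) (r j)).card).sum) (V₁ ++ L.map r) := by
  induction L with
  | nil => exact fun h => h
  | cons j L ih =>
    intro V₁ k h
    have h1 := (Swaps.sort (hr j (by simp)) (hv j (by simp)) h)
    rw [List.append_cons] at h1
    have h2 := ih (fun i hi => hv i (by simp [hi])) (fun i hi => hr i (by simp [hi])) h1
    simpa [add_assoc] using h2

/-- The number of swaps is at least the number of inversions that they produce. -/
theorem Swaps.exists_inversions_le {C : Finset ℕ} {v : ℕ → Vote} {L : List ℕ} (hL : L.Nodup)
    (hv : ∀ j ∈ L, IsRanking C (v j)) {k : ℕ} {W : Profile} (h : Swaps (L.map v) k W) :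
    ∃ r : ℕ → Vote, W = L.map r ∧ (∀ j ∈ L, IsRanking C (r j)) ∧
      (L.map fun j => (inversions C (v j) (r j)).card).sum ≤ k := by
  induction h with
  | refl =>
    refine ⟨v, rfl, hv, ?_⟩
    have h0 : ∀ j, inversions C (v j) (v j) = ∅ := fun j =>
      Finset.filter_eq_empty_iff.2 fun e _ h => lt_asymm h.1 h.2
    simp [h0]
  | @swap k V₁ V₂ s t a b _ ih =>
    obtain ⟨r, hW, hr, hk⟩ := ih
    obtain ⟨L₁, L', rfl, rfl, h2⟩ := List.map_eq_append_iff.1 hW.symm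
    obtain ⟨j, L₂, rfl, hj, rfl⟩ := List.map_eq_cons_iff.1 h2
    have hj₁ : j ∉ L₁ := fun hm => by
      simp only [List.nodup_append] at hL
      exact hL.2.2 j hm j (by simp) rfl
    have hj₂ : j ∉ L₂ := (List.nodup_cons.1 (List.nodup_append.1 hL).2.1).1
    have hrj := hr j (by simp)
    rw [hj] at hrj
    have hne : ∀ i, i ≠ j → Function.update r j (s ++ b :: a :: t) i = r i := fun i hi =>
      Function.update_of_ne hi _ _
    have hne₁ : ∀ i ∈ L₁, Function.update r j (s ++ b :: a :: t) i = r i := fun i hi =>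
      hne i fun he => hj₁ (he ▸ hi)
    have hne₂ : ∀ i ∈ L₂, Function.update r j (s ++ b :: a :: t) i = r i := fun i hi =>
      hne i fun he => hj₂ (he ▸ hi)
    refine ⟨Function.update r j (s ++ b :: a :: t), ?_, ?_, ?_⟩
    · simp only [List.map_append, List.map_cons, Function.update_self]
      rw [List.map_congr_left hne₁, List.map_congr_left hne₂]
    · intro i hi
      rcases eq_or_ne i j with rfl | hij
      · rw [Function.update_self]
        exact isRanking_swap hrj
      · rw [hne i hij]
        exact hr i hi
    · have h1 := card_inversions_swap_le (v := v j) hrj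
      simp only [List.map_append, List.map_cons, List.sum_append, List.sum_cons,
        Function.update_self] at hk ⊢
      rw [List.map_congr_left (g := fun j => (inversions C (v j) (r j)).card) (l := L₁)
          fun i hi => by rw [hne₁ i hi],
        List.map_congr_left (g := fun j => (inversions C (v j) (r j)).card) (l := L₂)
          fun i hi => by rw [hne₂ i hi]]
      rw [hj] at hk
      omega

/-- A certificate for Dodgson is a table of the positions of the candidates in the votes after
the swaps, which make `c` a Condorcet winner. -/
def DodgsonValid (m n : ℕ) (Cs Vs : ℕ → Prop) (_R : ℕ → ℕ → ℕ) (c : ℕ) (T : ℕ → ℕ → ℕ) : Prop :=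
  (∀ j, j < n → Vs j → ∀ a, a < m → Cs a → ∀ b, b < m → Cs b → T j a = T j b → a = b) ∧
    ∀ d, d < m → Cs d → ¬d = c → rankSupport n Vs T d c < rankSupport n Vs T c d

/-- The number of inversions between the original and the new votes. -/
noncomputable def dodgsonCost (m n : ℕ) (Cs Vs : ℕ → Prop) (R T : ℕ → ℕ → ℕ) : ℕ :=
  ∑ j ∈ Finset.range n, ind (Vs j) * ∑ a ∈ Finset.range m, ind (Cs a) *
    ∑ b ∈ Finset.range m, ind (Cs b) * ind (R j a < R j b ∧ T j b < T j a)

namespace Presents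

variable {m n : ℕ} {name : ℕ → ℕ} {vote : ℕ → Vote} {R : ℕ → ℕ → ℕ} {Cs Vs : ℕ → Prop}
  {C : Finset ℕ} {L : List ℕ}

theorem sum_inversions (h : Presents m n name vote R Cs Vs C L) {r : ℕ → Vote} {T : ℕ → ℕ → ℕ}
    (hr : ∀ j ∈ L, ∀ a < m, Cs a → ∀ b < m, Cs b →
      ((r j).idxOf (name a) < (r j).idxOf (name b) ↔ T j a < T j b)) :
    (L.map fun j => (inversions C ((vote j).filter fun c => c ∈ C) (r j)).card).sum =
      dodgsonCost m n Cs Vs R T := by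
  rw [← sum_ind_mul_eq_sum h.nodup h.lt_of_mem, dodgsonCost]
  refine Finset.sum_congr rfl fun j hj => ?_
  rw [h.mem_voters, and_iff_right (Finset.mem_range.1 hj)]
  by_cases hV : Vs j
  swap
  · simp [ind, hV]
  have hjL := (h.mem_voters j).2 ⟨Finset.mem_range.1 hj, hV⟩
  congr 1
  rw [card_inversions, h.sum_eq]
  refine Finset.sum_congr rfl fun a ha => ?_
  by_cases hCa : Cs a
  swap
  · simp [ind, hCa]
  rw [h.sum_eq]
  congr 1
  refine Finset.sum_congr rfl fun b hb => ?_
  by_cases hCb : Cs b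
  swap
  · simp [ind, hCb]
  rw [Finset.mem_range] at ha hb
  rw [h.restrict_rank j hjL a ha hCa b hb hCb, hr j hjL b hb hCb a ha hCa]

theorem isCondorcetWinner_iff (h : Presents m n name vote R Cs Vs C L) {r : ℕ → Vote}
    {T : ℕ → ℕ → ℕ} (hr : ∀ j ∈ L, ∀ a < m, Cs a → ∀ b < m, Cs b →
      ((r j).idxOf (name a) < (r j).idxOf (name b) ↔ T j a < T j b)) {a : ℕ} (ha : a < m)
    (haC : Cs a) : IsCondorcetWinner C (L.map r) (name a) ↔
      ∀ d < m, Cs d → d ≠ a → rankSupport n Vs T d a < rankSupport n Vs T a d := by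
  rw [IsCondorcetWinner, h.forall_rival_iff ha]
  have key : ∀ a < m, Cs a → ∀ b < m, Cs b →
      support (L.map r) (name a) (name b) = rankSupport n Vs T a b := by
    intro a ha haC b hb hbC
    rw [support_eq h.nodup h.lt_of_mem _ T ha haC hb hbC hr]
    exact rankSupport_congr (fun j hj => by simp [h.mem_voters, hj]) T a b
  refine forall_congr' fun d => forall_congr' fun hd => forall_congr' fun hdC => ?_
  rw [key d hd hdC a ha haC, key a ha haC d hd hdC]

end Presents

theorem mem_dodgson_iff (C : Finset ℕ) (V : Profile) (c : ℕ) : c ∈ dodgson C V ↔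
    c ∈ C ∧ ∃ k, DodgsonReachable C V c k ∧
      ∀ d ∈ C, ∀ k', DodgsonReachable C V d k' → k ≤ k' := by
  classical
  rw [dodgson, Finset.mem_filter]

/-- Winners under Dodgson are certified by the votes after the swaps. -/
noncomputable def dodgsonCertification : Certification dodgson where
  Reach := DodgsonReachable
  Valid := DodgsonValid
  cost := dodgsonCost
  mem_iff := mem_dodgson_iff
  sound := by
    intro m n name vote R Cs Vs C L h a T ha haC hv
    have key : ∀ j, ∃ r, j ∈ L → IsRanking C r ∧ ∀ a < m, Cs a → ∀ b < m, Cs b →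
        (r.idxOf (name a) < r.idxOf (name b) ↔ T j a < T j b) := by
      intro j
      by_cases hj : j ∈ L
      swap
      · exact ⟨[], fun h => absurd h hj⟩
      have hinj : Set.InjOn (T j) (↑(h.indices) : Set ℕ) := by
        intro b hb c hc hbc
        rw [Finset.mem_coe, h.mem_indices] at hb hc
        have hj := (h.mem_voters j).1 hj
        exact hv.1 j hj.1 hj.2 b hb.1 hb.2 c hc.1 hc.2 hbc
      obtain ⟨r, hr, hord⟩ := exists_isRanking h.injOn hinj
      rw [← h.eq_image] at hr
      exact ⟨r, fun _ => ⟨hr, fun a ha hCa b hb hCb =>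
        hord a (h.mem_indices.2 ⟨ha, hCa⟩) b (h.mem_indices.2 ⟨hb, hCb⟩)⟩⟩
    choose r hr using key
    refine ⟨L.map r, ?_, (h.isCondorcetWinner_iff (fun j hj => (hr j hj).2) ha haC).2 hv.2⟩
    rw [Presents.restrict_eq, ← h.sum_inversions fun j hj => (hr j hj).2]
    have := Swaps.sort_all L (fun j hj => h.isRanking_restrict hj) (fun j hj => (hr j hj).1)
      (V₁ := []) Swaps.refl
    simpa using this
  complete := by
    rintro m n name vote R Cs Vs C L h a k ha haC ⟨W, hW, hc⟩
    rw [Presents.restrict_eq] at hW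
    obtain ⟨r, rfl, hr, hk⟩ :=
      hW.exists_inversions_le h.nodup fun j hj => h.isRanking_restrict hj
    have hT : ∀ j ∈ L, ∀ b, min m ((r j).idxOf (name b)) = (r j).idxOf (name b) := fun j hj b =>
      min_eq_right (List.idxOf_le_length.trans ((hr j hj).length_eq ▸ h.card_le))
    have hord : ∀ j ∈ L, ∀ a < m, Cs a → ∀ b < m, Cs b →
        ((r j).idxOf (name a) < (r j).idxOf (name b) ↔
          min m ((r j).idxOf (name a)) < min m ((r j).idxOf (name b))) :=
      fun j hj a _ _ b _ _ => by rw [hT j hj, hT j hj]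
    refine ⟨fun j b => min m ((r j).idxOf (name b)), fun _ _ => min_le_left _ _, ⟨?_, ?_⟩, ?_⟩
    · intro j hj hVj b hb hCb c hc hCc hbc
      have hjL := (h.mem_voters j).2 ⟨hj, hVj⟩
      simp only [hT j hjL] at hbc
      exact h.inj b hb c hc ((hr j hjL).idxOf_inj (h.name_mem hb hCb) hbc)
    · exact (h.isCondorcetWinner_iff hord ha haC).1 hc
    · exact (h.sum_inversions hord).ge.trans hk
  definable_valid := by unfold DodgsonValid rankSupport; infer_instance
  definable_cost := by unfold dodgsonCost; infer_instance

/-! ### Codes of numbers, candidate lists and profiles -/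

theorem encodeList_eq {α : Type} (enc : α → List Bool) (l : List α) :
    encodeList enc l = (l.flatMap fun a => true :: enc a) ++ [false] := by
  induction l with
  | nil => rfl
  | cons a l ih => simp [encodeList, ih]

theorem length_le_encodeList {α : Type} (enc : α → List Bool) (l : List α) :
    l.length ≤ (encodeList enc l).length := by
  induction l with
  | nil => simp
  | cons a l ih =>
    simp only [encodeList, List.length_cons, List.length_append]
    omega

theorem length_le_encodeList_of_mem {α : Type} (enc : α → List Bool) {l : List α} {a : α}
    (h : a ∈ l) : (enc a).length ≤ (encodeList enc l).length := by
  induction l with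
  | nil => simp at h
  | cons b l ih =>
    simp only [encodeList, List.length_cons, List.length_append]
    rcases List.mem_cons.1 h with rfl | h
    · omega
    · have := ih h
      omega

theorem encodeList_map_range {α : Type} (enc : α → List Bool) (n : ℕ) (f : ℕ → α) :
    encodeList enc ((List.range n).map f) =
      ((List.range n).flatMap fun i => true :: enc (f i)) ++ [false] := by
  rw [encodeList_eq, List.flatMap_map]

/-- The number with the given binary digits, the lowest digit first. -/
def ofBits (l : List Bool) : ℕ := l.foldr Nat.bit 0

theorem ofBits_bits (n : ℕ) : ofBits n.bits = n := by
  induction n using Nat.binaryRec' with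
  | zero => rfl
  | bit b n h ih =>
    rw [Nat.bits_append_bit n b h]
    exact congrArg (Nat.bit b) ih

theorem bits_ofBits {l : List Bool} (h : ∀ hl : l ≠ [], l.getLast hl = true) :
    (ofBits l).bits = l := by
  induction l with
  | nil => rfl
  | cons b l ih =>
    have ih := ih fun hl => by simpa [List.getLast_cons hl] using h (by simp)
    change (Nat.bit b (ofBits l)).bits = b :: l
    rw [Nat.bits_append_bit, ih]
    intro h0
    have : l = [] := by rw [← ih, h0]; rfl
    subst this
    simpa using h

theorem getLast_bits (n : ℕ) : ∀ hl : n.bits ≠ [], n.bits.getLast hl = true := by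
  induction n using Nat.binaryRec' with
  | zero => simp
  | bit b n h ih =>
    intro hl
    simp only [Nat.bits_append_bit n b h]
    by_cases hn : n = 0
    · subst hn
      simpa using h rfl
    · have : n.bits ≠ [] := fun h0 => hn (by rw [← ofBits_bits n, h0]; rfl)
      rw [List.getLast_cons this]
      exact ih this

theorem map_getD_range {α : Type} (l : List α) (d : α) :
    (List.range l.length).map (fun i => l.getD i d) = l := by
  refine List.ext_getElem (by simp) fun i h₁ h₂ => ?_
  simp [h₂]

/-! ### Tables that describe elections -/

/-- The tables in the control problems, as they are guessed: the first argument selects a component,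
the others are its arguments. `numCand`, `numExtra`, `numVoters`, `numNew` are the
lengths of the lists of candidates, of additional or deletable candidates, of voters, and of new
voters, `target` is the index of the distinguished candidate, and `numAll` is the number of all
candidates that are ranked by the voters. -/
abbrev Table := ℕ → ℕ → ℕ → ℕ → ℕ

namespace Table

abbrev numCand (F : Table) : ℕ := F 0 0 0 0
abbrev numExtra (F : Table) : ℕ := F 0 1 0 0
abbrev numVoters (F : Table) : ℕ := F 0 2 0 0
abbrev numNew (F : Table) : ℕ := F 0 3 0 0
abbrev target (F : Table) : ℕ := F 0 4 0 0
abbrev numAll (F : Table) : ℕ := F 0 5 0 0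

/-- The length of the binary representation of a name. The limit of the control problem is stored
like the name of a candidate with index `numAll`. -/
abbrev len (F : Table) (a : ℕ) : ℕ := F 1 a 0 0

/-- The binary digits of a name. -/
abbrev Digit (F : Table) (a i : ℕ) : Prop := 0 < F 2 a i 0

/-- The index of the candidate at position `i` of the vote `j`. -/
abbrev ord (F : Table) (j i : ℕ) : ℕ := F 3 j i 0

/-- The position of the candidate `a` in the vote `j`. -/
abbrev rank (F : Table) (j a : ℕ) : ℕ := F 4 j a 0

/-- The number formed by the digits of the limit from `i` on, truncated. -/
abbrev limit (F : Table) (i : ℕ) : ℕ := F 5 i 0 0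

/-- The candidates of the election number `s`. -/
abbrev Cand (F : Table) (s a : ℕ) : Prop := 0 < F 6 s a 0

/-- The voters of the election number `s`. -/
abbrev Voter (F : Table) (s j : ℕ) : Prop := 0 < F 7 s j 0

/-- The winners of the election number `s`. -/
abbrev Win (F : Table) (s a : ℕ) : Prop := 0 < F 8 s a 0

/-- The indices of the additional or deletable candidates. -/
abbrev extra (F : Table) (i : ℕ) : ℕ := F 9 i 0 0

/-- The certificates for the winners of the election number `s`. -/
abbrev cert (F : Table) (s : ℕ) : ℕ → ℕ → ℕ → ℕ := F (s + 10)

/-- The votes of the new voters follow those of the voters. -/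
abbrev numVotes (F : Table) : ℕ := F.numVoters + F.numNew

/-- The binary representation of a name. -/
def digits (F : Table) (a : ℕ) : List Bool :=
  (List.range (F.len a)).map fun i => decide (F.Digit a i)

/-- The name of the candidate with index `a`. -/
def name (F : Table) (a : ℕ) : ℕ := ofBits (F.digits a)

/-- The ranking of voter `j`, by names. -/
def vote (F : Table) (j : ℕ) : Vote := (List.range F.numAll).map fun i => F.name (F.ord j i)

/-- The list `C` of an instance. -/
def candidates (F : Table) : List ℕ := (List.range F.numCand).map F.name

/-- The list `D` of an instance. -/
def extras (F : Table) : List ℕ := (List.range F.numExtra).map fun i => F.name (F.extra i)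

/-- The profile `V` of an instance. -/
def voters (F : Table) : Profile := (List.range F.numVoters).map F.vote

/-- The profile `W` of an instance. -/
def newVoters (F : Table) : Profile := (List.range F.numNew).map fun i => F.vote (F.numVoters + i)

/-- All ranked candidates. -/
def all (F : Table) : Finset ℕ := (Finset.range F.numAll).image F.name

open Classical in
/-- The names of the candidates of the election number `s`. -/
noncomputable def cands (F : Table) (s : ℕ) : Finset ℕ :=
  {a ∈ Finset.range F.numAll | F.Cand s a}.image F.name

open Classical in
/-- The names of the winners of the election number `s`. -/
noncomputable def wins (F : Table) (s : ℕ) : Finset ℕ :=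
  {a ∈ Finset.range F.numAll | F.Win s a}.image F.name

/-- The table describes an election and a limit correctly; `N` bounds its entries. -/
def WellFormed (N : ℕ) (F : Table) : Prop :=
  (F.target < F.numCand ∧ F.numCand ≤ F.numAll ∧ ∀ i, i < F.numExtra → F.extra i < F.numAll) ∧
  (∀ a, a < F.numAll + 1 → F.len a = 0 ∨ F.Digit a (F.len a - 1)) ∧
  (∀ a, a < F.numAll → ∀ b, b < F.numAll → a = b ∨ ¬F.len a = F.len b ∨
    ∃ i, i < F.len a ∧ ¬(F.Digit a i ↔ F.Digit b i)) ∧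
  (∀ j, j < F.numVotes → (∀ i, i < F.numAll → F.ord j i < F.numAll ∧ F.rank j (F.ord j i) = i) ∧
    ∀ a, a < F.numAll → F.rank j a < F.numAll ∧ F.ord j (F.rank j a) = a) ∧
  -- `N - (N - u)` is the minimum of `N` and `u`
  (F.limit (F.len F.numAll) = 0 ∧ ∀ i, i < F.len F.numAll → F.limit i =
    N - (N - (ind (F.Digit F.numAll i) + 2 * F.limit (i + 1))))

variable {N : ℕ} {F : Table}

theorem WellFormed.bits_name (h : F.WellFormed N) {a : ℕ} (ha : a ≤ F.numAll) :
    (F.name a).bits = F.digits a := by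
  refine bits_ofBits fun hl => ?_
  have h0 : F.len a ≠ 0 := fun h0 => hl (by rw [digits, h0]; rfl)
  have := (h.2.1 a (by omega)).resolve_left h0
  rw [List.getLast_eq_getElem]
  simpa [digits] using this

theorem WellFormed.name_inj (h : F.WellFormed N) {a b : ℕ} (ha : a < F.numAll)
    (hb : b < F.numAll) (hab : F.name a = F.name b) : a = b := by
  have hd : F.digits a = F.digits b := by rw [← h.bits_name ha.le, ← h.bits_name hb.le, hab]
  have hl : F.len a = F.len b := by simpa [digits] using congrArg List.length hd
  rcases h.2.2.1 a ha b hb with hab | hne | ⟨i, hi, hne⟩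
  · exact hab
  · exact absurd hl hne
  · refine absurd ?_ hne
    have hi' : i < F.len b := hl ▸ hi
    have := congrArg (fun l => l.getD i false) hd
    simpa [digits, hi, hi'] using this

theorem WellFormed.name_eq_iff (h : F.WellFormed N) {a b : ℕ} (ha : a < F.numAll)
    (hb : b < F.numAll) : F.name a = F.name b ↔ a = b :=
  ⟨h.name_inj ha hb, fun h => h ▸ rfl⟩

theorem mem_all {c : ℕ} : c ∈ F.all ↔ ∃ a < F.numAll, F.name a = c := by simp [all]

theorem mem_cands {s c : ℕ} : c ∈ F.cands s ↔ ∃ a < F.numAll, F.Cand s a ∧ F.name a = c := by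
  simp [cands, and_assoc]

theorem mem_wins {s c : ℕ} : c ∈ F.wins s ↔ ∃ a < F.numAll, F.Win s a ∧ F.name a = c := by
  simp [wins, and_assoc]

theorem cands_subset_all (s : ℕ) : F.cands s ⊆ F.all := fun c hc => by
  obtain ⟨a, ha, _, rfl⟩ := mem_cands.1 hc
  exact mem_all.2 ⟨a, ha, rfl⟩

theorem mem_candidates {c : ℕ} : c ∈ F.candidates ↔ ∃ a < F.numCand, F.name a = c := by
  simp [candidates]

theorem mem_extras {c : ℕ} : c ∈ F.extras ↔ ∃ i < F.numExtra, F.name (F.extra i) = c := by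
  simp [extras]

theorem WellFormed.name_mem_cands (h : F.WellFormed N) {s a : ℕ} (ha : a < F.numAll) :
    F.name a ∈ F.cands s ↔ F.Cand s a := by
  rw [mem_cands]
  exact ⟨fun ⟨b, hb, hC, he⟩ => h.name_inj hb ha he ▸ hC, fun hC => ⟨a, ha, hC, rfl⟩⟩

theorem WellFormed.name_mem_wins (h : F.WellFormed N) {s a : ℕ} (ha : a < F.numAll) :
    F.name a ∈ F.wins s ↔ F.Win s a := by
  rw [mem_wins]
  exact ⟨fun ⟨b, hb, hC, he⟩ => h.name_inj hb ha he ▸ hC, fun hC => ⟨a, ha, hC, rfl⟩⟩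

theorem WellFormed.isRanking_vote (h : F.WellFormed N) {j : ℕ} (hj : j < F.numVotes) :
    IsRanking F.all (F.vote j) := by
  obtain ⟨h1, h2⟩ := h.2.2.2.1 j hj
  constructor
  · refine List.Nodup.map_on (fun i hi i' hi' he => ?_) List.nodup_range
    rw [List.mem_range] at hi hi'
    have := h.name_inj (h1 i hi).1 (h1 i' hi').1 he
    rw [← (h1 i hi).2, this, (h1 i' hi').2]
  · ext c
    simp only [vote, List.mem_toFinset, List.mem_map, List.mem_range, mem_all]
    constructor
    · rintro ⟨i, hi, rfl⟩
      exact ⟨_, (h1 i hi).1, rfl⟩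
    · rintro ⟨a, ha, rfl⟩
      exact ⟨_, (h2 a ha).1, by rw [(h2 a ha).2]⟩

theorem WellFormed.idxOf_vote (h : F.WellFormed N) {j a : ℕ} (hj : j < F.numVotes)
    (ha : a < F.numAll) : (F.vote j).idxOf (F.name a) = F.rank j a := by
  obtain ⟨hr, ho⟩ := (h.2.2.2.1 j hj).2 a ha
  have hl : F.rank j a < (F.vote j).length := by simpa [vote] using hr
  have := (h.isRanking_vote hj).1.idxOf_getElem (F.rank j a) hl
  simpa [vote, ho] using this

/-- A number up to `N` can be compared with the limit by means of the truncated limit. -/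
theorem WellFormed.le_limit_iff (h : F.WellFormed N) {c : ℕ} (hc : c ≤ N) :
    c ≤ F.limit 0 ↔ c ≤ F.name F.numAll := by
  obtain ⟨h0, hstep⟩ := h.2.2.2.2
  have key : ∀ d ≤ F.len F.numAll, F.limit (F.len F.numAll - d) =
      min N (ofBits ((F.digits F.numAll).drop (F.len F.numAll - d))) := by
    intro d
    induction d with
    | zero =>
      rw [Nat.sub_zero, h0, List.drop_of_length_le (by simp [digits])]
      simp [ofBits]
    | succ d ih =>
      intro hd
      obtain ⟨i, hi⟩ : ∃ i, i = F.len F.numAll - (d + 1) := ⟨_, rfl⟩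
      have hi' : F.len F.numAll - d = i + 1 := by omega
      have ih := ih (by omega)
      rw [hi'] at ih
      rw [← hi, hstep i (by omega), ih]
      have hlen : i < (F.digits F.numAll).length := by simp [digits]; omega
      rw [List.drop_eq_getElem_cons hlen]
      have hbit : ofBits ((F.digits F.numAll)[i] :: (F.digits F.numAll).drop (i + 1)) =
          ind (F.Digit F.numAll i) + 2 * ofBits ((F.digits F.numAll).drop (i + 1)) := by
        change Nat.bit _ (ofBits _) = _
        rw [Nat.bit_val]
        by_cases hD : F.Digit F.numAll i <;> simp [digits, hD, ind, add_comm]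
      rw [hbit]
      have := ind_le_one (F.Digit F.numAll i)
      omega
  have := key _ le_rfl
  rw [Nat.sub_self, List.drop_zero] at this
  rw [this, name]
  omega

/-- The elections in a well-formed table. -/
theorem WellFormed.presents (h : F.WellFormed N) {s : ℕ} {C : Finset ℕ} (hC : C = F.cands s)
    {L : List ℕ} (hL : L.Nodup) (hmem : ∀ j, j ∈ L ↔ j < F.numVotes ∧ F.Voter s j) :
    Presents F.numAll F.numVotes F.name F.vote F.rank (F.Cand s) (F.Voter s) C L where
  inj a ha b hb he := h.name_inj ha hb he
  mem c := by rw [hC, mem_cands]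
  nodup := hL
  mem_voters := hmem
  ranking j hj := ⟨F.all, hC ▸ cands_subset_all s, h.isRanking_vote ((hmem j).1 hj).1⟩
  rank j hj a ha _ b hb _ := by
    rw [h.idxOf_vote ((hmem j).1 hj).1 ha, h.idxOf_vote ((hmem j).1 hj).1 hb]

/-! ### Codes of the parts of an instance -/

/-- The code of a name. -/
def nameCode (F : Table) (a : ℕ) : List Bool :=
  ((List.range (F.len a)).flatMap fun i => true :: [decide (F.Digit a i)]) ++ [false]

/-- The code of the list `C`. -/
def candidatesCode (F : Table) : List Bool :=
  ((List.range F.numCand).flatMap fun i => true :: F.nameCode i) ++ [false]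

/-- The code of the list `D`. -/
def extrasCode (F : Table) : List Bool :=
  ((List.range F.numExtra).flatMap fun i => true :: F.nameCode (F.extra i)) ++ [false]

/-- The code of a vote. -/
def voteCode (F : Table) (j : ℕ) : List Bool :=
  ((List.range F.numAll).flatMap fun i => true :: F.nameCode (F.ord j i)) ++ [false]

/-- The code of the profile `V`. -/
def votersCode (F : Table) : List Bool :=
  ((List.range F.numVoters).flatMap fun i => true :: F.voteCode i) ++ [false]

/-- The code of the profile `W`. -/
def newVotersCode (F : Table) : List Bool :=
  ((List.range F.numNew).flatMap fun i => true :: F.voteCode (F.numVoters + i)) ++ [false]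

theorem flatMap_range_congr {n : ℕ} {f g : ℕ → List Bool} (h : ∀ i < n, f i = g i) :
    (List.range n).flatMap f = (List.range n).flatMap g := by
  rw [List.flatMap_def, List.flatMap_def, List.map_congr_left fun i hi => h i (List.mem_range.1 hi)]

theorem WellFormed.nameCode_eq (h : F.WellFormed N) {a : ℕ} (ha : a ≤ F.numAll) :
    F.nameCode a = encodeNat (F.name a) := by
  rw [encodeNat, h.bits_name ha, digits, encodeList_map_range, nameCode]

theorem WellFormed.candidatesCode_eq (h : F.WellFormed N) :
    F.candidatesCode = encodeCandidates F.candidates := by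
  rw [encodeCandidates, candidates, encodeList_map_range, candidatesCode]
  congr 1
  refine flatMap_range_congr fun i hi => ?_
  rw [h.nameCode_eq (hi.le.trans h.1.2.1)]

theorem WellFormed.extrasCode_eq (h : F.WellFormed N) :
    F.extrasCode = encodeCandidates F.extras := by
  rw [encodeCandidates, extras, encodeList_map_range, extrasCode]
  congr 1
  refine flatMap_range_congr fun i hi => ?_
  rw [h.nameCode_eq (h.1.2.2 i hi).le]

theorem WellFormed.voteCode_eq (h : F.WellFormed N) {j : ℕ} (hj : j < F.numVotes) :
    F.voteCode j = encodeCandidates (F.vote j) := by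
  rw [encodeCandidates, vote, encodeList_map_range, voteCode]
  congr 1
  refine flatMap_range_congr fun i hi => ?_
  rw [h.nameCode_eq ((h.2.2.2.1 j hj).1 i hi).1.le]

theorem WellFormed.votersCode_eq (h : F.WellFormed N) :
    F.votersCode = encodeProfile F.voters := by
  rw [encodeProfile, voters, encodeList_map_range, votersCode]
  congr 1
  refine flatMap_range_congr fun i hi => ?_
  rw [h.voteCode_eq (by unfold numVotes; omega)]

theorem WellFormed.newVotersCode_eq (h : F.WellFormed N) :
    F.newVotersCode = encodeProfile F.newVoters := by
  rw [encodeProfile, newVoters, encodeList_map_range, newVotersCode]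
  congr 1
  refine flatMap_range_congr fun i hi => ?_
  rw [h.voteCode_eq (by unfold numVotes; omega)]

/-! ### Winners in a table -/

/-- The winners of the election number `s` in the table are certified, and they pass the test
against the table `T`. -/
def Checked {E : System} (Q : Certification E) (F : Table) (T : ℕ → ℕ → ℕ) (s : ℕ) : Prop :=
  (∀ a, a < F.numAll → F.Win s a → F.Cand s a ∧
    Q.Valid F.numAll F.numVotes (F.Cand s) (F.Voter s) F.rank a (F.cert s a)) ∧
  Q.Beats F.numAll F.numVotes (F.Cand s) (F.Voter s) F.rank (F.Win s) (F.cert s) T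

variable {E : System} {N : ℕ} {F : Table}

theorem WellFormed.winners_eq (h : F.WellFormed N) (Q : Certification E) {s : ℕ}
    (hc : ∀ T : ℕ → ℕ → ℕ, (∀ j b, T j b ≤ F.numAll) → Checked Q F T s) {C : Finset ℕ}
    (hC : C = F.cands s) {L : List ℕ} (hL : L.Nodup)
    (hmem : ∀ j, j ∈ L ↔ j < F.numVotes ∧ F.Voter s j) :
    E.winners C (L.map F.vote) = F.wins s := by
  have hP := h.presents hC hL hmem
  have h0 := hc (fun _ _ => 0) fun _ _ => Nat.zero_le _
  have key := Q.winners_of_beats hP (fun a ha hW => (h0.1 a ha hW).1)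
    (fun a ha hW => (h0.1 a ha hW).2) fun T hT => (hc T hT).2
  ext c
  constructor
  · intro hcw
    obtain ⟨a, ha, _, rfl⟩ := (hP.mem c).1 (Q.subset _ _ hcw)
    exact (h.name_mem_wins ha).2 ((key a ha).1 hcw)
  · intro hcw
    obtain ⟨a, ha, hW, rfl⟩ := mem_wins.1 hcw
    exact (key a ha).2 hW

/-! ### Construction of tables -/

/-- The table for an instance, with elections, winners, and certificates. -/
noncomputable def ofInstance (N : ℕ) (C U D : List ℕ) (V W : Profile) (k p : ℕ)
    (Cs : ℕ → Finset ℕ) (Vs Ws : ℕ → ℕ → Prop) (cert : ℕ → ℕ → ℕ → ℕ → ℕ) : Table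
  | 0, 0, _, _ => C.length
  | 0, 1, _, _ => D.length
  | 0, 2, _, _ => V.length
  | 0, 3, _, _ => W.length
  | 0, 4, _, _ => U.idxOf p
  | 0, _ + 5, _, _ => U.length
  | 1, a, _, _ => ((U ++ [k]).getD a 0).bits.length
  | 2, a, i, _ => ind (((U ++ [k]).getD a 0).bits.getD i false = true)
  | 3, j, i, _ => U.idxOf (((V ++ W).getD j []).getD i 0)
  | 4, j, a, _ => ((V ++ W).getD j []).idxOf (U.getD a 0)
  | 5, i, _, _ => min N (ofBits (k.bits.drop i))
  | 6, s, a, _ => ind (U.getD a 0 ∈ Cs s)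
  | 7, s, j, _ => ind (Vs s j)
  | 8, s, a, _ => ind (Ws s a)
  | 9, i, _, _ => U.idxOf (D.getD i 0)
  | s + 10, a, j, b => cert s a j b

section OfInstance

variable {C U D : List ℕ} {V W : Profile} {k p : ℕ} {Cs : ℕ → Finset ℕ} {Vs Ws : ℕ → ℕ → Prop}
  {cert : ℕ → ℕ → ℕ → ℕ → ℕ}

theorem name_ofInstance (a : ℕ) :
    name (ofInstance N C U D V W k p Cs Vs Ws cert) a = (U ++ [k]).getD a 0 := by
  have : digits (ofInstance N C U D V W k p Cs Vs Ws cert) a =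
      ((U ++ [k]).getD a 0).bits := by
    rw [← map_getD_range ((U ++ [k]).getD a 0).bits false, digits]
    refine List.map_congr_left fun i _ => ?_
    simp only [Digit, ofInstance, ind_pos, Bool.decide_eq_true]
  rw [name, this, ofBits_bits]

theorem name_ofInstance_of_lt {a : ℕ} (ha : a < U.length) :
    name (ofInstance N C U D V W k p Cs Vs Ws cert) a = U.getD a 0 := by
  rw [name_ofInstance, List.getD_append _ _ _ _ ha]

theorem getD_idxOf {c : ℕ} (hc : c ∈ U) : U.getD (U.idxOf c) 0 = c := by
  have := List.idxOf_lt_length_iff.2 hc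
  simp [this]

theorem getD_mem {α : Type} {l : List α} {d : α} {i : ℕ} (hi : i < l.length) : l.getD i d ∈ l := by
  rw [List.getD_eq_getElem _ _ hi]
  exact List.getElem_mem hi

theorem vote_ofInstance (hVW : IsProfile U.toFinset (V ++ W)) (hU : U.Nodup) {j : ℕ}
    (hj : j < (V ++ W).length) :
    vote (ofInstance N C U D V W k p Cs Vs Ws cert) j = (V ++ W).getD j [] := by
  have hr := hVW _ (getD_mem (d := []) hj)
  have hlen : ((V ++ W).getD j []).length = U.length := by
    rw [hr.length_eq, List.toFinset_card_of_nodup hU]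
  rw [← map_getD_range ((V ++ W).getD j []) 0, vote]
  change (List.range U.length).map _ = _
  rw [hlen]
  refine List.map_congr_left fun i hi => ?_
  rw [List.mem_range] at hi
  have hm : ((V ++ W).getD j []).getD i 0 ∈ U := by
    have := (hr.mem_iff _).1 (getD_mem (d := 0) (hlen ▸ hi))
    simpa using this
  change name _ (U.idxOf _) = _
  rw [name_ofInstance_of_lt (List.idxOf_lt_length_iff.2 hm), getD_idxOf hm]

theorem ofInstance_le (hUN : U.length ≤ N) (hCU : C.length ≤ U.length) (hU : U.Nodup)
    (hN : 0 < N) (hVW : IsProfile U.toFinset (V ++ W)) (hVN : (V ++ W).length ≤ N)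
    (hDN : D.length ≤ N) (hbits : ∀ c ∈ U, c.bits.length ≤ N) (hk : k.bits.length ≤ N)
    (hcert : ∀ s a j b, cert s a j b ≤ N) (a b c d : ℕ) :
    ofInstance N C U D V W k p Cs Vs Ws cert a b c d ≤ N := by
  rw [List.length_append] at hVN
  have hidx : ∀ c, U.idxOf c ≤ N := fun c => List.idxOf_le_length.trans hUN
  have hind : ∀ q, ind q ≤ N := fun q => (ind_le_one q).trans hN
  unfold ofInstance
  split
  · omega
  · omega
  · omega
  · omega
  · exact hidx _
  · exact hUN
  · by_cases ha : b < (U ++ [k]).length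
    · have := getD_mem (d := 0) ha
      rcases List.mem_append.1 this with h | h
      · exact hbits _ h
      · rw [List.mem_singleton.1 h]
        exact hk
    · rw [List.getD_eq_default _ _ (by omega)]
      simp
  · exact hind _
  · exact hidx _
  · by_cases hj : b < (V ++ W).length
    · have hr := hVW _ (getD_mem (d := []) hj)
      have hlen : ((V ++ W).getD b []).length = U.length := by
        rw [hr.length_eq, List.toFinset_card_of_nodup hU]
      have := List.idxOf_le_length (l := (V ++ W).getD b []) (a := U.getD c 0)
      omega
    · change ((V ++ W).getD b []).idxOf _ ≤ N
      rw [List.getD_eq_default (V ++ W) [] (by omega)]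
      exact Nat.zero_le N
  · exact min_le_left _ _
  · exact hind _
  · exact hind _
  · exact hind _
  · exact hidx _
  · exact hcert _ _ _ _

theorem wellFormed_ofInstance (hCU : C <+: U) (hU : U.Nodup) (hD : D ⊆ U)
    (hVW : IsProfile U.toFinset (V ++ W)) (hp : p ∈ C) :
    WellFormed N (ofInstance N C U D V W k p Cs Vs Ws cert) := by
  have hsub := hCU.subset
  have hdig : ∀ a i, (ofInstance N C U D V W k p Cs Vs Ws cert).Digit a i ↔
      ((U ++ [k]).getD a 0).bits.getD i false = true := fun a i => ind_pos
  refine ⟨⟨?_, hCU.length_le, fun i hi => ?_⟩, ?_, ?_, ?_, ?_, ?_⟩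
  · obtain ⟨X, rfl⟩ := hCU
    change (C ++ X).idxOf p < C.length
    rw [List.idxOf_append_of_mem hp]
    exact List.idxOf_lt_length_iff.2 hp
  · exact List.idxOf_lt_length_iff.2 (hD (getD_mem hi))
  · intro a _
    rw [hdig]
    change ((U ++ [k]).getD a 0).bits.length = 0 ∨
      ((U ++ [k]).getD a 0).bits.getD (((U ++ [k]).getD a 0).bits.length - 1) false = true
    generalize (U ++ [k]).getD a 0 = c
    by_cases hc : c.bits = []
    · exact Or.inl (by rw [hc]; rfl)
    · right
      have hpos := List.length_pos_iff.2 hc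
      rw [List.getD_eq_getElem _ _ (by omega), ← List.getLast_eq_getElem hc]
      exact getLast_bits c hc
  · intro a ha b hb
    by_contra hne
    push Not at hne
    obtain ⟨hab, hl, hd⟩ := hne
    have hbits : ((U ++ [k]).getD a 0).bits = ((U ++ [k]).getD b 0).bits := by
      refine Complexity.ext_getD.2 ⟨hl, fun i hi => ?_⟩
      rw [← hdig, ← hdig]
      exact hd i hi
    have := congrArg ofBits hbits
    rw [ofBits_bits, ofBits_bits, List.getD_append _ _ _ _ ha, List.getD_append _ _ _ _ hb,
      List.getD_eq_getElem _ _ ha, List.getD_eq_getElem _ _ hb] at this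
    exact hab ((hU.getElem_inj_iff).1 this)
  · intro j hj
    have hj : j < (V ++ W).length := by rw [List.length_append]; exact hj
    have hr := hVW _ (getD_mem (d := []) hj)
    have hlen : ((V ++ W).getD j []).length = U.length := by
      rw [hr.length_eq, List.toFinset_card_of_nodup hU]
    have hmem : ∀ c, c ∈ (V ++ W).getD j [] ↔ c ∈ U := fun c => by
      rw [hr.mem_iff, List.mem_toFinset]
    constructor
    · intro i hi
      have hi : i < ((V ++ W).getD j []).length := hlen ▸ hi
      have hm := (hmem _).1 (getD_mem (d := 0) hi)
      refine ⟨List.idxOf_lt_length_iff.2 hm, ?_⟩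
      change ((V ++ W).getD j []).idxOf (U.getD (U.idxOf (((V ++ W).getD j []).getD i 0)) 0) = i
      rw [getD_idxOf hm, List.getD_eq_getElem _ _ hi]
      exact hr.1.idxOf_getElem i hi
    · intro a ha
      have ha : a < U.length := ha
      have hm := (hmem _).2 (getD_mem (d := 0) ha)
      refine ⟨(List.idxOf_lt_length_iff.2 hm).trans_eq hlen, ?_⟩
      change U.idxOf (((V ++ W).getD j []).getD (((V ++ W).getD j []).idxOf (U.getD a 0)) 0) = a
      rw [getD_idxOf hm, List.getD_eq_getElem _ _ ha]
      exact hU.idxOf_getElem a ha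
  · have hk : (U ++ [k]).getD U.length 0 = k := by simp
    change min N (ofBits (k.bits.drop ((U ++ [k]).getD U.length 0).bits.length)) = 0
    rw [hk, List.drop_length]
    simp [ofBits]
  · intro i hi
    have hk : (U ++ [k]).getD U.length 0 = k := by simp
    have hi : i < k.bits.length := by
      have : i < ((U ++ [k]).getD U.length 0).bits.length := hi
      rwa [hk] at this
    rw [hdig]
    change min N (ofBits (k.bits.drop i)) = N - (N - (ind (((U ++ [k]).getD U.length 0).bits.getD i
      false = true) + 2 * min N (ofBits (k.bits.drop (i + 1)))))
    rw [hk, List.drop_eq_getElem_cons hi, List.getD_eq_getElem _ _ hi]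
    change min N (Nat.bit k.bits[i] (ofBits (k.bits.drop (i + 1)))) = _
    rw [Nat.bit_val]
    cases k.bits[i] <;> simp [ind] <;> omega

end OfInstance

/-- Every instance, together with any choice of elections among its candidates and voters, is
described by a table in which the winners of these elections are certified. -/
theorem exists_table (Q : Certification E) (N : ℕ) {C U D : List ℕ} {V W : Profile} {k p : ℕ}
    (hCU : C <+: U) (hU : U.Nodup) (hD : D ⊆ U) (hVW : IsProfile U.toFinset (V ++ W)) (hp : p ∈ C)
    (hUN : U.length ≤ N) (hVN : (V ++ W).length ≤ N) (hDN : D.length ≤ N)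
    (hbits : ∀ c ∈ U, c.bits.length ≤ N) (hk : k.bits.length ≤ N)
    (Cs : ℕ → Finset ℕ) (hCs : ∀ s, Cs s ⊆ U.toFinset) (Vs : ℕ → ℕ → Prop) :
    ∃ F : Table, (∀ a i j b, F a i j b ≤ N) ∧ F.WellFormed N ∧
      (∀ s T, Checked Q F T s) ∧ F.candidates = C ∧ F.extras = D ∧ F.voters = V ∧
      F.newVoters = W ∧ F.name F.numAll = k ∧ F.name F.target = p ∧ F.all = U.toFinset ∧
      (∀ s, F.cands s = Cs s) ∧ ∀ s j, F.Voter s j ↔ Vs s j := by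
  classical
  have hN : 0 < N := (List.length_pos_of_mem (hCU.subset hp)).trans_le hUN
  -- the part of the table that describes the instance does not depend on winners and certificates
  let F₀ : Table := ofInstance N C U D V W k p Cs Vs (fun _ _ => False) fun _ _ _ _ => 0
  have h₀ : WellFormed N F₀ := wellFormed_ofInstance hCU hU hD hVW hp
  have hcands : ∀ s, F₀.cands s = Cs s := by
    intro s
    have hC : ∀ a, F₀.Cand s a ↔ U.getD a 0 ∈ Cs s := fun a => ind_pos
    ext c
    rw [mem_cands]
    constructor
    · rintro ⟨a, ha, hCa, rfl⟩
      rw [name_ofInstance_of_lt ha]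
      exact (hC a).1 hCa
    · intro hc
      have hcU : c ∈ U := by simpa using hCs s hc
      refine ⟨U.idxOf c, List.idxOf_lt_length_iff.2 hcU, (hC _).2 ?_, ?_⟩
      · rwa [getD_idxOf hcU]
      · rw [name_ofInstance_of_lt (List.idxOf_lt_length_iff.2 hcU), getD_idxOf hcU]
  have hVoter : ∀ s j, F₀.Voter s j ↔ Vs s j := fun s j => ind_pos
  let L : ℕ → List ℕ := fun s => (List.range F₀.numVotes).filter fun j => F₀.Voter s j
  have hP : ∀ s, Presents F₀.numAll F₀.numVotes F₀.name F₀.vote F₀.rank (F₀.Cand s) (F₀.Voter s)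
      (Cs s) (L s) := fun s => h₀.presents (hcands s).symm (List.nodup_range.filter _) (by
        simp [L])
  let Ws : ℕ → ℕ → Prop := fun s a => F₀.name a ∈ E.winners (Cs s) ((L s).map F₀.vote)
  choose cert hcert hvalid hbeats using fun s =>
    Q.exists_beats (W := fun a => 0 < ind (Ws s a)) (hP s) fun a _ => ind_pos
  refine ⟨ofInstance N C U D V W k p Cs Vs Ws cert, ?_, wellFormed_ofInstance hCU hU hD hVW hp,
    ?_, ?_, ?_, ?_, ?_, ?_, ?_, ?_, hcands, hVoter⟩
  · exact ofInstance_le hUN hCU.length_le hU hN hVW hVN hDN hbits hk fun s a j b =>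
      (hcert s a j b).trans hUN
  · intro s T
    refine ⟨fun a ha hW => ⟨?_, hvalid s a ha hW⟩, hbeats s T⟩
    exact ((hP s).name_mem_iff ha).1 (Q.subset _ _ (ind_pos.1 hW))
  · refine Eq.trans ?_ (map_getD_range C 0)
    change (List.range C.length).map _ = _
    refine List.map_congr_left fun i hi => ?_
    rw [List.mem_range] at hi
    rw [name_ofInstance_of_lt (hi.trans_le hCU.length_le)]
    obtain ⟨X, rfl⟩ := hCU
    rw [List.getD_append _ _ _ _ hi]
  · refine Eq.trans ?_ (map_getD_range D 0)
    change (List.range D.length).map _ = _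
    refine List.map_congr_left fun i hi => ?_
    have hm := hD (getD_mem (d := 0) (List.mem_range.1 hi))
    change name _ (U.idxOf _) = _
    rw [name_ofInstance_of_lt (List.idxOf_lt_length_iff.2 hm), getD_idxOf hm]
  · refine Eq.trans ?_ (map_getD_range V [])
    change (List.range V.length).map _ = _
    refine List.map_congr_left fun i hi => ?_
    rw [List.mem_range] at hi
    rw [vote_ofInstance hVW hU (by rw [List.length_append]; omega), List.getD_append _ _ _ _ hi]
  · refine Eq.trans ?_ (map_getD_range W [])
    change (List.range W.length).map _ = _
    refine List.map_congr_left fun i hi => ?_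
    rw [List.mem_range] at hi
    change vote _ (V.length + i) = _
    rw [vote_ofInstance hVW hU (by rw [List.length_append]; omega),
      List.getD_append_right _ _ _ _ (by omega), Nat.add_sub_cancel_left]
  · change name _ U.length = k
    rw [name_ofInstance]
    simp
  · change name _ (U.idxOf p) = p
    have := hCU.subset hp
    rw [name_ofInstance_of_lt (List.idxOf_lt_length_iff.2 this), getD_idxOf this]
  · ext c
    rw [mem_all, List.mem_toFinset]
    constructor
    · rintro ⟨a, ha, rfl⟩
      rw [name_ofInstance_of_lt ha]
      exact getD_mem ha
    · intro hc
      refine ⟨U.idxOf c, List.idxOf_lt_length_iff.2 hc, ?_⟩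
      rw [name_ofInstance_of_lt (List.idxOf_lt_length_iff.2 hc), getD_idxOf hc]

/-! ### Control problems in terms of tables -/

/-- The candidate `a` survives the election number `s`. -/
def Survives (F : Table) (s a : ℕ) : TieRule → Prop
  | .promote => F.Win s a
  | .eliminate => F.Win s a ∧ ∑ b ∈ Finset.range F.numAll, ind (F.Win s b) = 1

/-- The goal is met in the election number `0`. -/
def GoalMet (F : Table) : Goal → Prop
  | .constructive => F.Win 0 F.target
  | .destructive => ¬F.Win 0 F.target

/-- The code of the instance, for every type of control action. -/
def code (F : Table) : Action → List Bool
  | .addCandidates => F.candidatesCode ++ F.extrasCode ++ F.votersCode ++ F.nameCode F.numAll ++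
      F.nameCode F.target
  | .addCandidatesUnlimited => F.candidatesCode ++ F.extrasCode ++ F.votersCode ++
      F.nameCode F.target
  | .deleteCandidates => F.candidatesCode ++ F.votersCode ++ F.nameCode F.numAll ++
      F.nameCode F.target
  | .deleteDeletableCandidates => F.candidatesCode ++ F.extrasCode ++ F.votersCode ++
      F.nameCode F.numAll ++ F.nameCode F.target
  | .partitionCandidates _ => F.candidatesCode ++ F.votersCode ++ F.nameCode F.target
  | .runoffPartitionCandidates _ => F.candidatesCode ++ F.votersCode ++ F.nameCode F.target
  | .addVoters => F.candidatesCode ++ F.votersCode ++ F.newVotersCode ++ F.nameCode F.numAll ++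
      F.nameCode F.target
  | .deleteVoters => F.candidatesCode ++ F.votersCode ++ F.nameCode F.numAll ++
      F.nameCode F.target
  | .partitionVoters _ => F.candidatesCode ++ F.votersCode ++ F.nameCode F.target

/-- The additional candidates are the ranked candidates that are not registered. -/
def ExtrasNew (F : Table) : Prop :=
  (∀ i, i < F.numExtra → F.numCand ≤ F.extra i) ∧
  (∀ i, i < F.numExtra → ∀ i', i' < F.numExtra → F.extra i = F.extra i' → i = i') ∧
  ∀ a, a < F.numAll → F.numCand ≤ a → ∃ i, i < F.numExtra ∧ F.extra i = a

/-- All candidates are registered, and the deletable candidates are listed without repetition. -/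
def ExtrasOld (F : Table) : Prop :=
  F.numAll = F.numCand ∧
  ∀ i, i < F.numExtra → ∀ i', i' < F.numExtra → F.extra i = F.extra i' → i = i'

/-- All registered candidates take part in the election number `s`. -/
def AllCand (F : Table) (s : ℕ) : Prop := ∀ a, a < F.numCand → F.Cand s a

/-- All voters take part in the election number `s`. -/
def AllVoter (F : Table) (s : ℕ) : Prop := ∀ j, j < F.numVotes → F.Voter s j

/-- The election number `0` is the final election after a control action of the given type; in
partition control, the elections number `1` and `2` are those of the first round. -/
def Legal (F : Table) : Action → Prop
  | .addCandidates => F.ExtrasNew ∧ F.numNew = 0 ∧ F.AllCand 0 ∧ F.AllVoter 0 ∧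
      ∑ i ∈ Finset.range F.numExtra, ind (F.Cand 0 (F.extra i)) ≤ F.limit 0
  | .addCandidatesUnlimited => F.ExtrasNew ∧ F.numNew = 0 ∧ F.AllCand 0 ∧ F.AllVoter 0
  | .deleteCandidates => F.numAll = F.numCand ∧ F.numNew = 0 ∧ F.AllVoter 0 ∧
      F.Cand 0 F.target ∧ ∑ a ∈ Finset.range F.numAll, ind (¬F.Cand 0 a) ≤ F.limit 0
  | .deleteDeletableCandidates => F.ExtrasOld ∧ F.numNew = 0 ∧ F.AllVoter 0 ∧
      F.Cand 0 F.target ∧ ∑ a ∈ Finset.range F.numAll, ind (¬F.Cand 0 a) ≤ F.limit 0 ∧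
      ∀ a, a < F.numAll → ¬F.Cand 0 a → ∃ i, i < F.numExtra ∧ F.extra i = a
  | .partitionCandidates t => F.numAll = F.numCand ∧ F.numNew = 0 ∧ F.AllVoter 0 ∧ F.AllVoter 1 ∧
      ∀ a, a < F.numAll → (F.Cand 2 a ↔ ¬F.Cand 1 a) ∧
        (F.Cand 0 a ↔ F.Survives 1 a t ∨ F.Cand 2 a)
  | .runoffPartitionCandidates t => F.numAll = F.numCand ∧ F.numNew = 0 ∧ F.AllVoter 0 ∧
      F.AllVoter 1 ∧ F.AllVoter 2 ∧ ∀ a, a < F.numAll → (F.Cand 2 a ↔ ¬F.Cand 1 a) ∧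
        (F.Cand 0 a ↔ F.Survives 1 a t ∨ F.Survives 2 a t)
  | .addVoters => F.numAll = F.numCand ∧ F.AllCand 0 ∧
      (∀ j, j < F.numVoters → F.Voter 0 j) ∧
      ∑ i ∈ Finset.range F.numNew, ind (F.Voter 0 (F.numVoters + i)) ≤ F.limit 0
  | .deleteVoters => F.numAll = F.numCand ∧ F.numNew = 0 ∧ F.AllCand 0 ∧
      ∑ j ∈ Finset.range F.numVoters, ind (¬F.Voter 0 j) ≤ F.limit 0
  | .partitionVoters t => F.numAll = F.numCand ∧ F.numNew = 0 ∧ F.AllCand 1 ∧ F.AllCand 2 ∧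
      F.AllVoter 0 ∧ (∀ j, j < F.numVotes → (F.Voter 2 j ↔ ¬F.Voter 1 j)) ∧
      ∀ a, a < F.numAll → (F.Cand 0 a ↔ F.Survives 1 a t ∨ F.Survives 2 a t)

/-- A table with entries up to `N` that describes an instance and three elections with correct
winners. -/
structure Correct {E : System} (Q : Certification E) (N : ℕ) (F : Table) : Prop where
  le : ∀ a i j b, F a i j b ≤ N
  wf : F.WellFormed N
  checked : ∀ s, s < 3 → ∀ T : ℕ → ℕ → ℕ, (∀ j b, T j b ≤ N) → Checked Q F T s

variable {E : System} {Q : Certification E} {N : ℕ} {F : Table}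

theorem sum_ind_eq_card {n : ℕ} {f : ℕ → ℕ} (hf : ∀ i < n, ∀ j < n, f i = f j → i = j)
    {P : ℕ → Prop} {S : Finset ℕ} (hS : ∀ c, c ∈ S ↔ ∃ i < n, P i ∧ f i = c) :
    ∑ i ∈ Finset.range n, ind (P i) = S.card := by
  classical
  have : S = {i ∈ Finset.range n | P i}.image f := by
    ext c
    simp [hS, and_assoc]
  rw [this, Finset.card_image_of_injOn, Finset.card_filter]
  · exact Finset.sum_congr rfl fun i _ => by simp [ind]
  · intro i hi j hj
    simp only [Finset.coe_filter, Finset.mem_range, Set.mem_ofPred_eq] at hi hj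
    exact hf i hi.1 j hj.1

theorem sum_ind_le (n : ℕ) (P : ℕ → Prop) : ∑ i ∈ Finset.range n, ind (P i) ≤ n := by
  refine (Finset.sum_le_card_nsmul _ _ 1 fun i _ => ind_le_one _).trans ?_
  simp

theorem length_voters : F.voters.length = F.numVoters := by simp [voters]

theorem length_newVoters : F.newVoters.length = F.numNew := by simp [newVoters]

namespace Correct

variable (h : Correct Q N F)
include h

theorem winners_eq {s : ℕ} (hs : s < 3) {C : Finset ℕ} (hC : C = F.cands s) {L : List ℕ}
    (hL : L.Nodup) (hmem : ∀ j, j ∈ L ↔ j < F.numVotes ∧ F.Voter s j) :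
    E.winners C (L.map F.vote) = F.wins s :=
  h.wf.winners_eq Q (fun T hT => h.checked s hs T fun j b => (hT j b).trans (h.le 0 5 0 0)) hC hL
    hmem

/-- The winners of an election among all voters. -/
theorem winners_voters {s : ℕ} (hs : s < 3) {C : Finset ℕ} (hC : C = F.cands s)
    (hnew : F.numNew = 0) (hV : F.AllVoter s) : E.winners C F.voters = F.wins s :=
  h.winners_eq hs hC List.nodup_range fun j => by
    rw [List.mem_range]
    refine ⟨fun hj => ⟨by unfold numVotes; omega, hV j (by unfold numVotes; omega)⟩, fun hj => ?_⟩
    have := hj.1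
    unfold numVotes at this
    omega

theorem target_lt : F.target < F.numAll := h.wf.1.1.trans_le h.wf.1.2.1

theorem target_mem : F.name F.target ∈ F.candidates := mem_candidates.2 ⟨_, h.wf.1.1, rfl⟩

theorem met_iff (g : Goal) : g.Met (F.wins 0) (F.name F.target) ↔ F.GoalMet g := by
  cases g
  · exact h.wf.name_mem_wins h.target_lt
  · exact not_congr (h.wf.name_mem_wins h.target_lt)

theorem card_wins (s : ℕ) :
    ∑ a ∈ Finset.range F.numAll, ind (F.Win s a) = (F.wins s).card :=
  sum_ind_eq_card (fun _ ha _ hb => h.wf.name_inj ha hb) fun _ => mem_wins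

theorem name_mem_survivors {s a : ℕ} (ha : a < F.numAll) (t : TieRule) :
    F.name a ∈ t.survivors (F.wins s) ↔ F.Survives s a t := by
  cases t
  · exact h.wf.name_mem_wins ha
  · rw [Survives, h.card_wins, ← h.wf.name_mem_wins ha, TieRule.survivors]
    split_ifs with hc <;> simp [hc]

theorem cands_eq_iff {s : ℕ} {S : Finset ℕ} (hS : S ⊆ F.all) :
    F.cands s = S ↔ ∀ a < F.numAll, F.Cand s a ↔ F.name a ∈ S := by
  constructor
  · rintro rfl a ha
    exact (h.wf.name_mem_cands ha).symm
  · intro hc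
    ext c
    rw [mem_cands]
    constructor
    · rintro ⟨a, ha, hC, rfl⟩
      exact (hc a ha).1 hC
    · intro hcS
      obtain ⟨a, ha, rfl⟩ := mem_all.1 (hS hcS)
      exact ⟨a, ha, (hc a ha).2 hcS, rfl⟩

theorem nodup_candidates : F.candidates.Nodup :=
  List.Nodup.map_on (fun _ ha _ hb => h.wf.name_inj ((List.mem_range.1 ha).trans_le h.wf.1.2.1)
    ((List.mem_range.1 hb).trans_le h.wf.1.2.1)) List.nodup_range

theorem nodup_extras_iff : F.extras.Nodup ↔
    ∀ i, i < F.numExtra → ∀ i', i' < F.numExtra → F.extra i = F.extra i' → i = i' := by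
  constructor
  · intro hd i hi i' hi' he
    exact List.inj_on_of_nodup_map hd (List.mem_range.2 hi) (List.mem_range.2 hi') (by rw [he])
  · intro hd
    refine List.Nodup.map_on (fun i hi i' hi' he => ?_) List.nodup_range
    rw [List.mem_range] at hi hi'
    exact hd i hi i' hi' (h.wf.name_inj (h.wf.1.2.2 i hi) (h.wf.1.2.2 i' hi') he)

theorem candidates_subset_all : F.candidates.toFinset ⊆ F.all := fun c hc => by
  obtain ⟨a, ha, rfl⟩ := mem_candidates.1 (List.mem_toFinset.1 hc)
  exact mem_all.2 ⟨a, ha.trans_le h.wf.1.2.1, rfl⟩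

theorem extras_subset_all : F.extras.toFinset ⊆ F.all := fun c hc => by
  obtain ⟨i, hi, rfl⟩ := mem_extras.1 (List.mem_toFinset.1 hc)
  exact mem_all.2 ⟨_, h.wf.1.2.2 i hi, rfl⟩

theorem name_mem_candidates {a : ℕ} (ha : a < F.numAll) :
    F.name a ∈ F.candidates ↔ a < F.numCand := by
  rw [mem_candidates]
  exact ⟨fun ⟨b, hb, he⟩ => h.wf.name_inj (hb.trans_le h.wf.1.2.1) ha he ▸ hb,
    fun hlt => ⟨a, hlt, rfl⟩⟩

theorem name_mem_extras {a : ℕ} (ha : a < F.numAll) :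
    F.name a ∈ F.extras ↔ ∃ i, i < F.numExtra ∧ F.extra i = a := by
  rw [mem_extras]
  exact ⟨fun ⟨i, hi, he⟩ => ⟨i, hi, h.wf.name_inj (h.wf.1.2.2 i hi) ha he⟩,
    fun ⟨i, hi, he⟩ => ⟨i, hi, he ▸ rfl⟩⟩

theorem candidates_eq_all_iff : F.candidates.toFinset = F.all ↔ F.numAll = F.numCand := by
  constructor
  · intro he
    by_contra hne
    have hlt : F.numCand < F.numAll := by
      have := h.wf.1.2.1
      omega
    have : F.name F.numCand ∈ F.candidates.toFinset := he ▸ mem_all.2 ⟨_, hlt, rfl⟩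
    rw [List.mem_toFinset, h.name_mem_candidates hlt] at this
    omega
  · intro he
    refine (h.candidates_subset_all).antisymm fun c hc => ?_
    obtain ⟨a, ha, rfl⟩ := mem_all.1 hc
    rw [List.mem_toFinset, h.name_mem_candidates ha]
    omega

theorem extrasNew_iff : F.ExtrasNew ↔ (F.candidates ++ F.extras).Nodup ∧
    (F.candidates ++ F.extras).toFinset = F.all := by
  have hsub : (F.candidates ++ F.extras).toFinset ⊆ F.all := by
    rw [List.toFinset_append]
    exact Finset.union_subset h.candidates_subset_all h.extras_subset_all
  rw [List.nodup_append', h.nodup_extras_iff]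
  constructor
  · rintro ⟨h1, h2, h3⟩
    refine ⟨⟨h.nodup_candidates, h2, ?_⟩, hsub.antisymm fun c hc => ?_⟩
    · intro c hc hce
      obtain ⟨i, hi, rfl⟩ := mem_extras.1 hce
      have := (h.name_mem_candidates (h.wf.1.2.2 i hi)).1 hc
      have := h1 i hi
      omega
    · obtain ⟨a, ha, rfl⟩ := mem_all.1 hc
      rw [List.mem_toFinset, List.mem_append, h.name_mem_candidates ha, h.name_mem_extras ha]
      by_cases hlt : a < F.numCand
      · exact Or.inl hlt
      · exact Or.inr (h3 a ha (not_lt.1 hlt))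
  · rintro ⟨⟨_, h2, hd⟩, he⟩
    refine ⟨fun i hi => ?_, h2, fun a ha hle => ?_⟩
    · by_contra hlt
      exact hd ((h.name_mem_candidates (h.wf.1.2.2 i hi)).2 (not_le.1 hlt))
        (mem_extras.2 ⟨i, hi, rfl⟩)
    · have : F.name a ∈ (F.candidates ++ F.extras).toFinset := he ▸ mem_all.2 ⟨a, ha, rfl⟩
      rw [List.mem_toFinset, List.mem_append, h.name_mem_candidates ha,
        h.name_mem_extras ha] at this
      exact this.resolve_left (by omega)

theorem isProfile_voters : IsProfile F.all F.voters := by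
  intro v hv
  obtain ⟨j, hj, rfl⟩ := List.mem_map.1 hv
  exact h.wf.isRanking_vote (by rw [List.mem_range] at hj; unfold numVotes; omega)

theorem isProfile_newVoters : IsProfile F.all F.newVoters := by
  intro v hv
  obtain ⟨j, hj, rfl⟩ := List.mem_map.1 hv
  exact h.wf.isRanking_vote (by rw [List.mem_range] at hj; unfold numVotes; omega)

theorem sum_ind_le_limit_iff {n : ℕ} (hn : n ≤ N) (P : ℕ → Prop) :
    ∑ i ∈ Finset.range n, ind (P i) ≤ F.limit 0 ↔
      ∑ i ∈ Finset.range n, ind (P i) ≤ F.name F.numAll :=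
  h.wf.le_limit_iff ((sum_ind_le n P).trans hn)

theorem card_added (hd : F.extras.Nodup) {S : Finset ℕ} (hS : F.cands 0 ∩ F.extras.toFinset = S) :
    ∑ i ∈ Finset.range F.numExtra, ind (F.Cand 0 (F.extra i)) ≤ F.limit 0 ↔
      S.card ≤ F.name F.numAll := by
  rw [h.sum_ind_le_limit_iff (h.le 0 1 0 0), sum_ind_eq_card (S := S)
    (f := fun i => F.name (F.extra i)) (P := fun i => F.Cand 0 (F.extra i)) ?_ ?_]
  · intro i hi i' hi' he
    exact h.nodup_extras_iff.1 hd i hi i' hi'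
      (h.wf.name_inj (h.wf.1.2.2 i hi) (h.wf.1.2.2 i' hi') he)
  · intro c
    rw [← hS, Finset.mem_inter, List.mem_toFinset, mem_extras]
    constructor
    · rintro ⟨hc, i, hi, rfl⟩
      exact ⟨i, hi, (h.wf.name_mem_cands (h.wf.1.2.2 i hi)).1 hc, rfl⟩
    · rintro ⟨i, hi, hC, rfl⟩
      exact ⟨(h.wf.name_mem_cands (h.wf.1.2.2 i hi)).2 hC, i, hi, rfl⟩

theorem card_deleted {S : Finset ℕ} (hS : F.all \ F.cands 0 = S) :
    ∑ a ∈ Finset.range F.numAll, ind (¬F.Cand 0 a) ≤ F.limit 0 ↔ S.card ≤ F.name F.numAll := by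
  rw [h.sum_ind_le_limit_iff (h.le 0 5 0 0), sum_ind_eq_card (S := S)
    fun _ ha _ hb => h.wf.name_inj ha hb]
  intro c
  rw [← hS, Finset.mem_sdiff, mem_all]
  constructor
  · rintro ⟨⟨a, ha, rfl⟩, hc⟩
    exact ⟨a, ha, fun hC => hc ((h.wf.name_mem_cands ha).2 hC), rfl⟩
  · rintro ⟨a, ha, hC, rfl⟩
    exact ⟨⟨a, ha, rfl⟩, fun hc => hC ((h.wf.name_mem_cands ha).1 hc)⟩

theorem allCand_iff {s : ℕ} : F.AllCand s ↔ F.candidates.toFinset ⊆ F.cands s := by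
  constructor
  · intro hA c hc
    obtain ⟨a, ha, rfl⟩ := mem_candidates.1 (List.mem_toFinset.1 hc)
    exact (h.wf.name_mem_cands (ha.trans_le h.wf.1.2.1)).2 (hA a ha)
  · intro hs a ha
    exact (h.wf.name_mem_cands (ha.trans_le h.wf.1.2.1)).1
      (hs (List.mem_toFinset.2 (mem_candidates.2 ⟨a, ha, rfl⟩)))

end Correct

end Table

/-! ### Lengths of codes -/

theorem length_bits_le (k : ℕ) : k.bits.length ≤ (encodeNat k).length :=
  length_le_encodeList _ _

theorem length_encodeNat_zero_le (k : ℕ) : (encodeNat 0).length ≤ (encodeNat k).length := by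
  have : (encodeNat 0).length = 1 := by simp [encodeNat, encodeList]
  rw [this, encodeNat, encodeList_eq, List.length_append, List.length_singleton]
  omega

theorem length_le_encodeCandidates (C : List ℕ) : C.length ≤ (encodeCandidates C).length :=
  length_le_encodeList _ _

theorem length_bits_le_of_mem {C : List ℕ} {c : ℕ} (hc : c ∈ C) :
    c.bits.length ≤ (encodeCandidates C).length :=
  (length_bits_le c).trans (length_le_encodeList_of_mem _ hc)

theorem length_le_encodeProfile (V : Profile) : V.length ≤ (encodeProfile V).length :=
  length_le_encodeList _ _

theorem TieRule.survivors_subset (t : TieRule) (W : Finset ℕ) : t.survivors W ⊆ W := by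
  cases t
  · exact subset_rfl
  · rw [survivors]
    split_ifs <;> simp

theorem exists_perm_of_perm_map {α β : Type} [DecidableEq α] {g : α → β} :
    ∀ {l' : List β} {l : List α}, l'.Perm (l.map g) → ∃ l'' : List α, l''.Perm l ∧ l''.map g = l'
  | [], l, h => by
    have : l = [] := by simpa using h
    exact ⟨[], this ▸ List.Perm.refl _, rfl⟩
  | x :: t, l, h => by
    obtain ⟨i, hi, rfl⟩ := List.mem_map.1 (h.subset (List.mem_cons_self ..))
    have h1 := List.perm_cons_erase hi
    have h2 : t.Perm ((l.erase i).map g) := (h.trans (h1.map g)).cons_inv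
    obtain ⟨l'', hl, rfl⟩ := exists_perm_of_perm_map h2
    exact ⟨i :: l'', (hl.cons i).trans h1.symm, rfl⟩

theorem sum_ind_eq_length {n : ℕ} {l : List ℕ} (hl : l.Nodup) {P : ℕ → Prop}
    (hP : ∀ i, i ∈ l ↔ i < n ∧ P i) : ∑ i ∈ Finset.range n, ind (P i) = l.length := by
  have h1 := sum_ind_eq_countP hl (fun j hj => ((hP j).1 hj).1) fun _ => True
  rw [List.countP_eq_length.2 (by simp)] at h1
  rw [← h1]
  refine Finset.sum_congr rfl fun i hi => ?_
  simp [hP, Finset.mem_range.1 hi]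

theorem sum_ind_add_sum_ind_not (n : ℕ) (P : ℕ → Prop) :
    ∑ i ∈ Finset.range n, ind (P i) + ∑ i ∈ Finset.range n, ind (¬P i) = n := by
  rw [← Finset.sum_add_distrib]
  have : ∀ i ∈ Finset.range n, ind (P i) + ind (¬P i) = 1 := fun i _ => by
    by_cases h : P i <;> simp [ind, h]
  rw [Finset.sum_congr rfl this]
  simp

namespace Table

namespace Correct

/-! ### From tables to control actions -/

variable {E : System} {Q : Certification E} {N : ℕ} {F : Table} {g : Goal}

theorem code_mem_addCandidates (h : Correct Q N F) (hl : F.Legal .addCandidates)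
    (hg : F.GoalMet g) : F.code .addCandidates ∈ controlProblem E g .addCandidates := by
  obtain ⟨hE, hnew, hC, hV, hk⟩ := hl
  obtain ⟨hnd, hall⟩ := h.extrasNew_iff.1 hE
  refine ⟨F.candidates, F.extras, F.voters, F.name F.numAll, F.name F.target, ?_, hnd, ?_,
    h.target_mem, F.cands 0 ∩ F.extras.toFinset, Finset.inter_subset_right, ?_, ?_⟩
  · rw [code, h.wf.candidatesCode_eq, h.wf.extrasCode_eq, h.wf.votersCode_eq,
      h.wf.nameCode_eq le_rfl, h.wf.nameCode_eq h.target_lt.le]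
  · rw [hall]
    exact h.isProfile_voters
  · exact (h.card_added (List.nodup_append'.1 hnd).2.1 rfl).1 hk
  · have : F.candidates.toFinset ∪ F.cands 0 ∩ F.extras.toFinset = F.cands 0 := by
      rw [Finset.union_inter_distrib_left, Finset.union_eq_right.2 (h.allCand_iff.1 hC),
        ← List.toFinset_append, hall]
      exact Finset.inter_eq_left.2 (cands_subset_all 0)
    rw [h.winners_voters (by norm_num) this hnew hV]
    exact h.met_iff g |>.2 hg

theorem code_mem_addCandidatesUnlimited (h : Correct Q N F) (hl : F.Legal .addCandidatesUnlimited)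
    (hg : F.GoalMet g) :
    F.code .addCandidatesUnlimited ∈ controlProblem E g .addCandidatesUnlimited := by
  obtain ⟨hE, hnew, hC, hV⟩ := hl
  obtain ⟨hnd, hall⟩ := h.extrasNew_iff.1 hE
  refine ⟨F.candidates, F.extras, F.voters, F.name F.target, ?_, hnd, ?_,
    h.target_mem, F.cands 0 ∩ F.extras.toFinset, Finset.inter_subset_right, ?_⟩
  · rw [code, h.wf.candidatesCode_eq, h.wf.extrasCode_eq, h.wf.votersCode_eq,
      h.wf.nameCode_eq h.target_lt.le]
  · rw [hall]
    exact h.isProfile_voters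
  · have : F.candidates.toFinset ∪ F.cands 0 ∩ F.extras.toFinset = F.cands 0 := by
      rw [Finset.union_inter_distrib_left, Finset.union_eq_right.2 (h.allCand_iff.1 hC),
        ← List.toFinset_append, hall]
      exact Finset.inter_eq_left.2 (cands_subset_all 0)
    rw [h.winners_voters (by norm_num) this hnew hV]
    exact h.met_iff g |>.2 hg

theorem code_mem_deleteCandidates (h : Correct Q N F) (hl : F.Legal .deleteCandidates)
    (hg : F.GoalMet g) : F.code .deleteCandidates ∈ controlProblem E g .deleteCandidates := by
  obtain ⟨hE, hnew, hV, hp, hk⟩ := hl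
  have hall := h.candidates_eq_all_iff.2 hE
  refine ⟨F.candidates, F.voters, F.name F.numAll, F.name F.target, ?_, h.nodup_candidates, ?_,
    h.target_mem, F.all \ F.cands 0, ?_, ?_, (h.card_deleted rfl).1 hk, ?_⟩
  · rw [code, h.wf.candidatesCode_eq, h.wf.votersCode_eq,
      h.wf.nameCode_eq le_rfl, h.wf.nameCode_eq h.target_lt.le]
  · rw [hall]
    exact h.isProfile_voters
  · rw [hall]
    exact Finset.sdiff_subset
  · rw [Finset.mem_sdiff, not_and_not_right]
    exact fun _ => (h.wf.name_mem_cands h.target_lt).2 hp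
  · rw [hall, h.winners_voters (by norm_num)
      (Finset.sdiff_sdiff_eq_self (cands_subset_all 0)) hnew hV]
    exact h.met_iff g |>.2 hg

theorem code_mem_deleteDeletableCandidates (h : Correct Q N F)
    (hl : F.Legal .deleteDeletableCandidates) (hg : F.GoalMet g) :
    F.code .deleteDeletableCandidates ∈ controlProblem E g .deleteDeletableCandidates := by
  obtain ⟨⟨hE, hD⟩, hnew, hV, hp, hk, hdel⟩ := hl
  have hall := h.candidates_eq_all_iff.2 hE
  refine ⟨F.candidates, F.extras, F.voters, F.name F.numAll, F.name F.target, ?_,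
    h.nodup_candidates, h.nodup_extras_iff.2 hD, ?_, ?_,
    h.target_mem, F.all \ F.cands 0, ?_, ?_, (h.card_deleted rfl).1 hk, ?_⟩
  · rw [code, h.wf.candidatesCode_eq, h.wf.extrasCode_eq, h.wf.votersCode_eq,
      h.wf.nameCode_eq le_rfl, h.wf.nameCode_eq h.target_lt.le]
  · intro c hc
    rw [← List.mem_toFinset, hall]
    exact h.extras_subset_all (List.mem_toFinset.2 hc)
  · rw [hall]
    exact h.isProfile_voters
  · intro c hc
    obtain ⟨hca, hcn⟩ := Finset.mem_sdiff.1 hc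
    obtain ⟨a, ha, rfl⟩ := mem_all.1 hca
    rw [List.mem_toFinset, h.name_mem_extras ha]
    exact hdel a ha fun hC => hcn ((h.wf.name_mem_cands ha).2 hC)
  · rw [Finset.mem_sdiff, not_and_not_right]
    exact fun _ => (h.wf.name_mem_cands h.target_lt).2 hp
  · rw [hall, h.winners_voters (by norm_num)
      (Finset.sdiff_sdiff_eq_self (cands_subset_all 0)) hnew hV]
    exact h.met_iff g |>.2 hg

theorem partition_cands (h : Correct Q N F)
    (hcomp : ∀ a, a < F.numAll → (F.Cand 2 a ↔ ¬F.Cand 1 a)) :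
    Disjoint (F.cands 1) (F.cands 2) ∧ F.cands 1 ∪ F.cands 2 = F.all := by
  constructor
  · rw [Finset.disjoint_left]
    intro c h1 h2
    obtain ⟨a, ha, hC, rfl⟩ := mem_cands.1 h1
    exact (hcomp a ha).1 ((h.wf.name_mem_cands ha).1 h2) hC
  · refine (Finset.union_subset (cands_subset_all 1) (cands_subset_all 2)).antisymm fun c hc => ?_
    obtain ⟨a, ha, rfl⟩ := mem_all.1 hc
    rw [Finset.mem_union, h.wf.name_mem_cands ha, h.wf.name_mem_cands ha, hcomp a ha]
    exact em _

theorem survivors_subset_all (t : TieRule) (s : ℕ) : t.survivors (F.wins s) ⊆ F.all :=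
  (t.survivors_subset _).trans fun c hc => by
    obtain ⟨a, ha, _, rfl⟩ := mem_wins.1 hc
    exact mem_all.2 ⟨a, ha, rfl⟩

theorem code_mem_partitionCandidates (h : Correct Q N F) {t : TieRule}
    (hl : F.Legal (.partitionCandidates t)) (hg : F.GoalMet g) :
    F.code (.partitionCandidates t) ∈ controlProblem E g (.partitionCandidates t) := by
  obtain ⟨hE, hnew, hV₀, hV₁, hC⟩ := hl
  have hall := h.candidates_eq_all_iff.2 hE
  obtain ⟨hdis, hun⟩ := h.partition_cands fun a ha => (hC a ha).1
  refine ⟨F.candidates, F.voters, F.name F.target, ?_, h.nodup_candidates, ?_,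
    h.target_mem, F.cands 1, F.cands 2, hdis, hun.trans hall.symm, ?_⟩
  · rw [code, h.wf.candidatesCode_eq, h.wf.votersCode_eq, h.wf.nameCode_eq h.target_lt.le]
  · rw [hall]
    exact h.isProfile_voters
  · rw [h.winners_voters (s := 1) (by norm_num) rfl hnew hV₁]
    have : F.cands 0 = t.survivors (F.wins 1) ∪ F.cands 2 := by
      rw [h.cands_eq_iff (Finset.union_subset (survivors_subset_all t 1) (cands_subset_all 2))]
      intro a ha
      rw [Finset.mem_union, h.name_mem_survivors ha, h.wf.name_mem_cands ha, (hC a ha).2]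
    rw [h.winners_voters (by norm_num) this.symm hnew hV₀]
    exact h.met_iff g |>.2 hg

theorem code_mem_runoffPartitionCandidates (h : Correct Q N F) {t : TieRule}
    (hl : F.Legal (.runoffPartitionCandidates t)) (hg : F.GoalMet g) :
    F.code (.runoffPartitionCandidates t) ∈ controlProblem E g (.runoffPartitionCandidates t) := by
  obtain ⟨hE, hnew, hV₀, hV₁, hV₂, hC⟩ := hl
  have hall := h.candidates_eq_all_iff.2 hE
  obtain ⟨hdis, hun⟩ := h.partition_cands fun a ha => (hC a ha).1
  refine ⟨F.candidates, F.voters, F.name F.target, ?_, h.nodup_candidates, ?_,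
    h.target_mem, F.cands 1, F.cands 2, hdis, hun.trans hall.symm, ?_⟩
  · rw [code, h.wf.candidatesCode_eq, h.wf.votersCode_eq, h.wf.nameCode_eq h.target_lt.le]
  · rw [hall]
    exact h.isProfile_voters
  · rw [h.winners_voters (s := 1) (by norm_num) rfl hnew hV₁,
      h.winners_voters (s := 2) (by norm_num) rfl hnew hV₂]
    have : F.cands 0 = t.survivors (F.wins 1) ∪ t.survivors (F.wins 2) := by
      rw [h.cands_eq_iff
        (Finset.union_subset (survivors_subset_all t 1) (survivors_subset_all t 2))]
      intro a ha
      rw [Finset.mem_union, h.name_mem_survivors ha, h.name_mem_survivors ha, (hC a ha).2]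
    rw [h.winners_voters (by norm_num) this.symm hnew hV₀]
    exact h.met_iff g |>.2 hg

theorem cands_eq_candidates (h : Correct Q N F) (hE : F.numAll = F.numCand) {s : ℕ}
    (hC : F.AllCand s) : F.candidates.toFinset = F.cands s :=
  (h.allCand_iff.1 hC).antisymm (h.candidates_eq_all_iff.2 hE ▸ cands_subset_all s)

theorem code_mem_addVoters (h : Correct Q N F) (hl : F.Legal .addVoters)
    (hg : F.GoalMet g) : F.code .addVoters ∈ controlProblem E g .addVoters := by
  classical
  obtain ⟨hE, hC, hV, hk⟩ := hl
  have hall := h.candidates_eq_all_iff.2 hE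
  have hlen := sum_ind_eq_length (n := F.numNew)
    (l := (List.range F.numNew).filter fun i => F.Voter 0 (F.numVoters + i))
    (List.nodup_range.filter _) (P := fun i => F.Voter 0 (F.numVoters + i)) (by simp)
  rw [h.sum_ind_le_limit_iff (h.le 0 3 0 0), hlen] at hk
  refine ⟨F.candidates, F.voters, F.newVoters, F.name F.numAll, F.name F.target, ?_,
    h.nodup_candidates, ?_, ?_, h.target_mem,
    ((List.range F.numNew).filter fun i => F.Voter 0 (F.numVoters + i)).map
      fun i => F.vote (F.numVoters + i), List.filter_sublist.map _, ?_, ?_⟩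
  · rw [code, h.wf.candidatesCode_eq, h.wf.votersCode_eq, h.wf.newVotersCode_eq,
      h.wf.nameCode_eq le_rfl, h.wf.nameCode_eq h.target_lt.le]
  · rw [hall]
    exact h.isProfile_voters
  · rw [hall]
    exact h.isProfile_newVoters
  · simpa using hk
  · have hL : F.voters ++ ((List.range F.numNew).filter fun i => F.Voter 0 (F.numVoters + i)).map
        (fun i => F.vote (F.numVoters + i)) = (List.range F.numVoters ++
          ((List.range F.numNew).filter fun i => F.Voter 0 (F.numVoters + i)).map
            (F.numVoters + ·)).map F.vote := by
      simp [voters, Function.comp_def]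
    rw [hL, h.winners_eq (by norm_num) (h.cands_eq_candidates hE hC)]
    · exact h.met_iff g |>.2 hg
    · refine List.nodup_append'.2 ⟨List.nodup_range,
        (List.nodup_range.filter _).map (add_right_injective _), ?_⟩
      intro j hj hj'
      rw [List.mem_range] at hj
      obtain ⟨i, _, rfl⟩ := List.mem_map.1 hj'
      omega
    · intro j
      simp only [List.mem_append, List.mem_range, List.mem_map, List.mem_filter,
        decide_eq_true_eq, numVotes]
      constructor
      · rintro (hj | ⟨i, ⟨hi, hVi⟩, rfl⟩)
        · exact ⟨by omega, hV j hj⟩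
        · exact ⟨by omega, hVi⟩
      · rintro ⟨hj, hVj⟩
        by_cases hlt : j < F.numVoters
        · exact Or.inl hlt
        · have e : F.numVoters + (j - F.numVoters) = j := by omega
          exact Or.inr ⟨j - F.numVoters, ⟨by omega, by rwa [e]⟩, e⟩

theorem code_mem_deleteVoters (h : Correct Q N F) (hl : F.Legal .deleteVoters)
    (hg : F.GoalMet g) : F.code .deleteVoters ∈ controlProblem E g .deleteVoters := by
  classical
  obtain ⟨hE, hnew, hC, hk⟩ := hl
  have hall := h.candidates_eq_all_iff.2 hE
  have hlen := sum_ind_eq_length (n := F.numVoters)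
    (l := (List.range F.numVoters).filter fun j => F.Voter 0 j)
    (List.nodup_range.filter _) (P := fun j => F.Voter 0 j) (by simp)
  replace hk : ∑ j ∈ Finset.range F.numVoters, ind (¬F.Voter 0 j) ≤ F.name F.numAll :=
    (h.sum_ind_le_limit_iff (h.le 0 2 0 0) _).1 hk
  have hsum := sum_ind_add_sum_ind_not F.numVoters fun j => F.Voter 0 j
  refine ⟨F.candidates, F.voters, F.name F.numAll, F.name F.target, ?_,
    h.nodup_candidates, ?_, h.target_mem,
    ((List.range F.numVoters).filter fun j => F.Voter 0 j).map F.vote,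
    List.filter_sublist.map _, ?_, ?_⟩
  · rw [code, h.wf.candidatesCode_eq, h.wf.votersCode_eq,
      h.wf.nameCode_eq le_rfl, h.wf.nameCode_eq h.target_lt.le]
  · rw [hall]
    exact h.isProfile_voters
  · rw [length_voters, List.length_map]
    omega
  · rw [h.winners_eq (by norm_num) (h.cands_eq_candidates hE hC) (List.nodup_range.filter _)]
    · exact h.met_iff g |>.2 hg
    · intro j
      simp [numVotes, hnew]

theorem code_mem_partitionVoters (h : Correct Q N F) {t : TieRule}
    (hl : F.Legal (.partitionVoters t)) (hg : F.GoalMet g) :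
    F.code (.partitionVoters t) ∈ controlProblem E g (.partitionVoters t) := by
  classical
  obtain ⟨hE, hnew, hC₁, hC₂, hV₀, hV, hC⟩ := hl
  have hall := h.candidates_eq_all_iff.2 hE
  refine ⟨F.candidates, F.voters, F.name F.target, ?_, h.nodup_candidates, ?_,
    h.target_mem, ((List.range F.numVoters).filter fun j => F.Voter 1 j).map F.vote,
    ((List.range F.numVoters).filter fun j => !decide (F.Voter 1 j)).map F.vote, ?_, ?_⟩
  · rw [code, h.wf.candidatesCode_eq, h.wf.votersCode_eq, h.wf.nameCode_eq h.target_lt.le]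
  · rw [hall]
    exact h.isProfile_voters
  · rw [← List.map_append]
    exact (List.filter_append_perm _ _).map _
  · rw [h.winners_eq (s := 1) (by norm_num) (h.cands_eq_candidates hE hC₁)
        (List.nodup_range.filter _) (fun j => by simp [numVotes, hnew]),
      h.winners_eq (s := 2) (by norm_num) (h.cands_eq_candidates hE hC₂)
        (List.nodup_range.filter _) (fun j => by
          have := hV j
          simp only [numVotes, hnew, add_zero] at this
          simp only [List.mem_filter, List.mem_range, numVotes, hnew, add_zero]
          refine and_congr_right fun hj => ?_
          rw [this hj]
          simp)]
    have : F.cands 0 = t.survivors (F.wins 1) ∪ t.survivors (F.wins 2) := by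
      rw [h.cands_eq_iff
        (Finset.union_subset (survivors_subset_all t 1) (survivors_subset_all t 2))]
      intro a ha
      rw [Finset.mem_union, h.name_mem_survivors ha, h.name_mem_survivors ha, hC a ha]
    rw [h.winners_voters (by norm_num) this.symm hnew hV₀]
    exact h.met_iff g |>.2 hg

/-- A correct table with a legal action that meets the goal describes a yes-instance. -/
theorem code_mem (h : Correct Q N F) {action : Action} (hl : F.Legal action) (hg : F.GoalMet g) :
    F.code action ∈ controlProblem E g action := by
  cases action with
  | addCandidates => exact h.code_mem_addCandidates hl hg
  | addCandidatesUnlimited => exact h.code_mem_addCandidatesUnlimited hl hg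
  | deleteCandidates => exact h.code_mem_deleteCandidates hl hg
  | deleteDeletableCandidates => exact h.code_mem_deleteDeletableCandidates hl hg
  | partitionCandidates t => exact h.code_mem_partitionCandidates hl hg
  | runoffPartitionCandidates t => exact h.code_mem_runoffPartitionCandidates hl hg
  | addVoters => exact h.code_mem_addVoters hl hg
  | deleteVoters => exact h.code_mem_deleteVoters hl hg
  | partitionVoters t => exact h.code_mem_partitionVoters hl hg

end Correct

/-! ### From control actions to tables -/

variable {E : System} {Q : Certification E} {N : ℕ} {g : Goal}

/-- A correct table for an instance in which all candidates are registered. -/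
theorem exists_correct (Q : Certification E) (N : ℕ) {C D : List ℕ} {V W : Profile} {k p : ℕ}
    (hU : C.Nodup) (hD : D ⊆ C) (hV : IsProfile C.toFinset V) (hW : IsProfile C.toFinset W)
    (hp : p ∈ C) (hN : (encodeCandidates C).length + D.length + V.length + W.length +
      (encodeNat k).length ≤ N)
    (Cs : ℕ → Finset ℕ) (hCs : ∀ s, Cs s ⊆ C.toFinset) (Vs : ℕ → ℕ → Prop) :
    ∃ F : Table, Correct Q N F ∧ F.candidates = C ∧ F.extras = D ∧ F.voters = V ∧
      F.newVoters = W ∧ F.name F.numAll = k ∧ F.name F.target = p ∧ F.all = C.toFinset ∧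
      (∀ s, F.cands s = Cs s) ∧ ∀ s j, F.Voter s j ↔ Vs s j := by
  have h1 := length_le_encodeCandidates C
  have h2 := length_bits_le k
  obtain ⟨F, hle, hwf, hch, h⟩ := exists_table Q N (k := k) (List.prefix_refl C) hU hD
    (fun v hv => (List.mem_append.1 hv).elim (hV v) (hW v)) hp (by omega)
    (by rw [List.length_append]; omega) (by omega)
    (fun c hc => (length_bits_le_of_mem hc).trans (by omega)) (by omega) Cs hCs Vs
  exact ⟨F, ⟨hle, hwf, fun s _ T _ => hch s T⟩, h⟩

theorem exists_correct_append (Q : Certification E) (N : ℕ) {C D : List ℕ} {V : Profile} {k p : ℕ}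
    (hU : (C ++ D).Nodup) (hV : IsProfile (C ++ D).toFinset V)
    (hp : p ∈ C) (hN : (encodeCandidates C).length + (encodeCandidates D).length + V.length +
      (encodeNat k).length ≤ N)
    {S : Finset ℕ} (hS : S ⊆ (C ++ D).toFinset) :
    ∃ F : Table, Correct Q N F ∧ F.candidates = C ∧ F.extras = D ∧ F.voters = V ∧
      F.newVoters = [] ∧ F.name F.numAll = k ∧ F.name F.target = p ∧ F.all = (C ++ D).toFinset ∧
      F.cands 0 = S ∧ ∀ j, F.Voter 0 j := by
  have h1 := length_le_encodeCandidates C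
  have h2 := length_bits_le k
  have h3 := length_le_encodeCandidates D
  obtain ⟨F, hle, hwf, hch, e1, e2, e3, e4, e5, e6, e7, e8, e9⟩ :=
    exists_table Q N (W := []) (k := k) (List.prefix_append C D) hU (List.subset_append_right C D)
    (by rwa [List.append_nil]) hp (by rw [List.length_append]; omega)
    (by rw [List.append_nil]; omega) (by omega)
    (fun c hc => (List.mem_append.1 hc).elim
      (fun hc => (length_bits_le_of_mem hc).trans (by omega))
      fun hc => (length_bits_le_of_mem hc).trans (by omega))
    (by omega) (fun _ => S) (fun _ => hS) fun _ _ => True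
  exact ⟨F, ⟨hle, hwf, fun s _ T _ => hch s T⟩, e1, e2, e3, e4, e5, e6, e7, e8 0,
    fun j => (e9 0 j).2 trivial⟩

theorem numNew_eq_zero {F : Table} (h : F.newVoters = []) : F.numNew = 0 := by
  have := length_newVoters (F := F)
  rw [h] at this
  exact this.symm

theorem exists_addCandidates {x : List Bool} (hx : x ∈ controlProblem E g .addCandidates)
    (Q : Certification E) : ∃ F, Correct Q x.length F ∧ x = F.code .addCandidates ∧
      F.Legal .addCandidates ∧ F.GoalMet g := by
  obtain ⟨C, D, V, k, p, hx, hnd, hV, hp, D', hD', hk, hg⟩ := hx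
  have hlen := congrArg List.length hx
  simp only [List.length_append] at hlen
  have hlV := length_le_encodeProfile V
  obtain ⟨F, h, rfl, rfl, rfl, h4, rfl, rfl, h7, h8, hVs⟩ := exists_correct_append Q x.length hnd hV
    hp (k := k) (by omega) (S := C.toFinset ∪ D')
    (by rw [List.toFinset_append]; exact Finset.union_subset_union_right hD')
  have hnew := numNew_eq_zero h4
  have hall : F.AllVoter 0 := fun j _ => hVs j
  refine ⟨F, h, ?_, ⟨h.extrasNew_iff.2 ⟨hnd, h7.symm⟩, hnew, h.allCand_iff.2 ?_, hall, ?_⟩, ?_⟩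
  · rw [hx, code, h.wf.candidatesCode_eq, h.wf.extrasCode_eq, h.wf.votersCode_eq,
      h.wf.nameCode_eq le_rfl, h.wf.nameCode_eq h.target_lt.le]
  · rw [h8]
    exact Finset.subset_union_left
  · refine (h.card_added (List.nodup_append'.1 hnd).2.1 (S := D') ?_).2 hk
    have hdis : Disjoint F.candidates.toFinset F.extras.toFinset := by
      rw [Finset.disjoint_left]
      intro c hc hc'
      exact (List.nodup_append'.1 hnd).2.2 (List.mem_toFinset.1 hc) (List.mem_toFinset.1 hc')
    rw [h8, Finset.union_inter_distrib_right, Finset.disjoint_iff_inter_eq_empty.1 hdis,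
      Finset.empty_union, Finset.inter_eq_left.2 hD']
  · rw [h.winners_voters (by norm_num) h8.symm hnew hall] at hg
    exact (h.met_iff g).1 hg

theorem exists_addCandidatesUnlimited {x : List Bool}
    (hx : x ∈ controlProblem E g .addCandidatesUnlimited) (Q : Certification E) :
    ∃ F, Correct Q x.length F ∧ x = F.code .addCandidatesUnlimited ∧
      F.Legal .addCandidatesUnlimited ∧ F.GoalMet g := by
  obtain ⟨C, D, V, p, hx, hnd, hV, hp, D', hD', hg⟩ := hx
  have hlen := congrArg List.length hx
  simp only [List.length_append] at hlen
  have hlV := length_le_encodeProfile V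
  have hl0 : (encodeNat 0).length ≤ (encodeNat p).length := length_encodeNat_zero_le p
  obtain ⟨F, h, rfl, rfl, rfl, h4, _, rfl, h7, h8, hVs⟩ := exists_correct_append Q x.length hnd hV
    hp (k := 0) (by omega) (S := C.toFinset ∪ D')
    (by rw [List.toFinset_append]; exact Finset.union_subset_union_right hD')
  have hnew := numNew_eq_zero h4
  have hall : F.AllVoter 0 := fun j _ => hVs j
  refine ⟨F, h, ?_, ⟨h.extrasNew_iff.2 ⟨hnd, h7.symm⟩, hnew, h.allCand_iff.2 ?_, hall⟩, ?_⟩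
  · rw [hx, code, h.wf.candidatesCode_eq, h.wf.extrasCode_eq, h.wf.votersCode_eq,
      h.wf.nameCode_eq h.target_lt.le]
  · rw [h8]
    exact Finset.subset_union_left
  · rw [h.winners_voters (by norm_num) h8.symm hnew hall] at hg
    exact (h.met_iff g).1 hg

theorem exists_deleteCandidates {x : List Bool} (hx : x ∈ controlProblem E g .deleteCandidates)
    (Q : Certification E) : ∃ F, Correct Q x.length F ∧ x = F.code .deleteCandidates ∧
      F.Legal .deleteCandidates ∧ F.GoalMet g := by
  obtain ⟨C, V, k, p, hx, hnd, hV, hp, D', hD', hpD, hk, hg⟩ := hx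
  have hlen := congrArg List.length hx
  simp only [List.length_append] at hlen
  have hlV := length_le_encodeProfile V
  obtain ⟨F, h, rfl, _, rfl, h4, rfl, rfl, h7, h8, hVs⟩ := exists_correct Q x.length (D := [])
    (W := []) hnd (List.nil_subset _) hV (fun _ hv => absurd hv List.not_mem_nil) hp (k := k)
    (by simp only [List.length_nil]; omega) (fun _ => C.toFinset \ D')
    (fun _ => Finset.sdiff_subset) fun _ _ => True
  have hnew := numNew_eq_zero h4
  have hall : F.AllVoter 0 := fun j _ => (hVs 0 j).2 trivial
  refine ⟨F, h, ?_, ⟨h.candidates_eq_all_iff.1 h7.symm, hnew, hall, ?_, ?_⟩, ?_⟩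
  · rw [hx, code, h.wf.candidatesCode_eq, h.wf.votersCode_eq,
      h.wf.nameCode_eq le_rfl, h.wf.nameCode_eq h.target_lt.le]
  · rw [← h.wf.name_mem_cands h.target_lt, h8, Finset.mem_sdiff]
    exact ⟨List.mem_toFinset.2 hp, hpD⟩
  · refine (h.card_deleted (S := D') ?_).2 hk
    rw [h7, h8, Finset.sdiff_sdiff_eq_self hD']
  · rw [h.winners_voters (by norm_num) (h8 0).symm hnew hall] at hg
    exact (h.met_iff g).1 hg

theorem exists_deleteDeletableCandidates {x : List Bool}
    (hx : x ∈ controlProblem E g .deleteDeletableCandidates) (Q : Certification E) :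
    ∃ F, Correct Q x.length F ∧ x = F.code .deleteDeletableCandidates ∧
      F.Legal .deleteDeletableCandidates ∧ F.GoalMet g := by
  obtain ⟨C, D, V, k, p, hx, hnd, hDn, hDC, hV, hp, D', hD', hpD, hk, hg⟩ := hx
  have hlen := congrArg List.length hx
  simp only [List.length_append] at hlen
  have hlV := length_le_encodeProfile V
  have hlD := length_le_encodeCandidates D
  obtain ⟨F, h, rfl, rfl, rfl, h4, rfl, rfl, h7, h8, hVs⟩ := exists_correct Q x.length
    (W := []) hnd hDC hV (fun _ hv => absurd hv List.not_mem_nil) hp (k := k)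
    (by simp only [List.length_nil]; omega) (fun _ => C.toFinset \ D')
    (fun _ => Finset.sdiff_subset) fun _ _ => True
  have hnew := numNew_eq_zero h4
  have hall : F.AllVoter 0 := fun j _ => (hVs 0 j).2 trivial
  have hD'C : D' ⊆ F.candidates.toFinset := fun c hc =>
    List.mem_toFinset.2 (hDC (List.mem_toFinset.1 (hD' hc)))
  refine ⟨F, h, ?_, ⟨⟨h.candidates_eq_all_iff.1 h7.symm, h.nodup_extras_iff.1 hDn⟩, hnew, hall,
    ?_, ?_, ?_⟩, ?_⟩
  · rw [hx, code, h.wf.candidatesCode_eq, h.wf.extrasCode_eq, h.wf.votersCode_eq,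
      h.wf.nameCode_eq le_rfl, h.wf.nameCode_eq h.target_lt.le]
  · rw [← h.wf.name_mem_cands h.target_lt, h8, Finset.mem_sdiff]
    exact ⟨List.mem_toFinset.2 hp, hpD⟩
  · refine (h.card_deleted (S := D') ?_).2 hk
    rw [h7, h8, Finset.sdiff_sdiff_eq_self hD'C]
  · intro a ha hC
    rw [← h.wf.name_mem_cands ha, h8, Finset.mem_sdiff, not_and_not_right] at hC
    have haC : F.name a ∈ F.candidates.toFinset := h7 ▸ mem_all.2 ⟨a, ha, rfl⟩
    exact (h.name_mem_extras ha).1 (List.mem_toFinset.1 (hD' (hC haC)))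
  · rw [h.winners_voters (by norm_num) (h8 0).symm hnew hall] at hg
    exact (h.met_iff g).1 hg

theorem cand_two_iff {F : Table} (h : Correct Q N F) {C₁ C₂ : Finset ℕ}
    (hdis : Disjoint C₁ C₂) (hun : C₁ ∪ C₂ = F.all) (h₁ : F.cands 1 = C₁) (h₂ : F.cands 2 = C₂)
    {a : ℕ} (ha : a < F.numAll) : F.Cand 2 a ↔ ¬F.Cand 1 a := by
  rw [← h.wf.name_mem_cands ha, ← h.wf.name_mem_cands ha, h₁, h₂]
  have : F.name a ∈ C₁ ∪ C₂ := hun ▸ mem_all.2 ⟨a, ha, rfl⟩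
  exact ⟨fun h2 h1 => Finset.disjoint_left.1 hdis h1 h2, (Finset.mem_union.1 this).resolve_left⟩

theorem exists_partitionCandidates {x : List Bool} {t : TieRule}
    (hx : x ∈ controlProblem E g (.partitionCandidates t)) (Q : Certification E) :
    ∃ F, Correct Q x.length F ∧ x = F.code (.partitionCandidates t) ∧
      F.Legal (.partitionCandidates t) ∧ F.GoalMet g := by
  obtain ⟨C, V, p, hx, hnd, hV, hp, C₁, C₂, hdis, hun, hg⟩ := hx
  have hlen := congrArg List.length hx
  simp only [List.length_append] at hlen
  have hlV := length_le_encodeProfile V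
  have hl0 : (encodeNat 0).length ≤ (encodeNat p).length := length_encodeNat_zero_le p
  have hC₁ : C₁ ⊆ C.toFinset := hun ▸ Finset.subset_union_left
  have hC₂ : C₂ ⊆ C.toFinset := hun ▸ Finset.subset_union_right
  obtain ⟨F, h, rfl, _, rfl, h4, _, rfl, h7, h8, hVs⟩ := exists_correct Q x.length (D := [])
    (W := []) hnd (List.nil_subset _) hV (fun _ hv => absurd hv List.not_mem_nil) hp (k := 0)
    (by simp only [List.length_nil]; omega)
    (fun | 0 => t.survivors (E.winners C₁ V) ∪ C₂ | 1 => C₁ | _ => C₂)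
    (fun
      | 0 => Finset.union_subset
        (((t.survivors_subset _).trans (Q.subset _ _)).trans hC₁) hC₂
      | 1 => hC₁
      | _ + 2 => hC₂) fun _ _ => True
  have h80 : F.cands 0 = t.survivors (E.winners C₁ F.voters) ∪ C₂ := h8 0
  have h81 : F.cands 1 = C₁ := h8 1
  have h82 : F.cands 2 = C₂ := h8 2
  have hnew := numNew_eq_zero h4
  have hall : ∀ s, F.AllVoter s := fun s j _ => (hVs s j).2 trivial
  have hw : E.winners C₁ F.voters = F.wins 1 :=
    h.winners_voters (by norm_num) h81.symm hnew (hall 1)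
  refine ⟨F, h, ?_, ⟨h.candidates_eq_all_iff.1 h7.symm, hnew, hall 0, hall 1,
    fun a ha => ⟨cand_two_iff h hdis (hun.trans h7.symm) h81 h82 ha, ?_⟩⟩, ?_⟩
  · rw [hx, code, h.wf.candidatesCode_eq, h.wf.votersCode_eq, h.wf.nameCode_eq h.target_lt.le]
  · rw [← h.wf.name_mem_cands ha, ← h.wf.name_mem_cands ha, h80, h82, Finset.mem_union, hw,
      h.name_mem_survivors ha]
  · rw [h.winners_voters (by norm_num) h80.symm hnew (hall 0)] at hg
    exact (h.met_iff g).1 hg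

theorem exists_runoffPartitionCandidates {x : List Bool} {t : TieRule}
    (hx : x ∈ controlProblem E g (.runoffPartitionCandidates t)) (Q : Certification E) :
    ∃ F, Correct Q x.length F ∧ x = F.code (.runoffPartitionCandidates t) ∧
      F.Legal (.runoffPartitionCandidates t) ∧ F.GoalMet g := by
  obtain ⟨C, V, p, hx, hnd, hV, hp, C₁, C₂, hdis, hun, hg⟩ := hx
  have hlen := congrArg List.length hx
  simp only [List.length_append] at hlen
  have hlV := length_le_encodeProfile V
  have hl0 : (encodeNat 0).length ≤ (encodeNat p).length := length_encodeNat_zero_le p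
  have hC₁ : C₁ ⊆ C.toFinset := hun ▸ Finset.subset_union_left
  have hC₂ : C₂ ⊆ C.toFinset := hun ▸ Finset.subset_union_right
  obtain ⟨F, h, rfl, _, rfl, h4, _, rfl, h7, h8, hVs⟩ := exists_correct Q x.length (D := [])
    (W := []) hnd (List.nil_subset _) hV (fun _ hv => absurd hv List.not_mem_nil) hp (k := 0)
    (by simp only [List.length_nil]; omega)
    (fun | 0 => t.survivors (E.winners C₁ V) ∪ t.survivors (E.winners C₂ V) | 1 => C₁ | _ => C₂)
    (fun
      | 0 => Finset.union_subset
        (((t.survivors_subset _).trans (Q.subset _ _)).trans hC₁)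
        (((t.survivors_subset _).trans (Q.subset _ _)).trans hC₂)
      | 1 => hC₁
      | _ + 2 => hC₂) fun _ _ => True
  have h80 : F.cands 0 = t.survivors (E.winners C₁ F.voters) ∪
      t.survivors (E.winners C₂ F.voters) := h8 0
  have h81 : F.cands 1 = C₁ := h8 1
  have h82 : F.cands 2 = C₂ := h8 2
  have hnew := numNew_eq_zero h4
  have hall : ∀ s, F.AllVoter s := fun s j _ => (hVs s j).2 trivial
  have hw₁ : E.winners C₁ F.voters = F.wins 1 :=
    h.winners_voters (by norm_num) h81.symm hnew (hall 1)
  have hw₂ : E.winners C₂ F.voters = F.wins 2 :=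
    h.winners_voters (by norm_num) h82.symm hnew (hall 2)
  refine ⟨F, h, ?_, ⟨h.candidates_eq_all_iff.1 h7.symm, hnew, hall 0, hall 1, hall 2,
    fun a ha => ⟨cand_two_iff h hdis (hun.trans h7.symm) h81 h82 ha, ?_⟩⟩, ?_⟩
  · rw [hx, code, h.wf.candidatesCode_eq, h.wf.votersCode_eq, h.wf.nameCode_eq h.target_lt.le]
  · rw [← h.wf.name_mem_cands ha, h80, Finset.mem_union, hw₁, hw₂,
      h.name_mem_survivors ha, h.name_mem_survivors ha]
  · rw [h.winners_voters (by norm_num) h80.symm hnew (hall 0)] at hg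
    exact (h.met_iff g).1 hg

theorem getD_voters {F : Table} {j : ℕ} (hj : j < F.numVoters) : F.voters.getD j [] = F.vote j := by
  simp [voters, hj]

theorem getD_newVoters {F : Table} {i : ℕ} (hi : i < F.numNew) :
    F.newVoters.getD i [] = F.vote (F.numVoters + i) := by
  simp [newVoters, hi]

/-- The indices of the voters in a subcollection. -/
theorem exists_sublist_range {V V' : Profile} (h : V'.Sublist V) :
    ∃ l : List ℕ, l.Sublist (List.range V.length) ∧ V' = l.map fun i => V.getD i [] := by
  rw [← map_getD_range V []] at h
  exact List.sublist_map_iff.1 h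

theorem exists_addVoters {x : List Bool} (hx : x ∈ controlProblem E g .addVoters)
    (Q : Certification E) : ∃ F, Correct Q x.length F ∧ x = F.code .addVoters ∧
      F.Legal .addVoters ∧ F.GoalMet g := by
  obtain ⟨C, V, W, k, p, hx, hnd, hV, hW, hp, W', hW', hk, hg⟩ := hx
  have hlen := congrArg List.length hx
  simp only [List.length_append] at hlen
  have hlV := length_le_encodeProfile V
  have hlW := length_le_encodeProfile W
  obtain ⟨l, hl, rfl⟩ := exists_sublist_range hW'
  obtain ⟨F, h, rfl, _, rfl, rfl, rfl, rfl, h7, h8, hVs⟩ := exists_correct Q x.length (D := [])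
    hnd (List.nil_subset _) hV hW hp (k := k)
    (by simp only [List.length_nil]; omega) (fun _ => C.toFinset)
    (fun _ => subset_rfl) fun _ j => j < V.length ∨ ∃ i ∈ l, V.length + i = j
  rw [length_newVoters] at hl
  rw [List.length_map] at hk
  simp only [length_voters] at hVs
  have hln : l.Nodup := List.nodup_range.sublist hl
  have hlt : ∀ i ∈ l, i < F.numNew := fun i hi => List.mem_range.1 (hl.subset hi)
  have hvote : (l.map fun i => F.newVoters.getD i []) =
      l.map fun i => F.vote (F.numVoters + i) :=
    List.map_congr_left fun i hi => getD_newVoters (hlt i hi)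
  refine ⟨F, h, ?_, ⟨h.candidates_eq_all_iff.1 h7.symm, h.allCand_iff.2 (h8 0).ge,
    fun j hj => (hVs 0 j).2 (Or.inl hj), ?_⟩, ?_⟩
  · rw [hx, code, h.wf.candidatesCode_eq, h.wf.votersCode_eq, h.wf.newVotersCode_eq,
      h.wf.nameCode_eq le_rfl, h.wf.nameCode_eq h.target_lt.le]
  · rw [h.sum_ind_le_limit_iff (h.le 0 3 0 0) fun i => F.Voter 0 (F.numVoters + i),
      sum_ind_eq_length hln]
    · exact hk
    · intro i
      rw [hVs]
      constructor
      · exact fun hi => ⟨hlt i hi, Or.inr ⟨i, hi, rfl⟩⟩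
      · rintro ⟨_, hi | ⟨i', hi', he⟩⟩
        · omega
        · rwa [← Nat.add_left_cancel he]
  · have hL : F.voters ++ (l.map fun i => F.newVoters.getD i []) =
        (List.range F.numVoters ++ l.map (F.numVoters + ·)).map F.vote := by
      rw [hvote]
      simp [voters, Function.comp_def]
    rw [hL, h.winners_eq (s := 0) (by norm_num) (h8 0).symm] at hg
    · exact (h.met_iff g).1 hg
    · refine List.nodup_append'.2 ⟨List.nodup_range, hln.map (add_right_injective _), ?_⟩
      intro j hj hj'
      rw [List.mem_range] at hj
      obtain ⟨i, _, rfl⟩ := List.mem_map.1 hj'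
      omega
    · intro j
      rw [hVs, List.mem_append, List.mem_range, List.mem_map]
      refine ⟨fun hj => ⟨?_, hj⟩, fun hj => hj.2⟩
      rcases hj with hj | ⟨i, hi, rfl⟩
      · unfold numVotes
        omega
      · have := hlt i hi
        unfold numVotes
        omega

theorem exists_deleteVoters {x : List Bool} (hx : x ∈ controlProblem E g .deleteVoters)
    (Q : Certification E) : ∃ F, Correct Q x.length F ∧ x = F.code .deleteVoters ∧
      F.Legal .deleteVoters ∧ F.GoalMet g := by
  obtain ⟨C, V, k, p, hx, hnd, hV, hp, V', hV', hk, hg⟩ := hx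
  have hlen := congrArg List.length hx
  simp only [List.length_append] at hlen
  have hlV := length_le_encodeProfile V
  obtain ⟨l, hl, rfl⟩ := exists_sublist_range hV'
  obtain ⟨F, h, rfl, _, rfl, h4, rfl, rfl, h7, h8, hVs⟩ := exists_correct Q x.length (D := [])
    (W := []) hnd (List.nil_subset _) hV (fun _ hv => absurd hv List.not_mem_nil) hp (k := k)
    (by simp only [List.length_nil]; omega) (fun _ => C.toFinset)
    (fun _ => subset_rfl) fun _ j => j ∈ l
  have hnew := numNew_eq_zero h4
  rw [length_voters] at hl hk
  rw [List.length_map] at hk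
  have hln : l.Nodup := List.nodup_range.sublist hl
  have hlt : ∀ i ∈ l, i < F.numVoters := fun i hi => List.mem_range.1 (hl.subset hi)
  have hvote : (l.map fun i => F.voters.getD i []) = l.map F.vote :=
    List.map_congr_left fun i hi => getD_voters (hlt i hi)
  have hmem : ∀ j, j ∈ l ↔ j < F.numVoters ∧ F.Voter 0 j := fun j => by
    rw [hVs]
    exact ⟨fun hj => ⟨hlt j hj, hj⟩, fun hj => hj.2⟩
  refine ⟨F, h, ?_, ⟨h.candidates_eq_all_iff.1 h7.symm, hnew, h.allCand_iff.2 (h8 0).ge, ?_⟩, ?_⟩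
  · rw [hx, code, h.wf.candidatesCode_eq, h.wf.votersCode_eq,
      h.wf.nameCode_eq le_rfl, h.wf.nameCode_eq h.target_lt.le]
  · refine (h.sum_ind_le_limit_iff (h.le 0 2 0 0) fun j => ¬F.Voter 0 j).2 ?_
    have h1 := sum_ind_eq_length hln hmem
    have h2 := sum_ind_add_sum_ind_not F.numVoters fun j => F.Voter 0 j
    change ∑ j ∈ Finset.range F.numVoters, ind (¬F.Voter 0 j) ≤ _
    omega
  · rw [hvote, h.winners_eq (s := 0) (by norm_num) (h8 0).symm hln] at hg
    · exact (h.met_iff g).1 hg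
    · simpa [numVotes, hnew] using hmem

theorem exists_partitionVoters {x : List Bool} {t : TieRule}
    (hx : x ∈ controlProblem E g (.partitionVoters t)) (Q : Certification E) :
    ∃ F, Correct Q x.length F ∧ x = F.code (.partitionVoters t) ∧
      F.Legal (.partitionVoters t) ∧ F.GoalMet g := by
  obtain ⟨C, V, p, hx, hnd, hV, hp, V₁, V₂, hV₁₂, hg⟩ := hx
  have hlen := congrArg List.length hx
  simp only [List.length_append] at hlen
  have hlV := length_le_encodeProfile V
  have hl0 : (encodeNat 0).length ≤ (encodeNat p).length := length_encodeNat_zero_le p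
  rw [← map_getD_range V []] at hV₁₂
  obtain ⟨l, hl, hl'⟩ := exists_perm_of_perm_map hV₁₂
  obtain ⟨l₁, l₂, rfl, rfl, rfl⟩ := List.map_eq_append_iff.1 hl'
  obtain ⟨F, h, rfl, _, rfl, h4, _, rfl, h7, h8, hVs⟩ := exists_correct Q x.length (D := [])
    (W := []) hnd (List.nil_subset _) hV (fun _ hv => absurd hv List.not_mem_nil) hp (k := 0)
    (by simp only [List.length_nil]; omega)
    (fun
      | 0 => t.survivors (E.winners C.toFinset (l₁.map fun i => V.getD i [])) ∪
        t.survivors (E.winners C.toFinset (l₂.map fun i => V.getD i []))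
      | _ => C.toFinset)
    (fun
      | 0 => Finset.union_subset ((t.survivors_subset _).trans (Q.subset _ _))
        ((t.survivors_subset _).trans (Q.subset _ _))
      | _ + 1 => subset_rfl)
    (fun | 0 => fun _ => True | 1 => fun j => j ∈ l₁ | _ => fun j => j ∈ l₂)
  have h80 : F.cands 0 = t.survivors (E.winners F.candidates.toFinset
      (l₁.map fun i => F.voters.getD i [])) ∪ t.survivors (E.winners F.candidates.toFinset
      (l₂.map fun i => F.voters.getD i [])) := h8 0
  have h81 : F.cands 1 = F.candidates.toFinset := h8 1
  have h82 : F.cands 2 = F.candidates.toFinset := h8 2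
  have hnew := numNew_eq_zero h4
  have hnv : F.numVotes = F.numVoters := by rw [numVotes, hnew, add_zero]
  rw [length_voters] at hl
  have hmem : ∀ j, j ∈ l₁ ∨ j ∈ l₂ ↔ j < F.numVoters := fun j => by
    rw [← List.mem_append, hl.mem_iff, List.mem_range]
  obtain ⟨hn₁, hn₂, hdis⟩ := List.nodup_append'.1 (hl.nodup_iff.2 List.nodup_range)
  have hv₁ : (l₁.map fun i => F.voters.getD i []) = l₁.map F.vote :=
    List.map_congr_left fun i hi => getD_voters ((hmem i).1 (Or.inl hi))
  have hv₂ : (l₂.map fun i => F.voters.getD i []) = l₂.map F.vote :=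
    List.map_congr_left fun i hi => getD_voters ((hmem i).1 (Or.inr hi))
  have hw₁ : E.winners F.candidates.toFinset (l₁.map F.vote) = F.wins 1 :=
    h.winners_eq (by norm_num) h81.symm hn₁ fun j => by
      rw [hVs 1, hnv, ← hmem]
      tauto
  have hw₂ : E.winners F.candidates.toFinset (l₂.map F.vote) = F.wins 2 :=
    h.winners_eq (by norm_num) h82.symm hn₂ fun j => by
      rw [hVs 2, hnv, ← hmem]
      tauto
  have hall : F.AllVoter 0 := fun j _ => (hVs 0 j).2 trivial
  refine ⟨F, h, ?_, ⟨h.candidates_eq_all_iff.1 h7.symm, hnew, h.allCand_iff.2 h81.ge,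
    h.allCand_iff.2 h82.ge, hall, fun j hj => ?_, fun a ha => ?_⟩, ?_⟩
  · rw [hx, code, h.wf.candidatesCode_eq, h.wf.votersCode_eq, h.wf.nameCode_eq h.target_lt.le]
  · rw [hnv, ← hmem] at hj
    rw [hVs 1, hVs 2]
    exact ⟨fun h2 h1 => hdis h1 h2, hj.resolve_left⟩
  · rw [← h.wf.name_mem_cands ha, h80]
    simp only [hv₁, hv₂, hw₁, hw₂]
    rw [Finset.mem_union, h.name_mem_survivors ha, h.name_mem_survivors ha]
  · rw [h.winners_voters (by norm_num) h80.symm hnew hall] at hg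
    exact (h.met_iff g).1 hg

/-- Every yes-instance is described by a correct table with a legal action that meets the
goal. -/
theorem exists_of_mem {x : List Bool} {action : Action} (hx : x ∈ controlProblem E g action)
    (Q : Certification E) : ∃ F, Correct Q x.length F ∧ x = F.code action ∧
      F.Legal action ∧ F.GoalMet g := by
  cases action with
  | addCandidates => exact exists_addCandidates hx Q
  | addCandidatesUnlimited => exact exists_addCandidatesUnlimited hx Q
  | deleteCandidates => exact exists_deleteCandidates hx Q
  | deleteDeletableCandidates => exact exists_deleteDeletableCandidates hx Q
  | partitionCandidates t => exact exists_partitionCandidates hx Q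
  | runoffPartitionCandidates t => exact exists_runoffPartitionCandidates hx Q
  | addVoters => exact exists_addVoters hx Q
  | deleteVoters => exact exists_deleteVoters hx Q
  | partitionVoters t => exact exists_partitionVoters hx Q

/-! ### Definability of the control problems -/

instance definableStr_nameCode {a : World → (ℕ → ℕ) → ℕ} [Definable a] :
    DefinableStr fun w v => nameCode (w.tab 0) (a w v) := by
  refine DefinableStr.comp₁ (F := fun w => nameCode (w.tab 0)) ?_
  unfold nameCode
  infer_instance

instance definableStr_voteCode {a : World → (ℕ → ℕ) → ℕ} [Definable a] :
    DefinableStr fun w v => voteCode (w.tab 0) (a w v) := by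
  refine DefinableStr.comp₁ (F := fun w => voteCode (w.tab 0)) ?_
  unfold voteCode
  infer_instance

instance definableStr_candidatesCode : DefinableStr fun w _ => candidatesCode (w.tab 0) := by
  unfold candidatesCode
  infer_instance

instance definableStr_extrasCode : DefinableStr fun w _ => extrasCode (w.tab 0) := by
  unfold extrasCode
  infer_instance

instance definableStr_votersCode : DefinableStr fun w _ => votersCode (w.tab 0) := by
  unfold votersCode
  infer_instance

instance definableStr_newVotersCode : DefinableStr fun w _ => newVotersCode (w.tab 0) := by
  unfold newVotersCode
  infer_instance

instance definableStr_code (action : Action) : DefinableStr fun w _ => code (w.tab 0) action := by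
  cases action <;> unfold code <;> infer_instance

set_option synthInstance.maxHeartbeats 400000 in
set_option synthInstance.maxSize 20000 in
instance definablePred_wellFormed :
    DefinablePred fun w _ => WellFormed w.size (w.tab 0) := by
  unfold WellFormed
  infer_instance

instance definablePred_goalMet (g : Goal) : DefinablePred fun w _ => GoalMet (w.tab 0) g := by
  cases g <;> unfold GoalMet <;> infer_instance

instance definablePred_survives {s a : World → (ℕ → ℕ) → ℕ} [Definable s] [Definable a]
    (t : TieRule) : DefinablePred fun w v => Survives (w.tab 0) (s w v) (a w v) t := by
  refine DefinablePred.comp₂ (F := fun w s a => Survives (w.tab 0) s a t) ?_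
  cases t <;> simp only [Survives] <;> infer_instance

set_option synthInstance.maxHeartbeats 400000 in
set_option synthInstance.maxSize 20000 in
instance definablePred_legal (action : Action) :
    DefinablePred fun w _ => Legal (w.tab 0) action := by
  cases action <;> unfold Legal <;>
    simp only [ExtrasNew, ExtrasOld, AllCand, AllVoter] <;> infer_instance

section Checked

variable {E : System} (Q : Certification E) {s c d e f : World → (ℕ → ℕ) → ℕ}
  [hs : Definable s] [hc : Definable c] [hd : Definable d] [he : Definable e] [hf : Definable f]

instance definablePred_valid : DefinablePred fun w v => Q.Valid (numAll (w.tab 0))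
    (numVotes (w.tab 0)) (Cand (w.tab 0) (s w v)) (Voter (w.tab 0) (s w v)) (rank (w.tab 0))
    (c w v) (w.tab (d w v) (e w v) (f w v)) :=
  Q.definable_valid.subst (fun
    | 0 => fun w _ => numAll (w.tab 0)
    | 1 => fun w _ => numVotes (w.tab 0)
    | 2 => s | 3 => c | 4 => d | 5 => e | _ => f) fun
    | 0 => (inferInstance : Definable fun w _ => numAll (w.tab 0))
    | 1 => (inferInstance : Definable fun w _ => numVotes (w.tab 0))
    | 2 => hs | 3 => hc | 4 => hd | 5 => he | _ + 6 => hf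

instance definable_cost : Definable fun w v => Q.cost (numAll (w.tab 0))
    (numVotes (w.tab 0)) (Cand (w.tab 0) (s w v)) (Voter (w.tab 0) (s w v)) (rank (w.tab 0))
    (w.tab (d w v) (e w v) (f w v)) :=
  Q.definable_cost.subst (fun
    | 0 => fun w _ => numAll (w.tab 0)
    | 1 => fun w _ => numVotes (w.tab 0)
    | 2 => s | 3 => d | 4 => e | _ => f) fun
    | 0 => (inferInstance : Definable fun w _ => numAll (w.tab 0))
    | 1 => (inferInstance : Definable fun w _ => numVotes (w.tab 0))
    | 2 => hs | 3 => hd | 4 => he | _ + 5 => hf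

instance definablePred_checked :
    DefinablePred fun w v => Checked Q (w.tab 0) (w.tab 1 0 0) (s w v) := by
  refine DefinablePred.comp₁ (F := fun w => Checked Q (w.tab 0) (w.tab 1 0 0)) ?_
  simp only [Checked, Certification.Beats, cert]
  infer_instance

end Checked

end Table

/-- The control problems for a certified election system are in `Σ₂ᵖ`: a correct table is guessed
existentially, and the tables that challenge its winners are guessed universally. -/
theorem Certification.controlProblem_mem {E : System} (Q : Certification E) (g : Goal)
    (action : Action) : controlProblem E g action ∈ Complexity.SigmaTwo := by
  have hch : DefinablePred fun w _ =>
      ∀ s, s < 3 → Table.Checked Q (w.tab 0) (w.tab 1 0 0) s :=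
    DefinablePred.all (f := fun _ _ => 3)
      (S := fun w _ s => Table.Checked Q (w.tab 0) (w.tab 1 0 0) s)
  have hcode : DefinablePred fun w _ => w.x = Table.code (w.tab 0) action := inferInstance
  refine Complexity.mem_SigmaTwo_of_definable (fun w => Table.WellFormed w.size (w.tab 0) ∧
    (∀ s, s < 3 → Table.Checked Q (w.tab 0) (w.tab 1 0 0) s) ∧ w.x = Table.code (w.tab 0) action ∧
    Table.Legal (w.tab 0) action ∧ Table.GoalMet (w.tab 0) g) inferInstance _ fun x => ?_
  constructor
  · intro hx
    obtain ⟨F, h, hcode, hl, hg⟩ := Table.exists_of_mem hx Q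
    obtain ⟨Y, hY⟩ := Complexity.exists_tableOf F h.le
    refine ⟨Y, fun Z => ?_⟩
    have hF : World.tab ⟨x, Y, Z⟩ 0 = F := hY
    rw [hF]
    exact ⟨h.wf, fun s hs => h.checked s hs _ fun j b => Complexity.tableOf_le _ _ _ _ _ _,
      hcode, hl, hg⟩
  · rintro ⟨Y, hY⟩
    have h0 := hY fun _ => false
    have h : Table.Correct Q x.length (Complexity.tableOf x.length Y) := by
      refine ⟨Complexity.tableOf_le _ _, h0.1, fun s hs T hT => ?_⟩
      obtain ⟨Z, hZ⟩ := Complexity.exists_tableOf (fun _ _ => T) fun _ _ => hT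
      have := (hY Z).2.1 s hs
      have hT' : World.tab ⟨x, Y, Z⟩ 1 0 0 = T := congrFun (congrFun hZ 0) 0
      rwa [hT'] at this
    have := h.code_mem h0.2.2.2.1 h0.2.2.2.2
    rwa [show x = _ from h0.2.2.1]

end Election

theorem corollary3p2 (E : Election.System)
    (hE : E = Election.kemeny ∨ E = Election.young ∨ E = Election.dodgson)
    (action : Election.Action) (goal : Election.Goal) :
    Election.controlProblem E goal action ∈ Complexity.SigmaTwo := by
  rcases hE with rfl | rfl | rfl
  · exact Election.kemenyCertification.controlProblem_mem goal action
  · exact Election.youngCertification.controlProblem_mem goal action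
  · exact Election.dodgsonCertification.controlProblem_mem goal action
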